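/- **Definitions.** Words are over $\{0,1\}$. A *parameterized enumeration problem* is a triple $(L,\mathrm{Sol},\kappa)$ with a decidable set $L$ of words, a computable map $\mathrm{Sol}$ from words to finite sets of words such that $\mathrm{Sol}(x)\neq\emptyset$ if and only if $x\in L$, and a map $\kappa$ from words to $\mathbb N$. A *polynomial-delay (PD) kernel* for it is a pair of algorithms $(\mathcal A_1,\mathcal A_2)$ such that: * on input $x$ and $\kappa(x)$, the compression algorithm $\mathcal A_1$ outputs, in time polynomial in $|x|+\kappa(x)$, a word $y$ such that $|y|,\kappa(y)\le f(\kappa(x))$ for some computable function $f$, and $\mathrm{Sol}(y)\neq\emptyset$ if and only if $\mathrm{Sol}(x)\neq\emptyset$; * on input $x$, $y$, $\kappa(x)$, $\kappa(y)$ and some $Y\in\mathrm{Sol}(y)$, the lifting algorithm $\mathcal A_2$ outputs without repetition the elements of a (possibly empty) set $S_Y\subseteq\mathrm{Sol}(x)$, where the time before the first output, between two consecutive outputs, and after the last output is polynomial in $|x|+|y|+|Y|+\kappa(x)+\kappa(y)$; and every element of $\mathrm{Sol}(x)$ lies in $S_Y$ for exactly one $Y\in \mathrm{Sol}(y)$.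 *Enum Vertex Cover*, parameterized by $k$: given a finite simple graph $G$ and an integer $k\ge 0$, enumerate all vertex covers of $G$ of size at most $k$; its parameter is $k$. A *crown decomposition* of a graph $G$ is a partition $(C,H,B)$ of $V(G)$ such that $C$ is independent, $N_G(C)=H$, and some matching between $H$ and $C$ saturates $H$. It is *heavy with respect to $t$* if $|H|\le t$ and $|B|+2|H|\le 3t$. **Theorem.** Enum Vertex Cover, parameterized by the maximum solution size $k$, has a PD kernel in which the output graph has at most $3k$ vertices (only if $k=0$ and $G$ has an edge, so that the instance has no solution, the output graph has $2$ vertices instead). Moreover, there is such a kernel with the following properties. Let $(G,k)$ be the input, and let $G_0$ be obtained from $G$ by removing all isolated vertices. 1. If $|V(G_0)|\le 3k$, the output is $(G_0,k)$. If $|V(G_0)|>3k$, the output is either $(K_2,0)$, and then $G$ has no vertex cover of size at most $k$, or $(G_0\setminus L,k)$, where $L=C\setminus V(M)$ for some crown decomposition $(C,H,B)$ of $G_0$ that is heavy with respect to $k$ and some $H$-saturating matching $M$ between $H$ and $C$. (Graphs are output up to renaming of the vertices.) 2. If the output is $(G',k)$ with $G'=G_0$ or $G'=G_0\setminus L$ as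 above, and $Y$ is a vertex cover of $G'$ of size at most $k$, let $F$ be the set of the vertices in $V(G)\setminus V(G')$ that have a neighbor in $V(G')\setminus Y$. Then $S_Y$ consists of the sets $Y\cup F\cup Z$ of size at most $k$ with $Z\subseteq V(G)\setminus(V(G')\cup F)$. -/

import Mathlib

/-! ### Algorithms: random access machines with outputs -/

/-- Words over the binary alphabet. -/
abbrev Word : Type := List Bool

namespace RAM

/-- Side-effect free expressions. `reg r` is the content of register `r`, `cell a e` the content of
the cell of array `a` whose address is the value of `e`; `sub` is truncated subtraction. There is
no multiplication, so unit cost per instruction is polynomially related to Turing machine time. -/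
inductive Exp : Type
  | lit (c : ℕ)
  | reg (r : ℕ)
  | cell (a : ℕ) (e : Exp)
  | add (e f : Exp)
  | sub (e f : Exp)

/-- Programs. A program mentions only finitely many registers and arrays. `put e` appends one bit
(is `e` nonzero?) to the output buffer, and `emit` delivers the buffer as one output and empties
it. -/
inductive Cmd : Type
  | skip
  | assign (r : ℕ) (e : Exp)
  | store (a : ℕ) (i e : Exp)
  | put (e : Exp)
  | emit
  | seq (c d : Cmd)
  | ite (e : Exp) (c d : Cmd)
  | loop (e : Exp) (c : Cmd)

/-- Registers, (unbounded) arrays and the output buffer. -/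
structure State : Type where
  regs : ℕ → ℕ
  arrs : ℕ → ℕ → ℕ
  buf : Word

/-- The value of an expression. -/
def Exp.eval (s : State) : Exp → ℕ
  | .lit c => c
  | .reg r => s.regs r
  | .cell a e => s.arrs a (e.eval s)
  | .add e f => e.eval s + f.eval s
  | .sub e f => e.eval s - f.eval s

/-- What an observer with a clock sees of a run: `none` is the passing of one time unit, and
`some w` is the output of the word `w`. -/
abbrev Trace : Type := List (Option Word)

/-- `Exec c s t s'`: started in state `s`, the program `c` halts in state `s'`, with trace `t`.
Every instruction and every evaluation of a test takes one time unit. -/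
inductive Exec : Cmd → State → Trace → State → Prop
  | skip (s : State) : Exec .skip s [none] s
  | assign (r : ℕ) (e : Exp) (s : State) :
      Exec (.assign r e) s [none] { s with regs := Function.update s.regs r (e.eval s) }
  | store (a : ℕ) (i e : Exp) (s : State) :
      Exec (.store a i e) s [none]
        { s with arrs := Function.update s.arrs a
                  (Function.update (s.arrs a) (i.eval s) (e.eval s)) }
  | put (e : Exp) (s : State) :
      Exec (.put e) s [none] { s with buf := s.buf ++ [decide (e.eval s ≠ 0)] }
  | emit (s : State) : Exec .emit s [none, some s.buf] { s with buf := [] }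
  | seq {c d : Cmd} {s s' s'' : State} {t t' : Trace} :
      Exec c s t s' → Exec d s' t' s'' → Exec (.seq c d) s (t ++ t') s''
  | ite_true {e : Exp} {c d : Cmd} {s s' : State} {t : Trace} :
      e.eval s ≠ 0 → Exec c s t s' → Exec (.ite e c d) s (none :: t) s'
  | ite_false {e : Exp} {c d : Cmd} {s s' : State} {t : Trace} :
      e.eval s = 0 → Exec d s t s' → Exec (.ite e c d) s (none :: t) s'
  | loop_true {e : Exp} {c : Cmd} {s s' s'' : State} {t t' : Trace} :
      e.eval s ≠ 0 → Exec c s t s' → Exec (.loop e c) s' t' s'' →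
        Exec (.loop e c) s (none :: (t ++ t')) s''
  | loop_false {e : Exp} {c : Cmd} {s : State} :
      e.eval s = 0 → Exec (.loop e c) s [none] s

/-- The state in which a program starts on input words `ws` and input numbers `ns`: the `j`-th word
is in array `j`, one bit per cell; the lengths of the words, followed by the numbers, are in the
registers `0, 1, 2, …`; all other registers and cells are zero, and the output buffer is empty. -/
def State.init (ws : List Word) (ns : List ℕ) : State where
  regs r := (ws.map List.length ++ ns).getD r 0
  arrs a i := ((ws.getD a []).getD i false).toNat
  buf := []

/-- The running time of a run. -/
def Trace.time (t : Trace) : ℕ := t.count none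

/-- The words that a run outputs, in this order. -/
def Trace.outputs (t : Trace) : List Word := t.reduceOption

/-- The delay of a run is at most `d`: at most `d` time units pass before the first output, between
two consecutive outputs, and after the last output. -/
def Trace.DelayLE (t : Trace) (d : ℕ) : Prop :=
  ∀ m : ℕ, List.replicate m none <:+: t → m ≤ d

end RAM

/-! ### Parameterized enumeration problems and polynomial-delay kernels -/

/-- A parameterized enumeration problem over the binary alphabet: a decidable language `L`, a
computable function `Sol` from words to finite sets of words such that `Sol x` is nonempty exactly
for `x` in `L`, and a parameterization `κ`. -/
structure ParamEnumProblem : Type where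
  L : Set Word
  Sol : Word → Finset Word
  κ : Word → ℕ
  sol_nonempty_iff : ∀ x, (Sol x).Nonempty ↔ x ∈ L
  decidable_L : ComputablePred fun x => x ∈ L
  computable_Sol : ∃ f : Word → List Word, Computable f ∧ ∀ x, (f x).toFinset = Sol x

/-- A polynomial-delay kernel. `compress x` is the output of the compression algorithm on `x`, and
`lift x Y` is the list of outputs of the lifting algorithm for `x` and a solution `Y` of
`compress x`. -/
structure PDKernel (P : ParamEnumProblem) : Type where
  /-- The function computed by the compression algorithm. -/
  compress : Word → Word
  /-- The solutions listed by the lifting algorithm. -/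
  lift : Word → Word → List Word
  /-- The compression algorithm. -/
  compressProg : RAM.Cmd
  /-- The lifting algorithm. -/
  liftProg : RAM.Cmd
  /-- The running time of the compression algorithm. -/
  time : Polynomial ℕ
  /-- The delay of the kernel. -/
  delay : Polynomial ℕ
  /-- The size of the kernel. -/
  size : ℕ → ℕ
  size_computable : Computable size
  compress_run : ∀ x, ∃ t s, RAM.Exec compressProg (RAM.State.init [x] [P.κ x]) t s ∧
    RAM.Trace.outputs t = [compress x] ∧ RAM.Trace.time t ≤ time.eval (x.length + P.κ x)
  κ_compress_le : ∀ x, P.κ (compress x) ≤ size (P.κ x)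
  length_compress_le : ∀ x, (compress x).length ≤ size (P.κ x)
  sol_compress_nonempty_iff : ∀ x, (P.Sol (compress x)).Nonempty ↔ (P.Sol x).Nonempty
  lift_run : ∀ x, ∀ Y ∈ P.Sol (compress x), ∃ t s,
    RAM.Exec liftProg
      (RAM.State.init [x, compress x, Y] [P.κ x, P.κ (compress x)]) t s ∧
    RAM.Trace.outputs t = lift x Y ∧
    RAM.Trace.DelayLE t
      (delay.eval (x.length + (compress x).length + Y.length + P.κ x + P.κ (compress x)))
  lift_nodup : ∀ x, ∀ Y ∈ P.Sol (compress x), (lift x Y).Nodup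
  lift_disjoint : ∀ x, ∀ Y ∈ P.Sol (compress x), ∀ Y' ∈ P.Sol (compress x), Y ≠ Y' →
    (lift x Y).Disjoint (lift x Y')
  lift_cover : ∀ x S, S ∈ P.Sol x ↔ ∃ Y ∈ P.Sol (compress x), S ∈ lift x Y

/-! ### The problem Enum Vertex Cover -/

namespace EnumVC

/-- An instance of Vertex Cover: a graph with vertex set `Fin n`, and a natural number `k`. -/
structure Instance : Type where
  n : ℕ
  graph : SimpleGraph (Fin n)
  k : ℕ

/-- The number of leading ones of a word. -/
def ones (w : Word) : ℕ := w.idxOf false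

/-- The word `1ᵏ 0 1ⁿ 0 b` represents `k` and the graph on `n` vertices in which distinct `i` and
`j` are adjacent if the bit number `i * n + j` or the bit number `j * n + i` of `b` is one (that is,
`b` is the adjacency matrix). Missing bits count as zero, so that every word represents an
instance. -/
def kOf (w : Word) : ℕ := ones w

/-- The number of vertices of the graph that a word represents. -/
def nOf (w : Word) : ℕ := ones (w.drop (kOf w + 1))

/-- The bit in row `i` and column `j` of the adjacency matrix that a word represents. -/
def bitOf (w : Word) (i j : ℕ) : Bool :=
  w.getD (kOf w + 1 + (nOf w + 1) + (i * nOf w + j)) false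

/-- The instance that a word represents. -/
def decode (w : Word) : Instance where
  n := nOf w
  graph :=
    { Adj := fun i j => i ≠ j ∧ (bitOf w i j = true ∨ bitOf w j i = true)
      symm := ⟨fun _ _ h => ⟨h.1.symm, h.2.symm⟩⟩
      loopless := ⟨fun _ h => h.1 rfl⟩ }
  k := kOf w

/-- The characteristic vector of a set of vertices. -/
def charVec {n : ℕ} (S : Finset (Fin n)) : Word := List.ofFn fun i => decide (i ∈ S)

open Classical in
/-- The vertex covers of size at most `k`, as characteristic vectors. -/
noncomputable def sol (w : Word) : Finset Word :=
  (Finset.univ.filter fun S : Finset (Fin (decode w).n) =>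
    (decode w).graph.IsVertexCover (S : Set (Fin (decode w).n)) ∧ S.card ≤ (decode w).k).image
      charVec

end EnumVC

namespace EnumVC

/-- All words of length `n`. -/
def allWords (n : ℕ) : List Word :=
  n.rec [[]] fun _ l => l.flatMap fun w => [true :: w, false :: w]

theorem mem_allWords (n : ℕ) (w : Word) : w ∈ allWords n ↔ w.length = n := by
  induction n generalizing w with
  | zero => simp [allWords]
  | succ n ih =>
    have h : allWords (n + 1) = (allWords n).flatMap fun w => [true :: w, false :: w] := rfl
    rw [h]
    cases w with
    | nil => simp
    | cons b w => cases b <;> simp [ih]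

/-- A bit vector describes a vertex cover of size at most `k`. -/
def Good (v w : Word) : Prop :=
  v.count true ≤ kOf w ∧
    ∀ i < nOf w, ∀ j < nOf w, i = j ∨ bitOf w i j = false ∨ v.getD i false = true ∨
      v.getD j false = true

instance : DecidableRel Good := fun v w => by unfold Good; infer_instance

theorem primrec_allWords : Primrec allWords := by
  refine Primrec.nat_rec₁ _ ?_
  refine (Primrec.list_flatMap Primrec.snd ?_)
  refine Primrec.list_cons.comp (Primrec.list_cons.comp (.const true) .snd)
    (Primrec.list_cons.comp (Primrec.list_cons.comp (.const false) .snd) (.const []))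

theorem primrec_kOf : Primrec kOf := Primrec.list_idxOf.comp (.const false) .id

theorem primrec_nOf : Primrec nOf :=
  primrec_kOf.comp (Primrec.list_drop.comp (Primrec.succ.comp primrec_kOf) .id)

theorem primrec_bitOf : Primrec fun p : Word × ℕ × ℕ => bitOf p.1 p.2.1 p.2.2 := by
  have hk := primrec_kOf.comp (Primrec.fst (α := Word) (β := ℕ × ℕ))
  have hn := primrec_nOf.comp (Primrec.fst (α := Word) (β := ℕ × ℕ))
  have hi := Primrec.fst.comp (Primrec.snd (α := Word) (β := ℕ × ℕ))
  have hj := Primrec.snd.comp (Primrec.snd (α := Word) (β := ℕ × ℕ))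
  exact (Primrec.list_getD false).comp .fst
    (Primrec.nat_add.comp
      (Primrec.nat_add.comp (Primrec.succ.comp hk) (Primrec.succ.comp hn))
      (Primrec.nat_add.comp (Primrec.nat_mul.comp hi hn) hj))

theorem primrec_count : Primrec fun v : Word => v.count true := by
  have h : Primrec fun v : Word => (v.filter fun b => b = true).length :=
    Primrec.list_length.comp (Primrec.listFilter (Primrec.eq.comp .id (.const true)))
  exact h.of_eq fun v => by simp [List.count, List.countP_eq_length_filter]

theorem primrecRel_good : PrimrecRel Good := by
  have h4 : PrimrecRel fun (j : ℕ) (q : ℕ × Word × Word) =>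
      q.1 = j ∨ bitOf q.2.2 q.1 j = false ∨ q.2.1.getD q.1 false = true ∨
        q.2.1.getD j false = true := by
    have hj : Primrec fun p : ℕ × ℕ × Word × Word => p.1 := Primrec.fst
    have hi : Primrec fun p : ℕ × ℕ × Word × Word => p.2.1 := Primrec.fst.comp .snd
    have hv : Primrec fun p : ℕ × ℕ × Word × Word => p.2.2.1 :=
      Primrec.fst.comp (Primrec.snd.comp .snd)
    have hw : Primrec fun p : ℕ × ℕ × Word × Word => p.2.2.2 :=
      Primrec.snd.comp (Primrec.snd.comp .snd)
    exact (Primrec.eq.comp hi hj).or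
      ((Primrec.eq.comp (primrec_bitOf.comp (hw.pair (hi.pair hj))) (.const false)).or
        ((Primrec.eq.comp ((Primrec.list_getD false).comp hv hi) (.const true)).or
          (Primrec.eq.comp ((Primrec.list_getD false).comp hv hj) (.const true))))
  have h3' : PrimrecPred fun p : ℕ × Word × Word =>
      ∀ j < nOf p.2.2, p.1 = j ∨ bitOf p.2.2 p.1 j = false ∨ p.2.1.getD p.1 false = true ∨
        p.2.1.getD j false = true :=
    (PrimrecRel.comp (R := fun (m : List ℕ) (q : ℕ × Word × Word) => ∀ j ∈ m, q.1 = j ∨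
      bitOf q.2.2 q.1 j = false ∨ q.2.1.getD q.1 false = true ∨ q.2.1.getD j false = true)
      (PrimrecRel.forall_mem_list h4)
      (Primrec.list_range.comp (primrec_nOf.comp (Primrec.snd.comp .snd))) Primrec.id).of_eq
      fun p => by simp
  have h3 : PrimrecRel fun (i : ℕ) (q : Word × Word) =>
      ∀ j < nOf q.2, i = j ∨ bitOf q.2 i j = false ∨ q.1.getD i false = true ∨
        q.1.getD j false = true := h3'
  have h2 : PrimrecPred fun q : Word × Word =>
      ∀ i < nOf q.2, ∀ j < nOf q.2, i = j ∨ bitOf q.2 i j = false ∨ q.1.getD i false = true ∨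
        q.1.getD j false = true :=
    (PrimrecRel.comp (R := fun (m : List ℕ) (q : Word × Word) => ∀ i ∈ m, ∀ j < nOf q.2, i = j ∨
      bitOf q.2 i j = false ∨ q.1.getD i false = true ∨ q.1.getD j false = true)
      (PrimrecRel.forall_mem_list h3) (Primrec.list_range.comp (primrec_nOf.comp .snd))
      Primrec.id).of_eq fun p => by simp
  exact (Primrec.nat_le.comp (primrec_count.comp .fst) (primrec_kOf.comp .snd)).and h2

theorem charVec_getD {n : ℕ} (S : Finset (Fin n)) (i : Fin n) :
    (charVec S).getD i false = decide (i ∈ S) := by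
  simp [charVec, List.getD]

theorem charVec_count {n : ℕ} (S : Finset (Fin n)) : (charVec S).count true = S.card := by
  have h : (charVec S).count true = ((List.finRange n).filter fun i => decide (i ∈ S)).length := by
    rw [charVec, List.ofFn_eq_map, List.count, List.countP_map, List.countP_eq_length_filter]
    congr 1
    exact List.filter_congr fun i _ => by simp
  rw [h, ← List.toFinset_card_of_nodup ((List.nodup_finRange n).filter _)]
  congr 1
  ext i
  simp

theorem exists_charVec {n : ℕ} (v : Word) (h : v.length = n) :
    ∃ S : Finset (Fin n), charVec S = v := by
  refine ⟨Finset.univ.filter fun i => v.getD i false = true, ?_⟩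
  subst h
  apply List.ext_getElem <;> simp [charVec]

theorem mem_sol (w v : Word) : v ∈ sol w ↔ v.length = nOf w ∧ Good v w := by
  have key : ∀ S : Finset (Fin (nOf w)),
      ((decode w).graph.IsVertexCover (S : Set (Fin (nOf w))) ∧ S.card ≤ kOf w) ↔
        Good (charVec S) w := by
    intro S
    unfold Good
    rw [charVec_count, and_comm]
    refine and_congr Iff.rfl ⟨fun h i hi j hj => ?_, fun h (i : Fin (nOf w)) (j : Fin (nOf w)) hij => ?_⟩
    · by_cases hne : i = j
      · exact .inl hne
      by_cases hb : bitOf w i j = true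
      · have := h (v := (⟨i, hi⟩ : Fin (nOf w))) (w := (⟨j, hj⟩ : Fin (nOf w)))
          ⟨fun e => hne (congrArg Fin.val e), .inl hb⟩
        have e1 := charVec_getD S ⟨i, hi⟩
        have e2 := charVec_getD S ⟨j, hj⟩
        simp only at e1 e2
        rw [e1, e2]
        simpa using .inr (.inr this)
      · exact .inr (.inl (by simpa using hb))
    · have hne : (i : ℕ) ≠ j := fun e => hij.1 (Fin.ext e)
      have h1 := h i i.2 j j.2
      have h2 := h j j.2 i i.2
      have e1 := charVec_getD S i
      have e2 := charVec_getD S j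
      rw [e1, e2] at h1
      rw [e1, e2] at h2
      rcases hij.2 with hb | hb
      · have h3 : i ∈ S ∨ j ∈ S := by simpa [hne, hb] using h1
        exact h3
      · have h3 : i ∈ S ∨ j ∈ S := by simpa [hne.symm, hb, or_comm] using h2
        exact h3
  constructor
  · intro h
    simp only [sol, Finset.mem_image, Finset.mem_filter, Finset.mem_univ, true_and] at h
    obtain ⟨S, hS, rfl⟩ := h
    exact ⟨by simp [charVec, decode], (key S).1 hS⟩
  · rintro ⟨hl, hg⟩
    obtain ⟨S, rfl⟩ := exists_charVec v hl
    simp only [sol, Finset.mem_image, Finset.mem_filter, Finset.mem_univ, true_and]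
    exact ⟨S, (key S).2 hg, rfl⟩

theorem computable_sol :
    ∃ f : Word → List Word, Computable f ∧ ∀ x, (f x).toFinset = sol x := by
  refine ⟨fun w => (allWords (nOf w)).filter fun v => Good v w, Primrec.to_comp ?_, fun w => ?_⟩
  · exact (PrimrecRel.listFilter primrecRel_good).comp (primrec_allWords.comp primrec_nOf) .id
  · ext v
    simp [mem_sol, mem_allWords]

theorem decidable_sol_nonempty : ComputablePred fun x => x ∈ {x : Word | (sol x).Nonempty} := by
  obtain ⟨f, hf, h⟩ := computable_sol
  have hp : ComputablePred fun l : List Word => l ≠ [] :=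
    (Primrec.eq.comp Primrec.id (.const [])).not.computablePred
  refine (hp.computable_of_manyOneReducible ⟨f, hf, fun x => ?_⟩)
  simp only [Set.mem_ofPred_eq, ← h x, List.toFinset_nonempty_iff]

end EnumVC

/-- Enum Vertex Cover parameterized by the maximum solution size `k`: given a graph and a natural
number `k`, enumerate all vertex covers of size at most `k`. -/
noncomputable def enumVertexCover : ParamEnumProblem where
  L := {x | (EnumVC.sol x).Nonempty}
  Sol := EnumVC.sol
  κ x := (EnumVC.decode x).k
  sol_nonempty_iff _ := Iff.rfl
  decidable_L := EnumVC.decidable_sol_nonempty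
  computable_Sol := EnumVC.computable_sol

/-! ### Heavy-crown decompositions -/

namespace EnumVC

/-- `(C, H, B)` is a crown decomposition of the induced subgraph `G[W]`, with crown `C`, head `H`
and body `B`, and `m` is a matching of the whole head into the crown. -/
structure IsCrownDecomposition {V : Type} [DecidableEq V] (G : SimpleGraph V) (W : Set V)
    (C H B : Finset V) (m : V → V) : Prop where
  union_eq : ((C ∪ H ∪ B : Finset V) : Set V) = W
  disjoint_CH : Disjoint C H
  disjoint_CB : Disjoint C B
  disjoint_HB : Disjoint H B
  indep : ∀ u ∈ C, ∀ v ∈ C, ¬ G.Adj u v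
  neighbors : ∀ v ∈ W, v ∈ H ↔ ∃ c ∈ C, G.Adj c v
  matching_mem : ∀ h ∈ H, m h ∈ C
  matching_adj : ∀ h ∈ H, G.Adj h (m h)
  matching_inj : ∀ h ∈ H, ∀ h' ∈ H, m h = m h' → h = h'

/-- A crown decomposition is heavy with respect to `t` if `|H| ≤ t` and `|B| + 2 |H| ≤ 3 t`. -/
structure IsHeavyCrownDecomposition {V : Type} [DecidableEq V] (G : SimpleGraph V) (W : Set V)
    (C H B : Finset V) (m : V → V) (t : ℕ) : Prop
    extends IsCrownDecomposition G W C H B m where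
  width_le : H.card ≤ t
  heavy : B.card + 2 * H.card ≤ 3 * t

/-- `J` arises from `I`, with the same `k`, by deleting the isolated vertices and then, if more
than `3 k` vertices are left, also the unmatched crown vertices of a heavy-crown decomposition;
`φ` identifies the vertices of `J` with the remaining vertices of `I`. -/
def IsCrownReduction (I J : Instance) (φ : J.graph ↪g I.graph) : Prop :=
  J.k = I.k ∧
    ((I.graph.support.ncard ≤ 3 * I.k ∧ Set.range φ = I.graph.support) ∨
     (3 * I.k < I.graph.support.ncard ∧ ∃ (C H B : Finset (Fin I.n)) (m : Fin I.n → Fin I.n),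
        IsHeavyCrownDecomposition I.graph I.graph.support C H B m I.k ∧
        Set.range φ = I.graph.support \ ((C \ H.image m : Finset (Fin I.n)) : Set (Fin I.n))))

/-- The sets of size at most `k` obtained from a vertex cover `Y` of `J` by adding all the forced
vertices (the deleted vertices with a neighbor in `J` that is not in `Y`) and then a set `Z` of
other deleted vertices. -/
def lifted (I J : Instance) (φ : J.graph ↪g I.graph) (Y : Finset (Fin J.n)) :
    Set (Finset (Fin I.n)) :=
  {S | S.card ≤ I.k ∧ ∃ F Z : Finset (Fin I.n),
    (∀ v, v ∈ F ↔ v ∉ Set.range φ ∧ ∃ u, u ∉ Y ∧ I.graph.Adj v (φ u)) ∧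
    (∀ v ∈ Z, v ∉ Set.range φ ∧ v ∉ F) ∧
    S = Y.image φ ∪ F ∪ Z}

end EnumVC

/-! Reduction. Suppose that `G` has `n` vertices, more than `3k` of them not isolated. A greedy
maximal matching with `m` edges marks a set `A` of `2m` vertices; the unmarked vertices are
independent, and `m > k` excludes a solution. A second matching `M`, between `A` and the unmarked
vertices, comes from an auction. All labels start at 0. An unmarked, unmatched vertex bids for its
neighbor of least label: it becomes the partner of that neighbor, expels the previous partner, and
the label grows by one. Bidding ends when the unmarked, unmatched vertices have only neighbors of
label `n + 1`. Labels never exceed `n + 1`, so the sum of the labels bounds the number of bids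
(`sem_auctionProg`). Again `|M| > k` excludes a solution.

Otherwise some `ℓ ≤ n` is not a label, since only `n` vertices carry labels. Let `H` be the vertices
of label above `ℓ`, `C` the non-isolated unmarked vertices with all neighbors in `H`, and `B` the
other non-isolated vertices. A bid goes to a least label, so a vertex `a` and its mate `c` always
satisfy `lab a ≤ lab b + 1` for all neighbors `b` of `c`. By the gap at `ℓ`, the mates of `H`
therefore lie in `C`, as do the non-isolated vertices that are neither marked nor matched. Writing
`M` also for the matched unmarked vertices, `B ∪ H ⊆ A ∪ (M \ C)` and `|H| ≤ |M ∩ C|`, so `|B| +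
2|H| ≤ 2k + k`: the crown is heavy (`AuctionInv.exists_crown`). No maximum matching is needed. The
crown vertices to delete are the unmatched ones, so the program never computes `ℓ`, `C` or `H`.

Solutions. If `Y` covers the reduced graph, then `(Y \ C) ∪ H` covers `G` and is no larger, because
`Y` contains the mate of each head vertex that it misses (`IsCrownReduction.exists_cover`). Deleted
vertices are independent. Hence a cover `S` of `G` restricts to a cover `Y` of the reduced graph,
and `S` consists of `Y`, the forced vertices and arbitrary further deleted vertices; as `Y` is
determined by `S`, the sets `S_Y` partition the solutions.

Lifting. `S_Y` consists of the sets of size at most `k` that agree with the base set (`Y` and the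
forced vertices) outside the free vertices. They are listed in colexicographic order. The successor
of `T` uses the least free `p ∉ T` such that dropping the free elements below `p` and inserting `p`
keeps the size at most `k`; one scan finds it (`sem_nextProg`), so the delay is polynomial even if
`S_Y` is exponentially large.

Machine level. Everything except the enumeration loop and the emission of outputs is written with
counted loops, which have a functional semantics `Prog.sem` and, by `Prog.exec_compile`, a silent
run of polynomial length. Correctness then becomes a matter of loop invariants
(`Prog.sem_count_induct`). The lifting algorithm recomputes the reduction, and `Prog.agree_sem`
shows that it finds the same kept vertices. -/

namespace RAM

/-! ### A structured fragment: programs with bounded loops -/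

namespace State

/-- Write a register. -/
def setReg (s : State) (r v : ℕ) : State := { s with regs := Function.update s.regs r v }

/-- Write a cell of an array. -/
def setArr (s : State) (a i v : ℕ) : State :=
  { s with arrs := Function.update s.arrs a (Function.update (s.arrs a) i v) }

/-- Append a bit to the output buffer. -/
def push (s : State) (b : Bool) : State := { s with buf := s.buf ++ [b] }

@[simp] theorem regs_setReg (s : State) (r v r' : ℕ) :
    (s.setReg r v).regs r' = if r' = r then v else s.regs r' := by
  simp [setReg, Function.update_apply]

@[simp] theorem arrs_setReg (s : State) (r v : ℕ) : (s.setReg r v).arrs = s.arrs := rfl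

@[simp] theorem buf_setReg (s : State) (r v : ℕ) : (s.setReg r v).buf = s.buf := rfl

@[simp] theorem regs_setArr (s : State) (a i v : ℕ) : (s.setArr a i v).regs = s.regs := rfl

@[simp] theorem arrs_setArr (s : State) (a i v a' i' : ℕ) :
    (s.setArr a i v).arrs a' i' = if a' = a ∧ i' = i then v else s.arrs a' i' := by
  by_cases ha : a' = a
  · subst ha
    simp [setArr, Function.update_apply]
  · simp [setArr, ha]

@[simp] theorem regs_push (s : State) (b : Bool) : (s.push b).regs = s.regs := rfl

@[simp] theorem arrs_push (s : State) (b : Bool) : (s.push b).arrs = s.arrs := rfl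

@[simp] theorem buf_push (s : State) (b : Bool) : (s.push b).buf = s.buf ++ [b] := rfl

end State

/-- Programs without outputs whose loops are counted: `count i l p` runs `p` with the register `i`
taking the values `0, 1, …` below the content of register `l`. -/
inductive Prog : Type
  | skip
  | assign (r : ℕ) (e : Exp)
  | store (a : ℕ) (i e : Exp)
  | put (e : Exp)
  | seq (p q : Prog)
  | ite (e : Exp) (p q : Prog)
  | count (i l : ℕ) (p : Prog)

namespace Prog

/-- The underlying machine program. -/
def compile : Prog → Cmd
  | skip => .skip
  | assign r e => .assign r e
  | store a i e => .store a i e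
  | put e => .put e
  | seq p q => .seq p.compile q.compile
  | ite e p q => .ite e p.compile q.compile
  | count i l p => .seq (.assign i (.lit 0)) (.loop (.sub (.reg l) (.reg i))
      (.seq p.compile (.assign i (.add (.reg i) (.lit 1)))))

/-- The state after a run. -/
def sem : Prog → State → State
  | skip, s => s
  | assign r e, s => s.setReg r (e.eval s)
  | store a i e, s => s.setArr a (i.eval s) (e.eval s)
  | put e, s => s.push (decide (e.eval s ≠ 0))
  | seq p q, s => q.sem (p.sem s)
  | ite e p q, s => if e.eval s ≠ 0 then p.sem s else q.sem s
  | count i l p, s =>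
      (fun s' => (p.sem s').setReg i ((p.sem s').regs i + 1))^[s.regs l] (s.setReg i 0)

/-- Does the program write the register? -/
def writesReg (r : ℕ) : Prog → Bool
  | assign r' _ => r == r'
  | seq p q => p.writesReg r || q.writesReg r
  | ite _ p q => p.writesReg r || q.writesReg r
  | count i _ p => r == i || p.writesReg r
  | _ => false

/-- Does the program write the array? -/
def writesArr (a : ℕ) : Prog → Bool
  | store a' _ _ => a == a'
  | seq p q => p.writesArr a || q.writesArr a
  | ite _ p q => p.writesArr a || q.writesArr a
  | count _ _ p => p.writesArr a
  | _ => false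

/-- Does the program write the output buffer? -/
def writesBuf : Prog → Bool
  | put _ => true
  | seq p q => p.writesBuf || q.writesBuf
  | ite _ p q => p.writesBuf || q.writesBuf
  | count _ _ p => p.writesBuf
  | _ => false

/-- All loop limits are registers in `L`, these are never written, and the body of a loop does not
write the counter. -/
def Ok (L : List ℕ) : Prog → Bool
  | assign r _ => !L.contains r
  | seq p q => p.Ok L && q.Ok L
  | ite _ p q => p.Ok L && q.Ok L
  | count i l p => L.contains l && !L.contains i && !p.writesReg i && p.Ok L
  | _ => true

/-- A bound for the running time in terms of a bound for the loop limits. -/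
noncomputable def bound : Prog → Polynomial ℕ
  | seq p q => p.bound + q.bound
  | ite _ p q => p.bound + q.bound + 1
  | count _ _ p => Polynomial.X * (p.bound + 2) + 2
  | _ => 1

/-! ### Frame properties and loop invariants of counted programs -/

theorem sem_regs_of_not_writes {r : ℕ} {p : Prog} (h : p.writesReg r = false) (s : State) :
    (p.sem s).regs r = s.regs r := by
  induction p generalizing s with
  | skip => rfl
  | assign r' e => simp_all [sem, writesReg]
  | store a i e => rfl
  | put e => rfl
  | seq p q hp hq => simp_all [sem, writesReg]
  | ite e p q hp hq =>
    simp only [writesReg, Bool.or_eq_false_iff] at h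
    simp only [sem]
    split_ifs <;> simp_all
  | count i l p hp =>
    simp only [writesReg, Bool.or_eq_false_iff, beq_eq_false_iff_ne] at h
    simp only [sem]
    have key : ∀ (m : ℕ) (s : State),
        ((fun s' => (p.sem s').setReg i ((p.sem s').regs i + 1))^[m] s).regs r = s.regs r := by
      intro m
      induction m with
      | zero => simp
      | succ m ih => intro s; rw [Function.iterate_succ_apply, ih]; simp [h.1, hp h.2]
    rw [key]
    simp [h.1]

theorem sem_arrs_of_not_writes {a : ℕ} {p : Prog} (h : p.writesArr a = false) (s : State) :
    (p.sem s).arrs a = s.arrs a := by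
  induction p generalizing s with
  | skip => rfl
  | assign r' e => rfl
  | store a' i e => funext j; simp_all [sem, writesArr]
  | put e => rfl
  | seq p q hp hq => simp_all [sem, writesArr]
  | ite e p q hp hq =>
    simp only [writesArr, Bool.or_eq_false_iff] at h
    simp only [sem]
    split_ifs <;> simp_all
  | count i l p hp =>
    simp only [writesArr] at h
    simp only [sem]
    have key : ∀ (m : ℕ) (s : State),
        ((fun s' => (p.sem s').setReg i ((p.sem s').regs i + 1))^[m] s).arrs a = s.arrs a := by
      intro m
      induction m with
      | zero => simp
      | succ m ih => intro s; rw [Function.iterate_succ_apply, ih]; simp [hp h]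
    rw [key]
    simp

theorem sem_buf_of_not_writes {p : Prog} (h : p.writesBuf = false) (s : State) :
    (p.sem s).buf = s.buf := by
  induction p generalizing s with
  | skip => rfl
  | assign r' e => rfl
  | store a' i e => rfl
  | put e => simp [writesBuf] at h
  | seq p q hp hq => simp_all [sem, writesBuf]
  | ite e p q hp hq =>
    simp only [writesBuf, Bool.or_eq_false_iff] at h
    simp only [sem]
    split_ifs <;> simp_all
  | count i l p hp =>
    simp only [writesBuf] at h
    simp only [sem]
    have key : ∀ (m : ℕ) (s : State),
        ((fun s' => (p.sem s').setReg i ((p.sem s').regs i + 1))^[m] s).buf = s.buf := by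
      intro m
      induction m with
      | zero => simp
      | succ m ih => intro s; rw [Function.iterate_succ_apply, ih]; simp [hp h]
    rw [key]
    simp

theorem not_writesReg_of_ok {L : List ℕ} {p : Prog} (h : p.Ok L = true) {l : ℕ} (hl : l ∈ L) :
    p.writesReg l = false := by
  induction p with
  | assign r e =>
    simp only [Ok, Bool.not_eq_true', List.contains_eq_mem, decide_eq_false_iff_not] at h
    simp only [writesReg, beq_eq_false_iff_ne]
    rintro rfl
    exact h hl
  | seq p q hp hq => simp_all [Ok, writesReg]
  | ite e p q hp hq => simp_all [Ok, writesReg]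
  | count i l' p hp =>
    simp only [Ok, Bool.and_eq_true, Bool.not_eq_true', List.contains_eq_mem,
      decide_eq_false_iff_not] at h
    simp only [writesReg, Bool.or_eq_false_iff, beq_eq_false_iff_ne]
    exact ⟨fun e => h.1.1.2 (e ▸ hl), hp h.2⟩
  | _ => rfl

/-- Induction over the iterations of a counted loop. -/
theorem sem_count_induct {i l : ℕ} {p : Prog} (Inv : ℕ → State → Prop) {s : State}
    (hi : p.writesReg i = false) (h0 : Inv 0 (s.setReg i 0))
    (hstep : ∀ j s', j < s.regs l → s'.regs i = j → Inv j s' →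
      Inv (j + 1) ((p.sem s').setReg i (j + 1))) :
    Inv (s.regs l) ((count i l p).sem s) := by
  -- The invariant is carried together with the fact that the counter equals the number of finished
  -- iterations.
  have key : ∀ m ≤ s.regs l,
      ((fun s' => (p.sem s').setReg i ((p.sem s').regs i + 1))^[m] (s.setReg i 0)).regs i = m ∧
      Inv m ((fun s' => (p.sem s').setReg i ((p.sem s').regs i + 1))^[m] (s.setReg i 0)) := by
    intro m
    induction m with
    | zero => simpa using h0
    | succ m ih =>
      intro hm
      obtain ⟨h1, h2⟩ := ih (by omega)
      rw [Function.iterate_succ_apply']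
      generalize (fun s' => (p.sem s').setReg i ((p.sem s').regs i + 1))^[m] (s.setReg i 0) = s'
        at h1 h2
      simp only [sem_regs_of_not_writes hi, h1, State.regs_setReg, if_true, true_and]
      exact hstep m s' (by omega) h1 h2
  exact (key _ le_rfl).2

/-! ### Polynomial running time of counted programs -/

theorem eval_mono (q : Polynomial ℕ) {m n : ℕ} (h : m ≤ n) : q.eval m ≤ q.eval n := by
  induction q using Polynomial.induction_on' with
  | add p q hp hq => simpa using add_le_add hp hq
  | monomial k a => simpa using Nat.mul_le_mul_left a (Nat.pow_le_pow_left h k)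

/-- Registers in `L` are never written, so `N` bounds every loop limit throughout the run, including
limits of nested loops, and the costs add up along the structure of the program. The trace contains
only clock ticks. -/
theorem exec_compile {L : List ℕ} {p : Prog} (h : p.Ok L = true) {N : ℕ} {s : State}
    (hN : ∀ l ∈ L, s.regs l ≤ N) :
    ∃ m ≤ p.bound.eval N, Exec p.compile s (List.replicate m none) (p.sem s) := by
  induction p generalizing s with
  | skip => exact ⟨1, by simp [bound], .skip s⟩
  | assign r e => exact ⟨1, by simp [bound], .assign r e s⟩
  | store a i e => exact ⟨1, by simp [bound], .store a i e s⟩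
  | put e => exact ⟨1, by simp [bound], .put e s⟩
  | seq p q hp hq =>
    simp only [Ok, Bool.and_eq_true] at h
    obtain ⟨m, hm, e⟩ := hp h.1 hN
    obtain ⟨m', hm', e'⟩ := hq h.2 (s := p.sem s) fun l hl => by
      rw [sem_regs_of_not_writes (not_writesReg_of_ok h.1 hl)]
      exact hN l hl
    refine ⟨m + m', by simpa [bound] using add_le_add hm hm', ?_⟩
    rw [List.replicate_add]
    exact .seq e e'
  | ite e p q hp hq =>
    simp only [Ok, Bool.and_eq_true] at h
    by_cases he : e.eval s = 0
    · obtain ⟨m, hm, e'⟩ := hq h.2 hN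
      refine ⟨m + 1, by simp [bound]; omega, ?_⟩
      simp only [sem, he, ne_eq, not_true_eq_false, if_false]
      exact .ite_false he e'
    · obtain ⟨m, hm, e'⟩ := hp h.1 hN
      refine ⟨m + 1, by simp [bound]; omega, ?_⟩
      simp only [sem, he, ne_eq, not_false_eq_true, if_true]
      exact .ite_true he e'
  | count i l p hp =>
    simp only [Ok, Bool.and_eq_true, Bool.not_eq_true', List.contains_eq_mem, decide_eq_true_eq,
      decide_eq_false_iff_not] at h
    obtain ⟨⟨⟨hl, hi⟩, hpi⟩, hpL⟩ := h
    have hil : l ≠ i := fun e => hi (e ▸ hl)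
    -- Here `m` counts the iterations still to come. Each costs the test, the body and the increment
    -- of the counter; the `+ 1` is the final failing test.
    have key : ∀ (m : ℕ) (s : State), (∀ l ∈ L, s.regs l ≤ N) → s.regs l = s.regs i + m →
        ∃ t ≤ m * (p.bound.eval N + 2) + 1,
          Exec (.loop (.sub (.reg l) (.reg i))
            (.seq p.compile (.assign i (.add (.reg i) (.lit 1))))) s (List.replicate t none)
            ((fun s' => (p.sem s').setReg i ((p.sem s').regs i + 1))^[m] s) := by
      intro m
      induction m with
      | zero =>
        intro s _ h
        exact ⟨1, by simp, .loop_false (by simp [Exp.eval, h])⟩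
      | succ m ih =>
        intro s hs h
        obtain ⟨a, ha, ea⟩ := hp hpL hs
        obtain ⟨b, hb, eb⟩ := ih ((p.sem s).setReg i ((p.sem s).regs i + 1))
          (fun l' hl' => by
            have : l' ≠ i := fun e => hi (e ▸ hl')
            simpa [this, sem_regs_of_not_writes (not_writesReg_of_ok hpL hl')] using hs l' hl')
          (by simp [hil, sem_regs_of_not_writes (not_writesReg_of_ok hpL hl),
                sem_regs_of_not_writes hpi, h]; omega)
        refine ⟨(a + 1 + b) + 1, by rw [Nat.succ_mul]; omega, ?_⟩
        rw [List.replicate_succ, List.replicate_add, List.replicate_add]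
        exact .loop_true (by simp [Exp.eval, h]) (.seq ea (.assign i _ _)) eb
    obtain ⟨t, ht, et⟩ := key (s.regs l) (s.setReg i 0)
      (fun l' hl' => by
        have : l' ≠ i := fun e => hi (e ▸ hl')
        simpa [this] using hN l' hl')
      (by simp [hil])
    refine ⟨1 + t, ?_, ?_⟩
    · have : s.regs l * (p.bound.eval N + 2) ≤ N * (p.bound.eval N + 2) :=
        Nat.mul_le_mul_right _ (hN l hl)
      simp [bound]
      omega
    · rw [List.replicate_add]
      exact .seq (.assign i (.lit 0) s) et

/-! ### Dependence of a run on what the program reads -/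

/-- All registers of an expression satisfy `ρ` and all its arrays satisfy `α`. -/
def _root_.RAM.Exp.within (ρ α : ℕ → Bool) : Exp → Bool
  | .lit _ => true
  | .reg r => ρ r
  | .cell a e => α a && e.within ρ α
  | .add e f => e.within ρ α && f.within ρ α
  | .sub e f => e.within ρ α && f.within ρ α

/-- All registers that the program reads satisfy `ρ`, and all arrays that it reads satisfy `α`. -/
def within (ρ α : ℕ → Bool) : Prog → Bool
  | skip => true
  | assign _ e => e.within ρ α
  | store _ i e => i.within ρ α && e.within ρ α
  | put e => e.within ρ α
  | seq p q => p.within ρ α && q.within ρ α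
  | ite e p q => e.within ρ α && p.within ρ α && q.within ρ α
  | count i l p => ρ i && ρ l && p.within ρ α

/-- Two states agree on the registers in `ρ` and the arrays in `α`. -/
structure _root_.RAM.State.Agree (ρ α : ℕ → Bool) (s s' : State) : Prop where
  regs : ∀ r, ρ r = true → s.regs r = s'.regs r
  arrs : ∀ a, α a = true → s.arrs a = s'.arrs a

theorem _root_.RAM.Exp.eval_congr {ρ α : ℕ → Bool} {e : Exp} (h : e.within ρ α = true)
    {s s' : State} (hs : s.Agree ρ α s') : e.eval s = e.eval s' := by
  induction e with
  | lit c => rfl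
  | reg r => exact hs.regs r h
  | cell a e ih =>
    simp only [Exp.within, Bool.and_eq_true] at h
    simp only [Exp.eval, ih h.2, hs.arrs a h.1]
  | add e f he hf =>
    simp only [Exp.within, Bool.and_eq_true] at h
    simp only [Exp.eval, he h.1, hf h.2]
  | sub e f he hf =>
    simp only [Exp.within, Bool.and_eq_true] at h
    simp only [Exp.eval, he h.1, hf h.2]

theorem _root_.RAM.State.Agree.setReg {ρ α : ℕ → Bool} {s s' : State} (h : s.Agree ρ α s')
    (r v : ℕ) : (s.setReg r v).Agree ρ α (s'.setReg r v) where
  regs r' hr' := by simp [h.regs r' hr']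
  arrs := h.arrs

/-- Equal readings give equal writes, equal branches and equal numbers of iterations. A loop counter
counts as read, since its increment depends on it. -/
theorem agree_sem {ρ α : ℕ → Bool} {p : Prog} (h : p.within ρ α = true) {s s' : State}
    (hs : s.Agree ρ α s') : (p.sem s).Agree ρ α (p.sem s') := by
  induction p generalizing s s' with
  | skip => exact hs
  | assign r e => simpa only [sem, Exp.eval_congr h hs] using hs.setReg r _
  | store a i e =>
    simp only [within, Bool.and_eq_true] at h
    simp only [sem, Exp.eval_congr h.1 hs, Exp.eval_congr h.2 hs]
    exact ⟨hs.regs, fun a' ha' => by funext j; simp [hs.arrs a' ha']⟩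
  | put e => exact ⟨hs.regs, hs.arrs⟩
  | seq p q hp hq =>
    simp only [within, Bool.and_eq_true] at h
    exact hq h.2 (hp h.1 hs)
  | ite e p q hp hq =>
    simp only [within, Bool.and_eq_true] at h
    simp only [sem, Exp.eval_congr h.1.1 hs]
    split_ifs
    · exact hp h.1.2 hs
    · exact hq h.2 hs
  | count i l p hp =>
    simp only [within, Bool.and_eq_true] at h
    simp only [sem, hs.regs l h.1.2]
    generalize s'.regs l = m
    have := hs.setReg i 0
    generalize s.setReg i 0 = u at this
    generalize s'.setReg i 0 = u' at this
    induction m generalizing u u' with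
    | zero => exact this
    | succ m ih =>
      rw [Function.iterate_succ_apply, Function.iterate_succ_apply]
      refine ih _ _ ?_
      have h2 := hp h.2 this
      rw [h2.regs i h.1.1]
      exact h2.setReg i _

end Prog

end RAM

namespace EnumVC

/-! ### Crown reductions and vertex covers -/

section Reduction

variable {I J : Instance} {φ : J.graph ↪g I.graph}

/-- What is left lies in `B ∪ H ∪ m(H)`, which has at most `|B| + 2|H|` elements. -/
theorem IsHeavyCrownDecomposition.ncard_diff_le {V : Type} [DecidableEq V]
    {G : SimpleGraph V} {W : Set V} {C H B : Finset V} {m : V → V} {t : ℕ}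
    (h : IsHeavyCrownDecomposition G W C H B m t) :
    (W \ ((C \ H.image m : Finset V) : Set V)).ncard ≤ 3 * t := by
  have hsub : W \ ((C \ H.image m : Finset V) : Set V) ⊆ ((B ∪ H ∪ H.image m : Finset V) : Set V) := by
    rintro v ⟨hv, hv'⟩
    rw [← h.union_eq] at hv
    simp only [Finset.coe_union, Finset.coe_sdiff, Set.mem_union, Finset.mem_coe, Set.mem_sdiff,
      not_and, not_not] at hv hv' ⊢
    tauto
  have h1 := Set.ncard_le_ncard hsub (Finset.finite_toSet _)
  rw [Set.ncard_coe_finset] at h1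
  have h2 := Finset.card_union_le (B ∪ H) (H.image m)
  have h3 := Finset.card_union_le B H
  have h4 := Finset.card_image_le (s := H) (f := m)
  have := h.heavy
  omega

theorem ncard_range_embedding (φ : J.graph ↪g I.graph) : (Set.range φ).ncard = J.n := by
  rw [← Set.image_univ, Set.ncard_image_of_injective _ φ.injective]
  simp

theorem IsCrownReduction.k_eq (h : IsCrownReduction I J φ) : J.k = I.k := h.1

theorem IsCrownReduction.card_le (h : IsCrownReduction I J φ) : J.n ≤ 3 * I.k := by
  rw [← ncard_range_embedding φ]
  obtain ⟨_, ⟨h1, h2⟩ | ⟨_, C, H, B, m, hc, h2⟩⟩ := h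
  · rwa [h2]
  · rw [h2]
    exact hc.ncard_diff_le

/-- The deleted vertices are independent. -/
theorem IsCrownReduction.not_adj (h : IsCrownReduction I J φ) {u v : Fin I.n}
    (hu : u ∉ Set.range φ) (hv : v ∉ Set.range φ) : ¬ I.graph.Adj u v := by
  intro hadj
  have hus : u ∈ I.graph.support := ⟨v, hadj⟩
  have hvs : v ∈ I.graph.support := ⟨u, hadj.symm⟩
  obtain ⟨_, ⟨_, h2⟩ | ⟨_, C, H, B, m, hc, h2⟩⟩ := h
  · exact hu (h2 ▸ hus)
  · rw [h2] at hu hv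
    simp only [Set.mem_sdiff, hus, hvs, true_and, not_not, Finset.mem_coe, Finset.mem_sdiff]
      at hu hv
    exact hc.indep u hu.1 v hv.1 hadj

/-- An edge between kept vertices is covered by `Y`; if its only kept end is not in `Y`, the other
end is forced; and there is no edge between deleted vertices. -/
theorem IsCrownReduction.lifted_isVertexCover (h : IsCrownReduction I J φ)
    {Y : Finset (Fin J.n)} (hY : J.graph.IsVertexCover (Y : Set (Fin J.n)))
    {S : Finset (Fin I.n)} (hS : S ∈ lifted I J φ Y) :
    I.graph.IsVertexCover (S : Set (Fin I.n)) := by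
  obtain ⟨-, F, Z, hF, -, rfl⟩ := hS
  have key : ∀ u (v : Fin I.n), v ∉ Set.range φ → I.graph.Adj v (φ u) →
      φ u ∈ Y.image φ ∪ F ∪ Z ∨ v ∈ Y.image φ ∪ F ∪ Z := by
    intro u v hv hadj
    by_cases hu : u ∈ Y
    · left; simp [hu]
    · right
      have : v ∈ F := (hF v).2 ⟨hv, u, hu, hadj⟩
      simp [this]
  intro v w hadj
  simp only [Finset.mem_coe]
  by_cases hv : v ∈ Set.range φ <;> by_cases hw : w ∈ Set.range φ
  · obtain ⟨a, rfl⟩ := hv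
    obtain ⟨b, rfl⟩ := hw
    rcases hY (φ.map_adj_iff.1 hadj) with h1 | h1
    · left; simp_all
    · right; simp_all
  · obtain ⟨a, rfl⟩ := hv
    exact key a w hw hadj.symm
  · obtain ⟨b, rfl⟩ := hw
    exact (key b v hv hadj).symm
  · exact absurd hadj (h.not_adj hv hw)

theorem isVertexCover_preimage {S : Finset (Fin I.n)}
    (hS : I.graph.IsVertexCover (S : Set (Fin I.n))) :
    J.graph.IsVertexCover ((Finset.univ.filter fun u => φ u ∈ S : Finset (Fin J.n)) :
      Set (Fin J.n)) := by
  intro v w hadj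
  simpa using hS (φ.map_adj_iff.2 hadj)

theorem card_preimage_le (S : Finset (Fin I.n)) :
    (Finset.univ.filter fun u => φ u ∈ S : Finset (Fin J.n)).card ≤ S.card :=
  Finset.card_le_card_of_injOn φ (by intro u; simp) φ.injective.injOn

/-- Forced vertices belong to `S`, because `S` must cover their edges to kept vertices outside `S`.
The remaining deleted vertices of `S` serve as `Z`. -/
theorem mem_lifted_preimage {S : Finset (Fin I.n)}
    (hS : I.graph.IsVertexCover (S : Set (Fin I.n))) (hk : S.card ≤ I.k) :
    S ∈ lifted I J φ (Finset.univ.filter fun u => φ u ∈ S) := by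
  classical
  refine ⟨hk, Finset.univ.filter fun v => v ∉ Set.range φ ∧ ∃ u, φ u ∉ S ∧ I.graph.Adj v (φ u),
    S.filter fun v => v ∉ Set.range φ ∧ ¬ ∃ u, φ u ∉ S ∧ I.graph.Adj v (φ u), ?_, ?_, ?_⟩
  · intro v
    simp
  · intro v
    simp only [Finset.mem_filter, Finset.mem_univ, true_and, not_and]
    exact fun h => ⟨h.2.1, fun _ => h.2.2⟩
  · ext v
    simp only [Finset.mem_union, Finset.mem_image, Finset.mem_filter, Finset.mem_univ, true_and]
    constructor
    · intro hv
      by_cases hr : v ∈ Set.range φ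
      · obtain ⟨u, rfl⟩ := hr
        exact .inl (.inl ⟨u, hv, rfl⟩)
      · by_cases hf : ∃ u, φ u ∉ S ∧ I.graph.Adj v (φ u)
        · exact .inl (.inr ⟨hr, hf⟩)
        · exact .inr ⟨hv, hr, hf⟩
    · rintro ((⟨u, hu, rfl⟩ | ⟨_, u, hu, hadj⟩) | h)
      · exact hu
      · exact (hS hadj).resolve_right (by simpa using hu)
      · exact h.1

/-- Neither `F` nor `Z` meets the range of `φ`, so `Y` can be read off from `S`. This is why no
solution is listed for two different `Y`. -/
theorem eq_preimage_of_mem_lifted {Y : Finset (Fin J.n)} {S : Finset (Fin I.n)}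
    (hS : S ∈ lifted I J φ Y) : Y = Finset.univ.filter fun u => φ u ∈ S := by
  obtain ⟨-, F, Z, hF, hZ, rfl⟩ := hS
  ext u
  simp only [Finset.mem_filter, Finset.mem_univ, true_and, Finset.mem_union, Finset.mem_image]
  constructor
  · exact fun hu => .inl (.inl ⟨u, hu, rfl⟩)
  · rintro ((⟨u', hu', e⟩ | h) | h)
    · exact φ.injective e ▸ hu'
    · exact absurd ⟨u, rfl⟩ ((hF _).1 h).1
    · exact absurd ⟨u, rfl⟩ (hZ _ h).1

/-- A small vertex cover of the reduced graph can be exchanged for a small vertex cover. -/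
theorem IsCrownReduction.exists_cover (h : IsCrownReduction I J φ) {Y : Finset (Fin J.n)}
    (hY : J.graph.IsVertexCover (Y : Set (Fin J.n))) (hk : Y.card ≤ J.k) :
    ∃ S : Finset (Fin I.n), I.graph.IsVertexCover (S : Set (Fin I.n)) ∧ S.card ≤ I.k := by
  classical
  rw [h.1] at hk
  have hcov : ∀ u v, I.graph.Adj u v → u ∈ Set.range φ → v ∈ Set.range φ →
      u ∈ Y.image φ ∨ v ∈ Y.image φ := by
    rintro _ _ hadj ⟨a, rfl⟩ ⟨b, rfl⟩
    have := hY (φ.map_adj_iff.1 hadj)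
    simpa using this
  obtain ⟨_, ⟨h1, h2⟩ | ⟨_, C, H, B, m, hc, h2⟩⟩ := h
  · refine ⟨Y.image φ, fun v w hadj => ?_, Finset.card_image_le.trans hk⟩
    exact hcov v w hadj (h2 ▸ ⟨w, hadj⟩) (h2 ▸ ⟨v, hadj.symm⟩)
  · have hHs : ∀ v ∈ H, v ∈ I.graph.support := fun v hv => hc.union_eq ▸ by simp [hv]
    have hCs : ∀ v ∈ C, v ∈ I.graph.support := fun v hv => hc.union_eq ▸ by simp [hv]
    have hr : ∀ v ∈ I.graph.support, v ∉ C → v ∈ Set.range φ := fun v hv hv' => by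
      rw [h2]
      exact ⟨hv, by simp [hv']⟩
    have hHr : ∀ v ∈ H, v ∈ Set.range φ := fun v hv =>
      hr v (hHs v hv) (Finset.disjoint_right.1 hc.disjoint_CH hv)
    have hmr : ∀ v ∈ H, m v ∈ Set.range φ := fun v hv => by
      rw [h2]
      refine ⟨hCs _ (hc.matching_mem v hv), ?_⟩
      simp only [Finset.coe_sdiff, Set.mem_sdiff, not_and, not_not]
      exact fun _ => Finset.mem_coe.2 (Finset.mem_image_of_mem _ hv)
    -- Every edge that meets the independent set `C` ends in `H`, so crown vertices can be traded
    -- for the whole head.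
    refine ⟨(Y.image φ \ C) ∪ H, ?_, ?_⟩
    · intro v w hadj
      simp only [Finset.coe_union, Finset.coe_sdiff, Set.mem_union, Set.mem_sdiff, Finset.mem_coe]
      by_cases hv : v ∈ C
      · exact .inr (.inr ((hc.neighbors w ⟨v, hadj.symm⟩).2 ⟨v, hv, hadj⟩))
      by_cases hw : w ∈ C
      · exact .inl (.inr ((hc.neighbors v ⟨w, hadj⟩).2 ⟨w, hw, hadj.symm⟩))
      have := hcov v w hadj (hr v ⟨w, hadj⟩ hv) (hr w ⟨v, hadj.symm⟩ hw)
      tauto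
    · have e1 : (Y.image φ \ C) ∪ H ⊆ (Y.image φ \ C) ∪ (H \ Y.image φ) := by
        intro v hv
        simp only [Finset.mem_union, Finset.mem_sdiff] at hv ⊢
        rcases hv with hv | hv
        · exact .inl hv
        · by_cases hvY : v ∈ Y.image φ
          · exact .inl ⟨hvY, Finset.disjoint_right.1 hc.disjoint_CH hv⟩
          · exact .inr ⟨hv, hvY⟩
      -- The matching edges survive the reduction, so a head vertex missing from `Y` is paid for by
      -- its mate.
      have e2 : (H \ Y.image φ).card ≤ (Y.image φ ∩ C).card := by
        refine Finset.card_le_card_of_injOn m ?_ ?_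
        · intro v hv
          simp only [Finset.coe_sdiff, Set.mem_sdiff, Finset.mem_coe] at hv
          have := hcov v (m v) (hc.matching_adj v hv.1) (hHr v hv.1) (hmr v hv.1)
          simpa using ⟨by simpa using this.resolve_left hv.2, hc.matching_mem v hv.1⟩
        · intro v hv w hw e
          simp only [Finset.coe_sdiff, Set.mem_sdiff, Finset.mem_coe] at hv hw
          exact hc.matching_inj v hv.1 w hw.1 e
      have e3 := Finset.card_le_card e1
      have e4 := Finset.card_union_le (Y.image φ \ C) (H \ Y.image φ)
      have e5 := Finset.card_sdiff_add_card_inter (Y.image φ) C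
      have e6 := Finset.card_image_le (s := Y) (f := φ)
      omega

end Reduction

/-! ### Crown decompositions from bipartite matchings with labels -/

/-- Adjacency in the graph that a word represents. -/
def AdjN (x : Word) (i j : ℕ) : Prop := i ≠ j ∧ (bitOf x i j = true ∨ bitOf x j i = true)

instance (x : Word) (i j : ℕ) : Decidable (AdjN x i j) := by unfold AdjN; infer_instance

theorem AdjN.symm {x : Word} {i j : ℕ} (h : AdjN x i j) : AdjN x j i := ⟨h.1.symm, h.2.symm⟩

/-- The graph that a word represents. -/
def graphOf (x : Word) : SimpleGraph (Fin (nOf x)) := (decode x).graph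

theorem graphOf_adj {x : Word} {i j : Fin (nOf x)} : (graphOf x).Adj i j ↔ AdjN x i j := by
  rw [AdjN, ← Fin.ext_iff.ne]
  rfl

theorem mem_support_graphOf {x : Word} {i : Fin (nOf x)} :
    i ∈ (graphOf x).support ↔ ∃ j < nOf x, AdjN x i j := by
  constructor
  · rintro ⟨j, hj⟩
    exact ⟨j, j.2, graphOf_adj.1 hj⟩
  · rintro ⟨j, hj, h⟩
    exact ⟨⟨j, hj⟩, graphOf_adj.2 h⟩

/-- A matching between the marked and the unmarked vertices, together with labels, as it is
maintained by the auction algorithm: `mate a = c + 1` means that the vertex `a` is matched to the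
unmarked vertex `c`, `used c ≠ 0` that `c` is matched, and `lab` are the labels (prices). -/
structure AuctionInv (x : Word) (mark mate used lab : ℕ → ℕ) : Prop where
  mate_lt : ∀ a < nOf x, ∀ c, mate a = c + 1 → c < nOf x
  mate_mark : ∀ a < nOf x, ∀ c, mate a = c + 1 → mark c = 0
  mate_adj : ∀ a < nOf x, ∀ c, mate a = c + 1 → AdjN x a c
  mate_used : ∀ a < nOf x, ∀ c, mate a = c + 1 → used c ≠ 0
  mate_inj : ∀ a < nOf x, ∀ a' < nOf x, ∀ c, mate a = c + 1 → mate a' = c + 1 → a = a'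
  exists_mate : ∀ c < nOf x, used c ≠ 0 → ∃ a < nOf x, mate a = c + 1
  lab_pos : ∀ a < nOf x, lab a ≠ 0 → mate a ≠ 0
  lab_le : ∀ a < nOf x, lab a ≤ nOf x + 1
  lab_near : ∀ a < nOf x, ∀ c, mate a = c + 1 → ∀ b < nOf x, AdjN x c b → lab a ≤ lab b + 1

namespace AuctionInv

variable {x : Word} {mark mate used lab : ℕ → ℕ}

/-- The unmarked, unmatched vertex `c` is matched to its neighbor `a` of least label. -/
theorem step (h : AuctionInv x mark mate used lab) {a c : ℕ} (ha : a < nOf x) (hc : c < nOf x)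
    (hmark : mark c = 0) (hused : used c = 0) (hadj : AdjN x c a) (hlab : lab a < nOf x + 1)
    (hmin : ∀ b < nOf x, AdjN x c b → lab a ≤ lab b) {mate' used' lab' : ℕ → ℕ}
    (hmate' : ∀ b, mate' b = if b = a then c + 1 else mate b)
    (hused' : ∀ b, used' b = if b = c then 1 else if mate a = b + 1 then 0 else used b)
    (hlab' : ∀ b, lab' b = if b = a then lab a + 1 else lab b) :
    AuctionInv x mark mate' used' lab' := by
  have hne : ∀ b < nOf x, mate b ≠ c + 1 := fun b hb e => h.mate_used b hb c e hused
  have hmono : ∀ b, lab b ≤ lab' b := fun b => by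
    rw [hlab']; split_ifs with e
    · subst e; omega
    · rfl
  refine ⟨?_, ?_, ?_, ?_, ?_, ?_, ?_, ?_, ?_⟩
  · intro b hb c' e
    rw [hmate'] at e
    split_ifs at e
    · obtain rfl : c = c' := by omega
      exact hc
    · exact h.mate_lt b hb c' e
  · intro b hb c' e
    rw [hmate'] at e
    split_ifs at e
    · obtain rfl : c = c' := by omega
      exact hmark
    · exact h.mate_mark b hb c' e
  · intro b hb c' e
    rw [hmate'] at e
    split_ifs at e with e'
    · obtain rfl : c = c' := by omega
      exact e' ▸ hadj.symm
    · exact h.mate_adj b hb c' e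
  · intro b hb c' e
    rw [hmate'] at e
    rw [hused']
    split_ifs at e with e'
    · obtain rfl : c = c' := by omega
      simp
    · have : mate a ≠ c' + 1 := fun e'' => e' (h.mate_inj b hb a ha c' e e'')
      simp only [this, if_false]
      split_ifs
      · simp
      · exact h.mate_used b hb c' e
  · intro b hb b' hb' c' e e'
    rw [hmate'] at e e'
    split_ifs at e e' with h1 h2 h2
    · rw [h1, h2]
    · obtain rfl : c = c' := by omega
      exact absurd e' (hne _ hb')
    · obtain rfl : c = c' := by omega
      exact absurd e (hne _ hb)
    · exact h.mate_inj b hb b' hb' c' e e'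
  · intro c' hc' hu
    rw [hused'] at hu
    split_ifs at hu with h1 h2
    · exact ⟨a, ha, by simp [hmate', h1]⟩
    · exact absurd rfl hu
    · obtain ⟨b, hb, e⟩ := h.exists_mate c' hc' hu
      refine ⟨b, hb, ?_⟩
      rw [hmate', if_neg]
      · exact e
      · rintro rfl
        exact h2 e
  · intro b hb
    rw [hlab', hmate']
    split_ifs
    · simp
    · exact h.lab_pos b hb
  · intro b hb
    rw [hlab']
    split_ifs
    · omega
    · exact h.lab_le b hb
  -- Labels only grow, and only the label of `a` does, so old pairs keep the inequality. For the new
  -- pair it is the minimality of `lab a` before the bid.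
  · intro b hb c' e b' hb' hadj'
    rw [hmate'] at e
    have := hmono b'
    split_ifs at e with h1
    · obtain rfl : c = c' := by omega
      have := hmin b' hb' hadj'
      rw [hlab', if_pos h1]
      omega
    · have := h.lab_near b hb c' e b' hb' hadj'
      rw [hlab', if_neg h1]
      omega

/-- A vertex cover has at least as many vertices as the matching has edges. -/
theorem card_used_le (h : AuctionInv x mark mate used lab)
    (hmax : ∀ i < nOf x, ∀ j < nOf x, AdjN x i j → mark i ≠ 0 ∨ mark j ≠ 0)
    {T : Finset (Fin (nOf x))}
    (hT : (graphOf x).IsVertexCover (T : Set (Fin (nOf x)))) :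
    (Finset.univ.filter fun c : Fin (nOf x) => used c ≠ 0).card ≤ T.card := by
  classical
  have hex : ∀ c : Fin (nOf x), ∃ a : Fin (nOf x), used c ≠ 0 → mate a = c + 1 := fun c => by
    by_cases hc : used c ≠ 0
    · obtain ⟨a, ha, e⟩ := h.exists_mate c c.2 hc
      exact ⟨⟨a, ha⟩, fun _ => e⟩
    · exact ⟨c, fun h => absurd h hc⟩
  choose g hg using hex
  have hm0 : ∀ c : Fin (nOf x), used c ≠ 0 → mark c = 0 := fun c hc =>
    h.mate_mark _ (g c).2 c (hg c hc)
  have hm1 : ∀ c : Fin (nOf x), used c ≠ 0 → mark (g c) ≠ 0 := fun c hc =>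
    (hmax _ (g c).2 c c.2 (h.mate_adj _ (g c).2 c (hg c hc))).resolve_right (by simp [hm0 c hc])
  -- Each matching edge, named by its unmarked end, chooses an end in `T`. Choices on different
  -- sides cannot collide, since one is marked and the other is not.
  refine Finset.card_le_card_of_injOn (fun c => if c ∈ T then c else g c) ?_ ?_
  · intro c hc
    simp only [Finset.coe_filter, Finset.mem_univ, true_and, Set.mem_ofPred_eq] at hc
    simp only [Finset.mem_coe]
    split_ifs with hcT
    · exact hcT
    · have := hT (v := g c) (w := c) (graphOf_adj.2 (h.mate_adj _ (g c).2 c (hg c hc)))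
      exact this.resolve_right (fun h => hcT (Finset.mem_coe.1 h))
  · intro c hc c' hc' e
    simp only [Finset.coe_filter, Finset.mem_univ, true_and, Set.mem_ofPred_eq] at hc hc'
    simp only at e
    split_ifs at e
    · exact e
    · exact absurd (hm0 c hc) (e ▸ hm1 c' hc')
    · exact absurd (hm0 c' hc') (e ▸ hm1 c hc)
    · have h1 := hg c hc
      rw [e, hg c' hc'] at h1
      exact Fin.ext (by omega)

/-- When every unmatched vertex has neighbors of high label only, a gap in the labels yields a
heavy-crown decomposition. -/
theorem exists_crown (h : AuctionInv x mark mate used lab)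
    (hsup : ∀ i < nOf x, mark i ≠ 0 → ∃ j < nOf x, AdjN x i j)
    (hmax : ∀ i < nOf x, ∀ j < nOf x, AdjN x i j → mark i ≠ 0 ∨ mark j ≠ 0)
    (hfix : ∀ c < nOf x, mark c = 0 → used c = 0 → ∀ b < nOf x, AdjN x c b → nOf x < lab b)
    {k : ℕ} (hmk : (Finset.univ.filter fun c : Fin (nOf x) => mark c ≠ 0).card ≤ 2 * k)
    (huk : (Finset.univ.filter fun c : Fin (nOf x) => used c ≠ 0).card ≤ k) :
    ∃ (C H B : Finset (Fin (nOf x))) (m : Fin (nOf x) → Fin (nOf x)),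
      IsHeavyCrownDecomposition (graphOf x) (graphOf x).support C H B m k ∧
      (graphOf x).support \ ((C \ H.image m : Finset (Fin (nOf x))) : Set (Fin (nOf x))) =
        {i : Fin (nOf x) | mark i ≠ 0 ∨ used i ≠ 0} := by
  classical
  -- The labels of `n` vertices cannot exhaust the `n + 1` values `0, …, n`.
  obtain ⟨ℓ, hℓ, hgap⟩ : ∃ ℓ ≤ nOf x, ∀ a < nOf x, lab a ≠ ℓ := by
    obtain ⟨ℓ, h1, h2⟩ := Finset.exists_mem_notMem_of_card_lt_card
      (s := (Finset.range (nOf x)).image lab) (t := Finset.range (nOf x + 1))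
      (Finset.card_image_le.trans_lt (by simp))
    refine ⟨ℓ, by simpa [Nat.lt_succ_iff] using h1, fun a ha e => h2 ?_⟩
    exact Finset.mem_image.2 ⟨a, by simpa using ha, e⟩
  let H : Finset (Fin (nOf x)) := Finset.univ.filter fun i => ℓ < lab i
  let C : Finset (Fin (nOf x)) := Finset.univ.filter fun i =>
    (∃ j < nOf x, AdjN x i j) ∧ mark i = 0 ∧ ∀ b < nOf x, AdjN x i b → ℓ < lab b
  let B : Finset (Fin (nOf x)) := Finset.univ.filter fun i =>
    (∃ j < nOf x, AdjN x i j) ∧ i ∉ C ∧ i ∉ H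
  let M : Finset (Fin (nOf x)) := Finset.univ.filter fun c => used c ≠ 0
  let A : Finset (Fin (nOf x)) := Finset.univ.filter fun c => mark c ≠ 0
  have memH : ∀ i, i ∈ H ↔ ℓ < lab i := fun i => by simp [H]
  have memC : ∀ i, i ∈ C ↔ (∃ j < nOf x, AdjN x i j) ∧ mark i = 0 ∧
      ∀ b < nOf x, AdjN x i b → ℓ < lab b := fun i => by simp [C]
  have memB : ∀ i, i ∈ B ↔ (∃ j < nOf x, AdjN x i j) ∧ i ∉ C ∧ i ∉ H := fun i => by simp [B]
  have memM : ∀ i, i ∈ M ↔ used i ≠ 0 := fun i => by simp [M]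
  have memA : ∀ i, i ∈ A ↔ mark i ≠ 0 := fun i => by simp [A]
  have hmate : ∀ i : Fin (nOf x), ∃ c : Fin (nOf x), i ∈ H → mate i = c + 1 := fun i => by
    by_cases hi : i ∈ H
    · rw [memH] at hi
      obtain ⟨c, hc⟩ := Nat.exists_eq_succ_of_ne_zero (h.lab_pos i i.2 (by omega))
      exact ⟨⟨c, h.mate_lt i i.2 c hc⟩, fun _ => hc⟩
    · exact ⟨i, fun h => absurd h hi⟩
  choose m hm using hmate
  have hmC : ∀ i ∈ H, m i ∈ C := fun i hi => by
    have e := hm i hi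
    refine (memC _).2 ⟨⟨i, i.2, (h.mate_adj i i.2 _ e).symm⟩, h.mate_mark i i.2 _ e, ?_⟩
    -- From `ℓ < lab i ≤ lab b + 1` follows `ℓ ≤ lab b`, and equality is excluded by the gap.
    intro b hb hadj
    have h1 := h.lab_near i i.2 _ e b hb hadj
    have h2 := hgap b hb
    have h3 := (memH i).1 hi
    omega
  have hmM : ∀ i ∈ H, m i ∈ M := fun i hi => (memM _).2 (h.mate_used i i.2 _ (hm i hi))
  have hHA : ∀ i ∈ H, i ∈ A := fun i hi => (memA i).2
    ((hmax i i.2 _ (m i).2 (h.mate_adj i i.2 _ (hm i hi))).resolve_right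
      (by simp [((memC _).1 (hmC i hi)).2.1]))
  have hinj : ∀ i ∈ H, ∀ j ∈ H, m i = m j → i = j := fun i hi j hj e => by
    refine Fin.ext (h.mate_inj i i.2 j j.2 _ (hm i hi) ?_)
    rw [e, hm j hj]
  have hCA : ∀ i ∈ C, i ∉ A := fun i hi hi' => (memA i).1 hi' ((memC i).1 hi).2.1
  have hHM : H.card ≤ (M ∩ C).card :=
    Finset.card_le_card_of_injOn m
      (fun i hi => by simpa using ⟨hmM i hi, hmC i hi⟩) (fun i hi j hj e => hinj i hi j hj e)
  -- Quietness gives labels above `n`, hence above `ℓ` whatever gap was chosen.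
  have hfree : ∀ i : Fin (nOf x), (∃ j < nOf x, AdjN x i j) → mark i = 0 → used i = 0 → i ∈ C :=
    fun i hs h1 h2 => (memC i).2 ⟨hs, h1, fun b hb hadj => hℓ.trans_lt (hfix i i.2 h1 h2 b hb hadj)⟩
  have hMsup : ∀ i : Fin (nOf x), used i ≠ 0 → ∃ j < nOf x, AdjN x i j := fun i hi => by
    obtain ⟨a, ha, e⟩ := h.exists_mate i i.2 hi
    exact ⟨a, ha, (h.mate_adj a ha _ e).symm⟩
  -- The source of heaviness: `|B| + |H| ≤ |A| + |M| - |M ∩ C| ≤ 3k - |H|`.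
  have hBH : B ∪ H ⊆ A ∪ (M \ C) := by
    intro i hi
    simp only [Finset.mem_union, Finset.mem_sdiff] at hi ⊢
    rcases hi with hi | hi
    · obtain ⟨h1, h2, -⟩ := (memB i).1 hi
      by_cases h3 : mark i = 0
      · refine .inr ⟨(memM i).2 fun h4 => h2 (hfree i h1 h3 h4), h2⟩
      · exact .inl ((memA i).2 h3)
    · exact .inl (hHA i hi)
  have hBHd : Disjoint B H := Finset.disjoint_left.2 fun i hi => ((memB i).1 hi).2.2
  have c1 := Finset.card_le_card hBH
  have c2 := Finset.card_union_le A (M \ C)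
  have c3 := Finset.card_sdiff_add_card_inter M C
  rw [Finset.card_union_of_disjoint hBHd] at c1
  change A.card ≤ 2 * k at hmk
  change M.card ≤ k at huk
  have hsupport : ∀ i : Fin (nOf x), i ∈ (graphOf x).support ↔ ∃ j < nOf x, AdjN x i j :=
    fun i => mem_support_graphOf
  have hHs : ∀ i ∈ H, ∃ j < nOf x, AdjN x i j := fun i hi => hsup i i.2 ((memA i).1 (hHA i hi))
  refine ⟨C, H, B, m, ⟨⟨?_, ?_, ?_, hBHd.symm, ?_, ?_, hmC, ?_, hinj⟩, ?_, ?_⟩, ?_⟩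
  · ext i
    rw [hsupport]
    simp only [Finset.coe_union, Set.mem_union, Finset.mem_coe]
    constructor
    · rintro ((hi | hi) | hi)
      · exact ((memC i).1 hi).1
      · exact hHs i hi
      · exact ((memB i).1 hi).1
    · intro hi
      by_cases h1 : i ∈ C
      · exact .inl (.inl h1)
      by_cases h2 : i ∈ H
      · exact .inl (.inr h2)
      exact .inr ((memB i).2 ⟨hi, h1, h2⟩)
  · exact Finset.disjoint_left.2 fun i hi hi' => hCA i hi (hHA i hi')
  · exact Finset.disjoint_left.2 fun i hi hi' => ((memB i).1 hi').2.1 hi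
  · intro u hu v hv hadj
    rcases hmax u u.2 v v.2 (graphOf_adj.1 hadj) with h1 | h1
    · exact h1 ((memC u).1 hu).2.1
    · exact h1 ((memC v).1 hv).2.1
  · intro v _
    constructor
    · intro hv
      exact ⟨m v, hmC v hv, graphOf_adj.2 (h.mate_adj v v.2 _ (hm v hv)).symm⟩
    · rintro ⟨c, hc, hadj⟩
      exact (memH v).2 (((memC c).1 hc).2.2 v v.2 (graphOf_adj.1 hadj))
  · intro i hi
    exact graphOf_adj.2 (h.mate_adj i i.2 _ (hm i hi))
  · omega
  · omega
  · ext i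
    rw [Set.mem_sdiff, hsupport, Finset.mem_coe, Finset.mem_sdiff, Set.mem_ofPred_eq]
    constructor
    · rintro ⟨h1, h2⟩
      by_contra! h3
      refine h2 ⟨hfree i h1 h3.1 h3.2, fun h4 => ?_⟩
      obtain ⟨j, hj, rfl⟩ := Finset.mem_image.1 h4
      exact (memM _).1 (hmM j hj) h3.2
    · rintro (h1 | h1)
      · exact ⟨hsup i i.2 h1, fun h2 => h1 ((memC i).1 h2.1).2.1⟩
      -- A matched vertex of `C` has its partner in `H`, so it belongs to `m(H)`. Thus the deleted
      -- part of the crown is independent of `ℓ`.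
      · refine ⟨hMsup i h1, fun h2 => h2.2 (Finset.mem_image.2 ?_)⟩
        obtain ⟨a, ha, e⟩ := h.exists_mate i i.2 h1
        have haH : (⟨a, ha⟩ : Fin (nOf x)) ∈ H :=
          (memH _).2 (((memC i).1 h2.1).2.2 a ha (h.mate_adj a ha _ e).symm)
        refine ⟨⟨a, ha⟩, haH, Fin.ext ?_⟩
        have := hm ⟨a, ha⟩ haH
        simp only at this
        omega

end AuctionInv

end EnumVC

open RAM

/-! ### The reduction as a program -/

notation "rK" => (5 : ℕ)
notation "rN" => (6 : ℕ)
notation "rN1" => (7 : ℕ)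
notation "rI" => (8 : ℕ)
notation "rJ" => (9 : ℕ)
notation "rT" => (10 : ℕ)
notation "rC" => (11 : ℕ)
notation "rM" => (12 : ℕ)
notation "rU" => (13 : ℕ)
notation "rX" => (14 : ℕ)
notation "rP" => (15 : ℕ)
notation "rQ" => (16 : ℕ)
notation "rB" => (17 : ℕ)
notation "rV" => (18 : ℕ)
notation "rZ" => (19 : ℕ)
notation "rA" => (20 : ℕ)
notation "rW" => (21 : ℕ)
notation "rG" => (22 : ℕ)
notation "rO" => (23 : ℕ)
notation "aIn" => (0 : ℕ)
notation "aSol" => (2 : ℕ)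
notation "aRow" => (3 : ℕ)
notation "aKeep" => (4 : ℕ)
notation "aMark" => (5 : ℕ)
notation "aMate" => (6 : ℕ)
notation "aUsed" => (7 : ℕ)
notation "aLab" => (8 : ℕ)
notation "aSet" => (9 : ℕ)
notation "aFree" => (10 : ℕ)

namespace EnumVC

/-- Read `k` and `n` from the input word; register `rZ` counts the zeros read so far. -/
def parseProg : Prog :=
  .count rI 0 (.ite (.cell aIn (.reg rI))
    (.ite (.reg rZ)
      (.ite (.sub (.reg rZ) (.lit 1)) .skip (.assign rN (.add (.reg rN) (.lit 1))))
      (.assign rK (.add (.reg rK) (.lit 1))))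
    (.assign rZ (.add (.reg rZ) (.lit 1))))

/-- Compute the loop limits. -/
def setupProg : Prog :=
  .seq parseProg (.assign rN1 (.add (.reg rN) (.lit 1)))

/-- Compute the addresses of the rows of the adjacency matrix. -/
def rowsProg : Prog :=
  .seq (.assign rA (.add (.add (.reg rK) (.reg rN)) (.lit 2)))
    (.count rI rN (.seq (.store aRow (.reg rI) (.reg rA))
      (.assign rA (.add (.reg rA) (.reg rN)))))

/-- Run `p` if the vertices in the registers `i` and `j` are adjacent. -/
def ifAdj (i j : ℕ) (p : Prog) : Prog :=
  .ite (.add (.sub (.reg i) (.reg j)) (.sub (.reg j) (.reg i)))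
    (.ite (.add (.cell aIn (.add (.cell aRow (.reg i)) (.reg j)))
      (.cell aIn (.add (.cell aRow (.reg j)) (.reg i)))) p .skip) .skip

/-- Mark the vertices that are not isolated, and count them. -/
def supportProg : Prog :=
  .seq (.assign rC (.lit 0)) (.count rI rN
    (.seq (.assign rT (.lit 0)) (.seq (.count rJ rN (ifAdj rI rJ (.assign rT (.lit 1))))
      (.seq (.store aKeep (.reg rI) (.reg rT)) (.assign rC (.add (.reg rC) (.reg rT)))))))

/-- Match two adjacent vertices if both are unmarked. -/
def pairProg : Prog :=
  .ite (.add (.cell aMark (.reg rI)) (.cell aMark (.reg rJ))) .skip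
    (.seq (.store aMark (.reg rI) (.lit 1)) (.seq (.store aMark (.reg rJ) (.lit 1))
      (.assign rM (.add (.reg rM) (.lit 1)))))

/-- Greedily construct a maximal matching, mark its vertices, and count its edges. -/
def greedyProg : Prog :=
  .seq (.assign rM (.lit 0)) (.count rI rN (.count rJ rN (ifAdj rI rJ pairProg)))

/-- Find the neighbor of least label. -/
def bestProg : Prog :=
  .count rJ rN (ifAdj rI rJ (.ite (.sub (.reg rV) (.cell aLab (.reg rJ)))
    (.seq (.assign rB (.add (.reg rJ) (.lit 1))) (.assign rV (.cell aLab (.reg rJ)))) .skip))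

/-- Match the vertex in register `rI` to its neighbor `rB - 1`, which loses its previous mate. -/
def kickProg : Prog :=
  .seq (.assign rB (.sub (.reg rB) (.lit 1)))
    (.seq (.assign rO (.cell aMate (.reg rB)))
      (.seq (.ite (.reg rO) (.store aUsed (.sub (.reg rO) (.lit 1)) (.lit 0)) .skip)
        (.seq (.store aMate (.reg rB) (.add (.reg rI) (.lit 1)))
          (.seq (.store aUsed (.reg rI) (.lit 1))
            (.store aLab (.reg rB) (.add (.cell aLab (.reg rB)) (.lit 1)))))))

/-- One bid of the vertex in register `rI`, if it is unmarked and unmatched. -/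
def bidProg : Prog :=
  .ite (.add (.cell aMark (.reg rI)) (.cell aUsed (.reg rI))) .skip
    (.seq (.assign rB (.lit 0)) (.seq (.assign rV (.reg rN1)) (.seq bestProg
      (.ite (.reg rB) kickProg .skip))))

/-- The auction: `(n + 1)²` rounds of bids of all vertices. -/
def auctionProg : Prog :=
  .count rP rN1 (.count rQ rN1 (.count rI rN bidProg))

/-- Keep the marked and the matched vertices, and count the latter. -/
def countProg : Prog :=
  .seq (.assign rU (.lit 0)) (.count rI rN
    (.seq (.store aKeep (.reg rI) (.add (.cell aMark (.reg rI)) (.cell aUsed (.reg rI))))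
      (.ite (.cell aUsed (.reg rI)) (.assign rU (.add (.reg rU) (.lit 1))) .skip)))

/-- Array `aKeep` gets the vertices of the reduced graph; register `rX` becomes nonzero if there is
a matching that proves that the instance has no solution. -/
def reduceProg : Prog :=
  .seq rowsProg (.seq supportProg
    (.ite (.sub (.reg rC) (.add (.reg rK) (.add (.reg rK) (.reg rK))))
      (.seq greedyProg (.seq auctionProg (.seq countProg
        (.assign rX (.add (.sub (.reg rM) (.reg rK)) (.sub (.reg rU) (.reg rK)))))))
      .skip))

/-! ### Parsing the input word -/

theorem ones_append (w : Word) (b : Bool) :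
    ones (w ++ [b]) = if b = true ∧ w.count false = 0 then ones w + 1 else ones w := by
  unfold ones
  rw [List.idxOf_append]
  by_cases h : false ∈ w
  · simp [h, List.count_eq_zero]
  · rw [if_neg h, List.idxOf_of_notMem h]
    cases b
    · simp
    · simp [h, List.count_eq_zero, Nat.add_comm]

/-- Read from left to right, a one counts for `k` before the first zero and for `n` between the
first and the second. Together with `ones_append` this describes the transitions of `parseProg`. -/
theorem nOf_append (w : Word) (b : Bool) :
    nOf (w ++ [b]) = if b = true ∧ w.count false = 1 then nOf w + 1 else nOf w := by
  unfold nOf kOf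
  rw [ones_append]
  by_cases h : false ∈ w
  · have hlt : ones w < w.length := List.idxOf_lt_length_of_mem h
    have h0 : w.count false ≠ 0 := by simpa [List.count_eq_zero] using h
    have hc : w.count false = (w.drop (ones w + 1)).count false + 1 := by
      conv_lhs => rw [← List.take_append_drop (ones w) w]
      rw [List.count_append, List.drop_eq_getElem_cons hlt]
      have h1 : (w.take (ones w)).count false = 0 := by
        rw [List.count_eq_zero, List.mem_take_iff_idxOf_lt h]
        simp [ones]
      have h2 : w[ones w] = false := List.getElem_idxOf hlt
      rw [h1, h2]
      simp
    rw [if_neg (by simp [h0]), List.drop_append_of_le_length (by omega), ones_append]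
    simp [hc]
  · have h0 : w.count false = 0 := by simpa [List.count_eq_zero] using h
    have h1 : ones w = w.length := List.idxOf_of_notMem h
    have h2 : ∀ m, w.length ≤ m → (w ++ [b]).drop (m + 1) = [] := fun m hm => by simpa using hm
    have h3 : w.drop (w.length + 1) = [] := by simp
    have h4 : ¬ (b = true ∧ w.count false = 1) := by simp [h0]
    rw [if_neg h4, h1, h3]
    split_ifs <;> rw [h2 _ (by omega)]

/-! ### Relating machine states to the input graph -/

/-- The state provides the input word and the numbers `k`, `n`, and `n + 1`. -/
structure Ctx0 (x : Word) (s : State) : Prop where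
  k : s.regs rK = kOf x
  n : s.regs rN = nOf x
  n1 : s.regs rN1 = nOf x + 1
  input : ∀ i, s.arrs aIn i = (x.getD i false).toNat

/-- The state also provides the addresses of the rows of the adjacency matrix. -/
structure Ctx (x : Word) (s : State) : Prop extends Ctx0 x s where
  row : ∀ i < nOf x, s.arrs aRow i = kOf x + 1 + (nOf x + 1) + i * nOf x

theorem sem_setupProg {x : Word} {s : State} (hK : s.regs rK = 0) (hN : s.regs rN = 0)
    (hZ : s.regs rZ = 0) (hlen : s.regs 0 = x.length)
    (hin : ∀ i, s.arrs aIn i = (x.getD i false).toNat) : Ctx0 x (setupProg.sem s) := by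
  have key : (parseProg.sem s).regs rK = kOf (x.take (s.regs 0)) ∧
      (parseProg.sem s).regs rN = nOf (x.take (s.regs 0)) ∧
      (parseProg.sem s).regs rZ = (x.take (s.regs 0)).count false ∧
      (parseProg.sem s).arrs aIn = s.arrs aIn := by
    refine Prog.sem_count_induct (Inv := fun j s' => s'.regs rK = kOf (x.take j) ∧
      s'.regs rN = nOf (x.take j) ∧ s'.regs rZ = (x.take j).count false ∧
      s'.arrs aIn = s.arrs aIn) rfl ?_ ?_
    · simp [hK, hN, hZ, kOf, nOf, ones]
    · rintro j s' hj hi ⟨h1, h2, h3, h4⟩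
      rw [hlen] at hj
      have e : x.take (j + 1) = x.take j ++ [x[j]] := (List.take_append_getElem hj).symm
      have hb : s'.arrs aIn (s'.regs rI) = x[j].toNat := by
        rw [h4, hin, hi]
        simp [List.getD, hj]
      rw [e, nOf_append, kOf, ones_append, List.count_append, ← kOf]
      cases hx : x[j]
      · simp [Prog.sem, Exp.eval, hb, hx, h1, h2, h3, h4]
      · by_cases z0 : (x.take j).count false = 0
        · simp [Prog.sem, Exp.eval, hb, hx, h1, h2, h3, h4, z0]
        · by_cases z1 : (x.take j).count false = 1
          · simp [Prog.sem, Exp.eval, hb, hx, h1, h2, h3, h4, z1]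
          · have z2 : (x.take j).count false - 1 ≠ 0 := by omega
            simp [Prog.sem, Exp.eval, hb, hx, h1, h2, h3, h4, z0, z1, z2]
  rw [hlen, List.take_length] at key
  obtain ⟨h1, h2, -, h4⟩ := key
  constructor <;> simp [setupProg, Prog.sem, Exp.eval, h1, h2, h4, hin]

namespace Ctx

variable {x : Word} {s : State}

/-- The program does not write the registers and arrays of the context. -/
def _root_.RAM.Prog.Safe (p : Prog) : Bool :=
  p.Ok [rK, rN, rN1] && !p.writesArr aIn && !p.writesArr aRow

theorem congr (h : Ctx x s) {s' : State} (h5 : s'.regs rK = s.regs rK)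
    (h6 : s'.regs rN = s.regs rN) (h7 : s'.regs rN1 = s.regs rN1)
    (h0 : s'.arrs aIn = s.arrs aIn) (h3 : s'.arrs aRow = s.arrs aRow) : Ctx x s' :=
  ⟨⟨h5.trans h.k, h6.trans h.n, h7.trans h.n1, h0 ▸ h.input⟩, h3 ▸ h.row⟩

theorem sem (h : Ctx x s) {p : Prog} (hp : p.Safe = true) : Ctx x (p.sem s) := by
  simp only [Prog.Safe, Bool.and_eq_true, Bool.not_eq_true'] at hp
  exact h.congr (Prog.sem_regs_of_not_writes (Prog.not_writesReg_of_ok hp.1.1 (by simp)) s)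
    (Prog.sem_regs_of_not_writes (Prog.not_writesReg_of_ok hp.1.1 (by simp)) s)
    (Prog.sem_regs_of_not_writes (Prog.not_writesReg_of_ok hp.1.1 (by simp)) s)
    (Prog.sem_arrs_of_not_writes hp.1.2 s) (Prog.sem_arrs_of_not_writes hp.2 s)

theorem setReg (h : Ctx x s) {r : ℕ} (v : ℕ) (hr : r ≠ rK ∧ r ≠ rN ∧ r ≠ rN1 := by decide) :
    Ctx x (s.setReg r v) :=
  h.congr (by simp [hr.1.symm]) (by simp [hr.2.1.symm]) (by simp [hr.2.2.symm]) rfl rfl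

theorem bit (h : Ctx x s) {i j : ℕ} (hi : i < nOf x) :
    s.arrs aIn (s.arrs aRow i + j) = (bitOf x i j).toNat := by
  rw [h.input, h.row i hi, bitOf, Nat.add_assoc (kOf x + 1 + (nOf x + 1))]

theorem sem_ifAdj (h : Ctx x s) {i j : ℕ} (p : Prog) (hi : s.regs i < nOf x)
    (hj : s.regs j < nOf x) :
    (ifAdj i j p).sem s = if AdjN x (s.regs i) (s.regs j) then p.sem s else s := by
  simp only [ifAdj, Prog.sem, Exp.eval, h.bit hi, h.bit hj, AdjN]
  -- With truncated subtraction, the two differences vanish together only for equal numbers.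
  have h1 : s.regs i - s.regs j + (s.regs j - s.regs i) ≠ 0 ↔ s.regs i ≠ s.regs j := by omega
  simp only [h1, ite_and]
  refine if_congr Iff.rfl (if_congr ?_ rfl rfl) rfl
  cases bitOf x (s.regs i) (s.regs j) <;> cases bitOf x (s.regs j) (s.regs i) <;> simp

end Ctx

/-- Expressions have no product, so each row address is obtained from the previous one by adding
`n`; the invariant keeps the next address in `rA`. -/
theorem sem_rowsProg {x : Word} {s : State} (h : Ctx0 x s) : Ctx x (rowsProg.sem s) := by
  have hN : ((Prog.assign rA (.add (.add (.reg rK) (.reg rN)) (.lit 2))).sem s).regs rN = nOf x := by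
    simp [Prog.sem, h.n]
  have key : (∀ i < nOf x, (rowsProg.sem s).arrs aRow i = kOf x + 1 + (nOf x + 1) + i * nOf x) ∧
      (rowsProg.sem s).regs rA = kOf x + 1 + (nOf x + 1) + nOf x * nOf x ∧
      Ctx0 x (rowsProg.sem s) := by
    have := Prog.sem_count_induct (i := rI) (l := rN)
      (p := .seq (.store aRow (.reg rI) (.reg rA)) (.assign rA (.add (.reg rA) (.reg rN))))
      (Inv := fun j s' =>
        (∀ i < j, s'.arrs aRow i = kOf x + 1 + (nOf x + 1) + i * nOf x) ∧
        s'.regs rA = kOf x + 1 + (nOf x + 1) + j * nOf x ∧ Ctx0 x s')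
      (s := (Prog.assign rA (.add (.add (.reg rK) (.reg rN)) (.lit 2))).sem s) rfl ?_ ?_
    · rw [hN] at this
      exact this
    · refine ⟨by simp, ?_, ?_⟩
      · simp [Prog.sem, Exp.eval, h.k, h.n]; omega
      · constructor <;> simp [Prog.sem, h.k, h.n, h.n1, h.input]
    · rintro j s' hj hi ⟨h1, h2, h3⟩
      refine ⟨fun i hi' => ?_, ?_, ?_⟩
      · simp only [Prog.sem, Exp.eval, State.arrs_setReg, State.arrs_setArr, hi, true_and]
        split_ifs with e
        · rw [h2, e]
        · exact h1 i (by omega)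
      · simp [Prog.sem, Exp.eval, h2, h3.n, Nat.succ_mul, Nat.add_assoc]
      · constructor <;> simp [Prog.sem, h3.k, h3.n, h3.n1, h3.input]
  exact ⟨key.2.2, key.1⟩

/-! ### Finding the non-isolated vertices -/

/-- The vertex `i` is not isolated. -/
def Supp (x : Word) (i : ℕ) : Prop := ∃ j < nOf x, AdjN x i j

instance (x : Word) (i : ℕ) : Decidable (Supp x i) := by unfold Supp; infer_instance

theorem sem_supportProg_inner {x : Word} {s : State} (h : Ctx x s) (hi : s.regs rI < nOf x)
    (hT : s.regs rT = 0) :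
    ((Prog.count rJ rN (ifAdj rI rJ (.assign rT (.lit 1)))).sem s).regs rT =
      if Supp x (s.regs rI) then 1 else 0 := by
  have := Prog.sem_count_induct (i := rJ) (l := rN) (p := ifAdj rI rJ (.assign rT (.lit 1)))
    (Inv := fun j s' => Ctx x s' ∧ s'.regs rI = s.regs rI ∧
      s'.regs rT = if ∃ j' < j, AdjN x (s.regs rI) j' then 1 else 0) (s := s) rfl ?_ ?_
  · rw [h.n] at this
    exact this.2.2
  · exact ⟨h.setReg 0, by simp, by simp [hT]⟩
  · rintro j s' hj hj' ⟨h1, h2, h3⟩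
    rw [h.n] at hj
    refine ⟨(h1.sem rfl).setReg _, ?_, ?_⟩
    · simp [Prog.sem_regs_of_not_writes (p := ifAdj rI rJ (.assign rT (.lit 1))) (r := rI) rfl, h2]
    · rw [h1.sem_ifAdj _ (by omega) (by omega), hj', h2]
      by_cases ha : AdjN x (s.regs rI) j
      · have : ∃ j' < j + 1, AdjN x (s.regs rI) j' := ⟨j, by omega, ha⟩
        rw [if_pos ha, if_pos this]
        simp [Prog.sem, Exp.eval]
      · have : (∃ j' < j + 1, AdjN x (s.regs rI) j') ↔ ∃ j' < j, AdjN x (s.regs rI) j' := by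
          constructor
          · rintro ⟨j', h4, h5⟩
            rcases Nat.lt_succ_iff_lt_or_eq.1 h4 with h6 | rfl
            · exact ⟨j', h6, h5⟩
            · exact absurd h5 ha
          · rintro ⟨j', h4, h5⟩
            exact ⟨j', by omega, h5⟩
        rw [if_neg ha, if_congr this rfl rfl]
        simp [h3]

theorem sem_supportProg {x : Word} {s : State} (h : Ctx x s) :
    (∀ i < nOf x, (supportProg.sem s).arrs aKeep i = if Supp x i then 1 else 0) ∧
      (supportProg.sem s).regs rC = ((Finset.range (nOf x)).filter (Supp x)).card := by
  have := Prog.sem_count_induct (i := rI) (l := rN)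
    (p := .seq (.assign rT (.lit 0)) (.seq (.count rJ rN (ifAdj rI rJ (.assign rT (.lit 1))))
      (.seq (.store aKeep (.reg rI) (.reg rT)) (.assign rC (.add (.reg rC) (.reg rT))))))
    (Inv := fun j s' => Ctx x s' ∧ (∀ i < j, s'.arrs aKeep i = if Supp x i then 1 else 0) ∧
      s'.regs rC = ((Finset.range j).filter (Supp x)).card) (s := s.setReg rC 0) rfl ?_ ?_
  · rw [(h.setReg (r := rC) 0).n] at this
    exact this.2
  · exact ⟨(h.setReg 0).setReg 0, by simp, by simp⟩
  · rintro j s' hj hj' ⟨h1, h2, h3⟩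
    rw [(h.setReg (r := rC) 0).n] at hj
    refine ⟨(h1.sem rfl).setReg _, ?_⟩
    have e := sem_supportProg_inner (h1.setReg (r := rT) 0) (by simpa [hj'] using hj) (by simp)
    have e1 := Prog.sem_regs_of_not_writes
      (p := .count rJ rN (ifAdj rI rJ (.assign rT (.lit 1)))) (r := rI) rfl (s'.setReg rT 0)
    have e2 := Prog.sem_regs_of_not_writes
      (p := .count rJ rN (ifAdj rI rJ (.assign rT (.lit 1)))) (r := rC) rfl (s'.setReg rT 0)
    have e3 := Prog.sem_arrs_of_not_writes
      (p := .count rJ rN (ifAdj rI rJ (.assign rT (.lit 1)))) (a := aKeep) rfl (s'.setReg rT 0)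
    simp only [Prog.sem.eq_5, Prog.sem.eq_2, Prog.sem.eq_3, Exp.eval]
    generalize (Prog.count rJ rN (ifAdj rI rJ (.assign rT (.lit 1)))).sem (s'.setReg rT 0) = u
      at e e1 e2 e3
    simp only [State.regs_setReg, State.arrs_setReg, hj', reduceIte, Nat.reduceEqDiff] at e e1 e2 e3
    constructor
    · intro i hi
      simp only [State.arrs_setReg, State.arrs_setArr, true_and, e1, e, e3]
      by_cases h4 : i = j
      · rw [if_pos h4, h4]
      · rw [if_neg h4, h2 i (by omega)]
    · simp only [State.regs_setReg, State.regs_setArr, Nat.reduceEqDiff, reduceIte, e, e2, h3]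
      rw [Finset.range_add_one, Finset.filter_insert]
      split_ifs <;> simp

end EnumVC

namespace EnumVC

/-! ### Greedy matching -/

/-- Some matching with `m` edges covers exactly the marked vertices; we record only what is needed
of it. -/
structure GreedyInv (x : Word) (mark : ℕ → ℕ) (m : ℕ) : Prop where
  supp : ∀ i < nOf x, mark i ≠ 0 → Supp x i
  card : (Finset.univ.filter fun i : Fin (nOf x) => mark i ≠ 0).card = 2 * m
  cover : ∀ T : Finset (Fin (nOf x)), (graphOf x).IsVertexCover (T : Set (Fin (nOf x))) →
    m ≤ (T.filter fun i : Fin (nOf x) => mark i ≠ 0).card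

/-- A cover contains an end of the new edge, and this end was unmarked before, so the marked part of
every cover strictly grows. -/
theorem GreedyInv.step {x : Word} {mark mark' : ℕ → ℕ} {m : ℕ} (h : GreedyInv x mark m) {i j : ℕ}
    (hi : i < nOf x) (hj : j < nOf x) (hadj : AdjN x i j) (hmi : mark i = 0) (hmj : mark j = 0)
    (hmark : ∀ v, mark' v = if v = i ∨ v = j then 1 else mark v) :
    GreedyInv x mark' (m + 1) := by
  have hne : (⟨i, hi⟩ : Fin (nOf x)) ≠ ⟨j, hj⟩ := fun e => hadj.1 (congrArg Fin.val e)
  refine ⟨?_, ?_, ?_⟩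
  · intro v hv
    rw [hmark]
    split_ifs with e
    · rcases e with rfl | rfl
      · exact fun _ => ⟨j, hj, hadj⟩
      · exact fun _ => ⟨i, hi, hadj.symm⟩
    · exact h.supp v hv
  · have : (Finset.univ.filter fun v : Fin (nOf x) => mark' v ≠ 0) =
        insert ⟨i, hi⟩ (insert ⟨j, hj⟩ (Finset.univ.filter fun v : Fin (nOf x) => mark v ≠ 0)) := by
      ext v
      simp only [Finset.mem_filter, Finset.mem_univ, true_and, Finset.mem_insert, hmark, Fin.ext_iff]
      split_ifs with e
      · simp only [ne_eq, one_ne_zero, not_false_eq_true, true_iff]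
        tauto
      · tauto
    rw [this, Finset.card_insert_of_notMem (by simp [hne, hmi]),
      Finset.card_insert_of_notMem (by simp [hmj]), h.card]
    ring
  · intro T hT
    have h1 := h.cover T hT
    refine (Nat.succ_le_succ h1).trans (Nat.succ_le_of_lt (Finset.card_lt_card ?_))
    refine Finset.ssubset_iff_subset_ne.2 ⟨fun v hv => ?_, fun e => ?_⟩
    · simp only [Finset.mem_filter, hmark] at hv ⊢
      refine ⟨hv.1, ?_⟩
      split_ifs
      · simp
      · exact hv.2
    · rcases hT (graphOf_adj (i := ⟨i, hi⟩) (j := ⟨j, hj⟩).2 hadj) with h2 | h2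
      · have : (⟨i, hi⟩ : Fin (nOf x)) ∈ T.filter fun i : Fin (nOf x) => mark i ≠ 0 := by
          rw [e]; simpa [hmark] using h2
        simp [hmi] at this
      · have : (⟨j, hj⟩ : Fin (nOf x)) ∈ T.filter fun i : Fin (nOf x) => mark i ≠ 0 := by
          rw [e]; simpa [hmark] using h2
        simp [hmj] at this

/-- Marks are never removed, and an adjacent pair has a marked end after its visit. Hence the
unmarked vertices are independent once all pairs have been visited. -/
theorem sem_pairProg {x : Word} {s : State} (hs : GreedyInv x (s.arrs aMark) (s.regs rM))
    (hi : s.regs rI < nOf x) (hj : s.regs rJ < nOf x) (hadj : AdjN x (s.regs rI) (s.regs rJ)) :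
    GreedyInv x ((pairProg.sem s).arrs aMark) ((pairProg.sem s).regs rM) ∧
      (∀ v, s.arrs aMark v ≠ 0 → (pairProg.sem s).arrs aMark v ≠ 0) ∧
      ((pairProg.sem s).arrs aMark (s.regs rI) ≠ 0 ∨
        (pairProg.sem s).arrs aMark (s.regs rJ) ≠ 0) := by
  by_cases h0 : s.arrs aMark (s.regs rI) + s.arrs aMark (s.regs rJ) = 0
  · have e : pairProg.sem s = ((s.setArr aMark (s.regs rI) 1).setArr aMark (s.regs rJ) 1).setReg rM
        (s.regs rM + 1) := by
      simp [pairProg, Prog.sem, Exp.eval, h0]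
    rw [e]
    simp only [State.arrs_setReg, State.regs_setReg, reduceIte]
    refine ⟨hs.step hi hj hadj (by omega) (by omega) fun v => ?_, fun v hv => ?_, .inl ?_⟩
    · simp only [State.arrs_setArr, true_and]
      by_cases h1 : v = s.regs rJ <;> by_cases h2 : v = s.regs rI <;> simp [h1, h2]
    · simp only [State.arrs_setArr, true_and]
      split_ifs <;> simp [hv]
    · simp only [State.arrs_setArr, true_and]
      split_ifs <;> simp
  · have e : pairProg.sem s = s := by
      simp only [pairProg, Prog.sem, Exp.eval, ne_eq, h0, not_false_eq_true, if_true]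
    rw [e]
    exact ⟨hs, fun v hv => hv, by omega⟩

theorem sem_greedyProg {x : Word} {s : State} (h : Ctx x s) (h0 : ∀ v, s.arrs aMark v = 0) :
    GreedyInv x ((greedyProg.sem s).arrs aMark) ((greedyProg.sem s).regs rM) ∧
      ∀ i < nOf x, ∀ j < nOf x, AdjN x i j →
        (greedyProg.sem s).arrs aMark i ≠ 0 ∨ (greedyProg.sem s).arrs aMark j ≠ 0 := by
  have hout := Prog.sem_count_induct (i := rI) (l := rN)
    (p := .count rJ rN (ifAdj rI rJ pairProg))
    (Inv := fun i s' => Ctx x s' ∧ GreedyInv x (s'.arrs aMark) (s'.regs rM) ∧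
      ∀ i' < i, ∀ j' < nOf x, AdjN x i' j' → s'.arrs aMark i' ≠ 0 ∨ s'.arrs aMark j' ≠ 0)
    (s := s.setReg rM 0) rfl ?_ ?_
  · rw [(h.setReg (r := rM) 0).n] at hout
    exact hout.2
  · refine ⟨(h.setReg 0).setReg 0, ⟨?_, ?_, ?_⟩, by simp⟩ <;> simp [h0]
  · rintro i s' hi hi' ⟨h1, h2, h3⟩
    rw [(h.setReg (r := rM) 0).n] at hi
    have hin := Prog.sem_count_induct (i := rJ) (l := rN) (p := ifAdj rI rJ pairProg)
      (Inv := fun j u => Ctx x u ∧ u.regs rI = i ∧ GreedyInv x (u.arrs aMark) (u.regs rM) ∧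
        (∀ i' < i, ∀ j' < nOf x, AdjN x i' j' → u.arrs aMark i' ≠ 0 ∨ u.arrs aMark j' ≠ 0) ∧
        ∀ j' < j, AdjN x i j' → u.arrs aMark i ≠ 0 ∨ u.arrs aMark j' ≠ 0)
      (s := s') rfl ?_ ?_
    · rw [h1.n] at hin
      obtain ⟨a1, a2, a3, a4, a5⟩ := hin
      refine ⟨a1.setReg _, by simpa using a3, ?_⟩
      simp only [State.arrs_setReg]
      intro i' hi'' j' hj' hadj
      rcases Nat.lt_succ_iff_lt_or_eq.1 hi'' with h6 | rfl
      · exact a4 i' h6 j' hj' hadj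
      · exact a5 j' hj' hadj
    · exact ⟨h1.setReg 0, by simp [hi'], by simpa using h2, by simpa using h3, by simp⟩
    · rintro j u hj hj' ⟨b1, b2, b3, b4, b5⟩
      rw [h1.n] at hj
      refine ⟨(b1.sem rfl).setReg _, ?_, ?_⟩
      · simpa [Prog.sem_regs_of_not_writes (p := ifAdj rI rJ pairProg) (r := rI) rfl] using b2
      rw [b1.sem_ifAdj _ (by omega) (by omega), b2, hj']
      simp only [State.arrs_setReg, State.regs_setReg, Nat.reduceEqDiff, reduceIte]
      split_ifs with ha
      · obtain ⟨c1, c2, c3⟩ := sem_pairProg b3 (by omega) (by omega) (by rwa [b2, hj'])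
        rw [b2, hj'] at c3
        refine ⟨c1, fun i' h4 j' h5 h6 => (b4 i' h4 j' h5 h6).imp (c2 _) (c2 _), ?_⟩
        intro j' h4 h5
        rcases Nat.lt_succ_iff_lt_or_eq.1 h4 with h6 | rfl
        · exact (b5 j' h6 h5).imp (c2 _) (c2 _)
        · exact c3
      · refine ⟨b3, b4, ?_⟩
        intro j' h4 h5
        rcases Nat.lt_succ_iff_lt_or_eq.1 h4 with h6 | rfl
        · exact b5 j' h6 h5
        · exact absurd h5 ha

/-! ### The auction -/

/-- The invariant of the auction, for the arrays of a state. -/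
def AInv (x : Word) (s : State) : Prop :=
  AuctionInv x (s.arrs aMark) (s.arrs aMate) (s.arrs aUsed) (s.arrs aLab)

/-- The vertex `c` does not bid any more. -/
def Quiet (x : Word) (s : State) (c : ℕ) : Prop :=
  s.arrs aMark c = 0 → s.arrs aUsed c = 0 → ∀ b < nOf x, AdjN x c b → nOf x < s.arrs aLab b

/-- The sum of the labels. -/
def labSum (x : Word) (s : State) : ℕ := ∑ a ∈ Finset.range (nOf x), s.arrs aLab a

/-- The running minimum starts at `n + 1` and only strict improvements count, so a neighbor of label
`n + 1` is never chosen. This caps the labels, and `rB = 0` means that all neighbors have reached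
the cap; otherwise `rB` is the chosen vertex plus one. -/
theorem sem_bestProg {x : Word} {s : State} (h : Ctx x s) (hI : s.regs rI < nOf x)
    (hB : s.regs rB = 0) (hV : s.regs rV = nOf x + 1) :
    (bestProg.sem s).regs rV ≤ nOf x + 1 ∧
      (∀ b < nOf x, AdjN x (s.regs rI) b → (bestProg.sem s).regs rV ≤ s.arrs aLab b) ∧
      (((bestProg.sem s).regs rB = 0 ∧ (bestProg.sem s).regs rV = nOf x + 1) ∨
        ∃ a < nOf x, (bestProg.sem s).regs rB = a + 1 ∧ AdjN x (s.regs rI) a ∧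
          (bestProg.sem s).regs rV = s.arrs aLab a ∧ s.arrs aLab a < nOf x + 1) := by
  have := Prog.sem_count_induct (i := rJ) (l := rN)
    (p := ifAdj rI rJ (.ite (.sub (.reg rV) (.cell aLab (.reg rJ)))
      (.seq (.assign rB (.add (.reg rJ) (.lit 1))) (.assign rV (.cell aLab (.reg rJ)))) .skip))
    (Inv := fun j u => Ctx x u ∧ u.regs rI = s.regs rI ∧ u.arrs aLab = s.arrs aLab ∧
      u.regs rV ≤ nOf x + 1 ∧
      (∀ b < j, AdjN x (s.regs rI) b → u.regs rV ≤ s.arrs aLab b) ∧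
      ((u.regs rB = 0 ∧ u.regs rV = nOf x + 1) ∨
        ∃ a < j, u.regs rB = a + 1 ∧ AdjN x (s.regs rI) a ∧
          u.regs rV = s.arrs aLab a ∧ s.arrs aLab a < nOf x + 1)) (s := s) rfl ?_ ?_
  · rw [h.n] at this
    exact this.2.2.2
  · exact ⟨h.setReg 0, by simp, rfl, by simp [hV], by simp, by simp [hB, hV]⟩
  · rintro j u hj hj' ⟨h1, h2, h3, h4, h5, h6⟩
    rw [h.n] at hj
    refine ⟨(h1.sem rfl).setReg _, ?_, ?_, ?_⟩
    · rw [State.regs_setReg, if_neg (by simp), Prog.sem_regs_of_not_writes rfl, h2]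
    · rw [State.arrs_setReg, Prog.sem_arrs_of_not_writes rfl, h3]
    rw [h1.sem_ifAdj _ (by omega) (by omega), h2, hj']
    have hold : ∀ (v : ℕ), (∀ b < j, AdjN x (s.regs rI) b → v ≤ s.arrs aLab b) →
        (AdjN x (s.regs rI) j → v ≤ s.arrs aLab j) →
        ∀ b < j + 1, AdjN x (s.regs rI) b → v ≤ s.arrs aLab b := by
      intro v a1 a2 b hb hb'
      rcases Nat.lt_succ_iff_lt_or_eq.1 hb with h7 | rfl
      · exact a1 b h7 hb'
      · exact a2 hb'
    have hex : (u.regs rB = 0 ∧ u.regs rV = nOf x + 1) ∨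
        (∃ a < j + 1, u.regs rB = a + 1 ∧ AdjN x (s.regs rI) a ∧
          u.regs rV = s.arrs aLab a ∧ s.arrs aLab a < nOf x + 1) :=
      h6.imp_right fun ⟨a, h7, h8⟩ => ⟨a, by omega, h8⟩
    split_ifs with ha
    · by_cases hlt : u.regs rV - u.arrs aLab (u.regs rJ) = 0
      · have e : (Prog.ite (.sub (.reg rV) (.cell aLab (.reg rJ))) (.seq (.assign rB (.add (.reg rJ)
            (.lit 1))) (.assign rV (.cell aLab (.reg rJ)))) .skip).sem u = u := by
          simp only [Prog.sem, Exp.eval, hlt, ne_eq, not_true_eq_false, if_false]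
        rw [e]
        simp only [State.regs_setReg, Nat.reduceEqDiff, reduceIte]
        rw [h3, hj'] at hlt
        exact ⟨h4, hold _ h5 fun _ => by omega, hex⟩
      · have e : (Prog.ite (.sub (.reg rV) (.cell aLab (.reg rJ))) (.seq (.assign rB (.add (.reg rJ)
            (.lit 1))) (.assign rV (.cell aLab (.reg rJ)))) .skip).sem u =
            (u.setReg rB (j + 1)).setReg rV (s.arrs aLab j) := by
          rw [h3, hj'] at hlt
          simp [Prog.sem, Exp.eval, hlt, hj', h3]
        rw [e]
        simp only [State.regs_setReg, Nat.reduceEqDiff, reduceIte]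
        rw [h3, hj'] at hlt
        refine ⟨by omega, hold _ (fun b hb hb' => ?_) fun _ => le_rfl,
          .inr ⟨j, by omega, rfl, ha, rfl, by omega⟩⟩
        have := h5 b hb hb'
        omega
    · simp only [State.regs_setReg, Nat.reduceEqDiff, reduceIte]
      exact ⟨h4, hold _ h5 fun h7 => absurd h7 ha, hex⟩

/-- The sum of the labels is the potential that limits the number of bids. -/
theorem sem_kickProg {x : Word} {s : State} (hinv : AInv x s) (hI : s.regs rI < nOf x)
    (hm : s.arrs aMark (s.regs rI) = 0) (hu : s.arrs aUsed (s.regs rI) = 0) {a : ℕ}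
    (ha : a < nOf x) (hB : s.regs rB = a + 1) (hadj : AdjN x (s.regs rI) a)
    (hlt : s.arrs aLab a < nOf x + 1)
    (hmin : ∀ b < nOf x, AdjN x (s.regs rI) b → s.arrs aLab a ≤ s.arrs aLab b) :
    AInv x (kickProg.sem s) ∧ labSum x (kickProg.sem s) = labSum x s + 1 := by
  have hmark : (kickProg.sem s).arrs aMark = s.arrs aMark := Prog.sem_arrs_of_not_writes rfl s
  have hmate : ∀ b, (kickProg.sem s).arrs aMate b =
      if b = a then s.regs rI + 1 else s.arrs aMate b := by
    intro b
    by_cases h0 : s.arrs aMate a = 0 <;> simp [kickProg, Prog.sem, Exp.eval, hB, h0]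
  have hused : ∀ b, (kickProg.sem s).arrs aUsed b = if b = s.regs rI then 1 else
      if s.arrs aMate a = b + 1 then 0 else s.arrs aUsed b := by
    intro b
    by_cases h0 : s.arrs aMate a = 0
    · simp [kickProg, Prog.sem, Exp.eval, hB, h0]
    · have : b = s.arrs aMate a - 1 ↔ s.arrs aMate a = b + 1 := by omega
      simp [kickProg, Prog.sem, Exp.eval, hB, h0, this]
  have hlab : ∀ b, (kickProg.sem s).arrs aLab b =
      if b = a then s.arrs aLab a + 1 else s.arrs aLab b := by
    intro b
    by_cases h0 : s.arrs aMate a = 0 <;> simp [kickProg, Prog.sem, Exp.eval, hB, h0]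
  constructor
  · unfold AInv
    rw [hmark]
    exact AuctionInv.step hinv ha hI hm hu hadj hlt hmin hmate hused hlab
  · have ha' : a ∈ Finset.range (nOf x) := by simpa using ha
    unfold labSum
    have e : ∑ b ∈ (Finset.range (nOf x)).erase a, (kickProg.sem s).arrs aLab b =
        ∑ b ∈ (Finset.range (nOf x)).erase a, s.arrs aLab b :=
      Finset.sum_congr rfl fun b hb => (hlab b).trans (if_neg (Finset.ne_of_mem_erase hb))
    rw [← Finset.add_sum_erase _ _ ha', ← Finset.add_sum_erase _ _ ha', e, hlab, if_pos rfl]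
    omega

theorem sem_bidProg {x : Word} {s : State} (h : Ctx x s) (hinv : AInv x s)
    (hI : s.regs rI < nOf x) :
    AInv x (bidProg.sem s) ∧
      ((labSum x (bidProg.sem s) = labSum x s + 1 ∧ ¬ Quiet x s (s.regs rI)) ∨
      ((bidProg.sem s).arrs = s.arrs ∧ Quiet x s (s.regs rI))) := by
  by_cases h0 : s.arrs aMark (s.regs rI) + s.arrs aUsed (s.regs rI) = 0
  · set u := (s.setReg rB 0).setReg rV (nOf x + 1) with hu
    have e : bidProg.sem s = (Prog.ite (.reg rB) kickProg .skip).sem (bestProg.sem u) := by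
      simp [bidProg, Prog.sem, Exp.eval, h0, h.n1, hu]
    have hu' : Ctx x u := (h.setReg 0).setReg _
    have hb := sem_bestProg hu' (by simpa [hu] using hI) (by simp [hu]) (by simp [hu])
    have eI : (bestProg.sem u).regs rI = s.regs rI := Prog.sem_regs_of_not_writes rfl u
    have eA : (bestProg.sem u).arrs = s.arrs := by
      funext a
      exact Prog.sem_arrs_of_not_writes rfl u
    have hinv' : AInv x (bestProg.sem u) := by unfold AInv; rw [eA]; exact hinv
    have hsum : labSum x (bestProg.sem u) = labSum x s := by unfold labSum; rw [eA]
    have huI : u.regs rI = s.regs rI := rfl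
    have huA : u.arrs = s.arrs := rfl
    rw [huI, huA] at hb
    obtain ⟨h1, h2, ⟨h3, h4⟩ | ⟨a, h3, h4, h5, h6, h7⟩⟩ := hb
    · have e' : bidProg.sem s = bestProg.sem u := by
        rw [e]; simp [Prog.sem, Exp.eval, h3]
      rw [e']
      refine ⟨hinv', .inr ⟨eA, fun _ _ b hb hb' => ?_⟩⟩
      have := h2 b hb hb'
      omega
    · have e' : bidProg.sem s = kickProg.sem (bestProg.sem u) := by
        rw [e]; simp [Prog.sem, Exp.eval, h4]
      rw [e', ← hsum]
      have := sem_kickProg hinv' (by rwa [eI]) (by rw [eI, eA]; omega) (by rw [eI, eA]; omega)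
        h3 h4 (by rwa [eI]) (by rwa [eA]) (by rw [eI, eA, ← h6]; exact h2)
      refine ⟨this.1, .inl ⟨this.2, fun hq => ?_⟩⟩
      have := hq (by omega) (by omega) a h3 h5
      omega
  · have e : bidProg.sem s = s := by
      simp only [bidProg, Prog.sem, Exp.eval, ne_eq, h0, not_false_eq_true, if_true]
    rw [e]
    exact ⟨hinv, .inr ⟨rfl, fun h1 h2 => by omega⟩⟩

/-- Until the first successful bid the arrays are those at the start of the round, so a round
without a bid shows that all vertices are quiet in one and the same state. -/
theorem sem_round {x : Word} {s : State} (h : Ctx x s) (hinv : AInv x s) :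
    AInv x ((Prog.count rI rN bidProg).sem s) ∧
      ((labSum x s + 1 ≤ labSum x ((Prog.count rI rN bidProg).sem s) ∧
          ¬ ∀ c < nOf x, Quiet x s c) ∨
        ((Prog.count rI rN bidProg).sem s).arrs = s.arrs ∧ ∀ c < nOf x, Quiet x s c) := by
  have := Prog.sem_count_induct (i := rI) (l := rN) (p := bidProg)
    (Inv := fun c u => Ctx x u ∧ AInv x u ∧
      ((labSum x s + 1 ≤ labSum x u ∧ ¬ ∀ c' < nOf x, Quiet x s c') ∨
      u.arrs = s.arrs ∧ ∀ c' < c, Quiet x s c')) (s := s) rfl ?_ ?_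
  · rw [h.n] at this
    exact this.2
  · exact ⟨h.setReg 0, hinv, .inr ⟨rfl, by simp⟩⟩
  · rintro c u hc hc' ⟨h1, h2, h3⟩
    rw [h.n] at hc
    obtain ⟨h4, h5⟩ := sem_bidProg h1 h2 (by omega)
    refine ⟨(h1.sem rfl).setReg _, h4, ?_⟩
    rcases h3 with ⟨h3, h6⟩ | ⟨h3, h6⟩
    · refine .inl ⟨?_, h6⟩
      change _ ≤ labSum x (bidProg.sem u)
      rcases h5 with h5 | ⟨h5, -⟩
      · omega
      · have : labSum x (bidProg.sem u) = labSum x u := by unfold labSum; rw [h5]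
        omega
    · have hs : labSum x u = labSum x s := by unfold labSum; rw [h3]
      rcases h5 with h5 | ⟨h5, h7⟩
      · refine .inl ⟨?_, fun h8 => h5.2 ?_⟩
        · change _ ≤ labSum x (bidProg.sem u)
          omega
        · have := h8 c hc
          rwa [Quiet, ← h3, ← hc'] at this
      · right
        refine ⟨h5.trans h3, fun c' h8 => ?_⟩
        rcases Nat.lt_succ_iff_lt_or_eq.1 h8 with h9 | rfl
        · exact h6 c' h9
        · rw [Quiet, h3, hc'] at h7
          exact h7

/-- A round in a quiet state changes no array, so quietness persists. If it were never reached, `(n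
+ 1)²` rounds would drive the sum of the labels above its maximum `n (n + 1)`. -/
theorem sem_auctionProg {x : Word} {s : State} (h : Ctx x s) (hinv : AInv x s) :
    AInv x (auctionProg.sem s) ∧ ∀ c < nOf x, Quiet x (auctionProg.sem s) c := by
  have hround : ∀ (m : ℕ) (u : State), Ctx x u → AInv x u →
      (m ≤ labSum x u ∨ ∀ c < nOf x, Quiet x u c) →
      Ctx x ((Prog.count rI rN bidProg).sem u) ∧ AInv x ((Prog.count rI rN bidProg).sem u) ∧
      (m + 1 ≤ labSum x ((Prog.count rI rN bidProg).sem u) ∨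
        ∀ c < nOf x, Quiet x ((Prog.count rI rN bidProg).sem u) c) := by
    intro m u h1 h2 h3
    obtain ⟨h4, h5⟩ := sem_round h1 h2
    refine ⟨h1.sem rfl, h4, ?_⟩
    rcases h5 with ⟨h5, h6⟩ | ⟨h5, h6⟩
    · rcases h3 with h3 | h3
      · left; omega
      · exact absurd h3 h6
    · right
      intro c hc
      rw [Quiet, h5]
      exact h6 c hc
  -- Two nested loops replace a loop limit `(n + 1)²`: after `p` outer and `q` inner rounds the sum
  -- is at least `p (n + 1) + q`, unless all is quiet.
  have hout := Prog.sem_count_induct (i := rP) (l := rN1) (p := .count rQ rN1 (.count rI rN bidProg))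
    (Inv := fun p u => Ctx x u ∧ AInv x u ∧
      (p * (nOf x + 1) ≤ labSum x u ∨ ∀ c < nOf x, Quiet x u c)) (s := s) rfl ?_ ?_
  · rw [h.n1] at hout
    obtain ⟨-, h2, h3⟩ := hout
    refine ⟨h2, h3.resolve_left fun h4 => ?_⟩
    have h5 : labSum x (auctionProg.sem s) ≤ nOf x * (nOf x + 1) := by
      refine (Finset.sum_le_card_nsmul _ _ (nOf x + 1) fun a ha => ?_).trans (by simp)
      exact h2.lab_le a (by simpa using ha)
    have h6 := h4.trans h5
    have h7 : nOf x * (nOf x + 1) < (nOf x + 1) * (nOf x + 1) :=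
      Nat.mul_lt_mul_of_pos_right (by omega) (by omega)
    omega
  · exact ⟨h.setReg 0, hinv, .inl (by simp)⟩
  · rintro p u hp hp' ⟨h1, h2, h3⟩
    have hin := Prog.sem_count_induct (i := rQ) (l := rN1) (p := .count rI rN bidProg)
      (Inv := fun q w => Ctx x w ∧ AInv x w ∧
        (p * (nOf x + 1) + q ≤ labSum x w ∨ ∀ c < nOf x, Quiet x w c)) (s := u) rfl ?_ ?_
    · rw [h1.n1] at hin
      obtain ⟨a1, a2, a3⟩ := hin
      refine ⟨a1.setReg _, a2, ?_⟩
      rw [Nat.succ_mul]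
      exact a3
    · exact ⟨h1.setReg 0, h2, h3⟩
    · rintro q w hq hq' ⟨b1, b2, b3⟩
      obtain ⟨c1, c2, c3⟩ := hround _ w b1 b2 b3
      exact ⟨c1.setReg _, c2, c3⟩

end EnumVC

namespace EnumVC

/-! ### Correctness of the reduction program -/

theorem card_filter_fin (n : ℕ) (p : ℕ → Prop) [DecidablePred p] :
    (Finset.univ.filter fun i : Fin n => p i).card = ((Finset.range n).filter p).card := by
  rw [← Finset.card_map Fin.valEmbedding]
  congr 1
  ext i
  simp only [Finset.mem_map, Finset.mem_filter, Finset.mem_univ, true_and, Fin.valEmbedding_apply,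
    Finset.mem_range]
  constructor
  · rintro ⟨j, hj, rfl⟩
    exact ⟨j.2, hj⟩
  · rintro ⟨h1, h2⟩
    exact ⟨⟨i, h1⟩, h2, rfl⟩

theorem ncard_support_graphOf (x : Word) :
    (graphOf x).support.ncard = ((Finset.range (nOf x)).filter (Supp x)).card := by
  rw [← card_filter_fin, ← Set.ncard_coe_finset]
  congr 1
  ext i
  rw [mem_support_graphOf, Finset.mem_coe, Finset.mem_filter]
  exact ⟨fun h => ⟨Finset.mem_univ _, h⟩, fun h => h.2⟩

theorem sem_countProg {x : Word} {s : State} (h : Ctx x s) :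
    (∀ i < nOf x, (countProg.sem s).arrs aKeep i = s.arrs aMark i + s.arrs aUsed i) ∧
      (countProg.sem s).regs rU =
        ((Finset.range (nOf x)).filter fun i => s.arrs aUsed i ≠ 0).card := by
  have := Prog.sem_count_induct (i := rI) (l := rN)
    (p := .seq (.store aKeep (.reg rI) (.add (.cell aMark (.reg rI)) (.cell aUsed (.reg rI))))
      (.ite (.cell aUsed (.reg rI)) (.assign rU (.add (.reg rU) (.lit 1))) .skip))
    (Inv := fun i u => u.arrs aMark = s.arrs aMark ∧ u.arrs aUsed = s.arrs aUsed ∧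
      (∀ j < i, u.arrs aKeep j = s.arrs aMark j + s.arrs aUsed j) ∧
      u.regs rU = ((Finset.range i).filter fun i => s.arrs aUsed i ≠ 0).card)
    (s := s.setReg rU 0) rfl ?_ ?_
  · rw [(h.setReg (r := rU) 0).n] at this
    exact this.2.2
  · simp
  · rintro i u hi hi' ⟨h1, h2, h3, h4⟩
    simp only [State.arrs_setReg]
    refine ⟨(Prog.sem_arrs_of_not_writes rfl u).trans h1,
      (Prog.sem_arrs_of_not_writes rfl u).trans h2, ?_⟩
    have e : (u.setArr aKeep i (s.arrs aMark i + s.arrs aUsed i)).arrs aUsed i = s.arrs aUsed i := by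
      simp [h2]
    simp only [Prog.sem, Exp.eval, State.regs_setArr, hi', h1, h2, e]
    rw [Finset.range_add_one, Finset.filter_insert]
    have h5 : ∀ j < i + 1, (u.setArr aKeep i (s.arrs aMark i + s.arrs aUsed i)).arrs aKeep j =
        s.arrs aMark j + s.arrs aUsed j := by
      intro j hj
      rw [State.arrs_setArr]
      by_cases hji : j = i
      · simp [hji]
      · simpa [hji] using h3 j (by omega)
    split_ifs with h0
    · exact ⟨h5, by simp [h4]⟩
    · exact ⟨h5, by simp [h4]⟩

/-- What the reduction achieves. -/
def Reduced (x : Word) (s : State) : Prop :=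
  (s.regs rX ≠ 0 ∧ 3 * kOf x < (graphOf x).support.ncard ∧
    ∀ T : Finset (Fin (nOf x)), (graphOf x).IsVertexCover (T : Set (Fin (nOf x))) →
      kOf x < T.card) ∨
  (s.regs rX = 0 ∧
    (((graphOf x).support.ncard ≤ 3 * kOf x ∧
      (graphOf x).support = {i : Fin (nOf x) | s.arrs aKeep i ≠ 0}) ∨
    (3 * kOf x < (graphOf x).support.ncard ∧
      ∃ (C H B : Finset (Fin (nOf x))) (m : Fin (nOf x) → Fin (nOf x)),
        IsHeavyCrownDecomposition (graphOf x) (graphOf x).support C H B m (kOf x) ∧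
        (graphOf x).support \ ((C \ H.image m : Finset (Fin (nOf x))) : Set (Fin (nOf x))) =
          {i : Fin (nOf x) | s.arrs aKeep i ≠ 0})))

/-- The sizes of both matchings are lower bounds for every vertex cover, so either of them exceeding
`k` refutes the instance. If neither does, the hypotheses `|A| ≤ 2k` and `|M| ≤ k` of
`AuctionInv.exists_crown` hold. -/
theorem sem_reduceProg {x : Word} {s : State} (h : Ctx0 x s) (hX : s.regs rX = 0)
    (h5 : ∀ v, s.arrs aMark v = 0) (h6 : ∀ v, s.arrs aMate v = 0) (h7 : ∀ v, s.arrs aUsed v = 0)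
    (h8 : ∀ v, s.arrs aLab v = 0) : Ctx x (reduceProg.sem s) ∧ Reduced x (reduceProg.sem s) := by
  set s1 := supportProg.sem (rowsProg.sem s) with hs1
  have c1 : Ctx x s1 := (sem_rowsProg h).sem rfl
  obtain ⟨hkeep, hC⟩ := sem_supportProg (sem_rowsProg h)
  rw [← hs1] at hkeep hC
  rw [← ncard_support_graphOf] at hC
  have fr : ∀ {r}, (Prog.seq rowsProg supportProg).writesReg r = false → s1.regs r = s.regs r :=
    fun hr => Prog.sem_regs_of_not_writes hr s
  have fa : ∀ {a}, (Prog.seq rowsProg supportProg).writesArr a = false → s1.arrs a = s.arrs a :=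
    fun hr => Prog.sem_arrs_of_not_writes hr s
  have etest : s1.regs rC - (s1.regs rK + (s1.regs rK + s1.regs rK)) =
      (graphOf x).support.ncard - 3 * kOf x := by rw [hC, c1.k]; omega
  by_cases hle : (graphOf x).support.ncard ≤ 3 * kOf x
  · have e : reduceProg.sem s = s1 := by
      simp only [reduceProg, Prog.sem, Exp.eval, ← hs1]
      rw [etest, if_neg (by omega)]
    rw [e]
    refine ⟨c1, .inr ⟨(fr rfl).trans hX, .inl ⟨hle, ?_⟩⟩⟩
    ext i
    rw [mem_support_graphOf, Set.mem_ofPred_eq, hkeep i i.2]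
    change Supp x i ↔ _
    split_ifs with hs <;> simp [hs]
  · set s2 := greedyProg.sem s1 with hs2
    set s3 := auctionProg.sem s2 with hs3
    set s4 := countProg.sem s3 with hs4
    have c2 : Ctx x s2 := c1.sem rfl
    have c3 : Ctx x s3 := c2.sem rfl
    have c4 : Ctx x s4 := c3.sem rfl
    have e : reduceProg.sem s = s4.setReg rX ((s4.regs rM - kOf x) + (s4.regs rU - kOf x)) := by
      simp only [reduceProg, Prog.sem, Exp.eval, ← hs1]
      rw [etest, if_pos (by omega)]
      simp only [← hs2, ← hs3, ← hs4, c4.k]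
    obtain ⟨hg, hmax⟩ := sem_greedyProg c1 (by rwa [fa rfl])
    rw [← hs2] at hg hmax
    have ga : ∀ {a}, (Prog.seq (.seq rowsProg supportProg) greedyProg).writesArr a = false →
        s2.arrs a = s.arrs a := fun hr => Prog.sem_arrs_of_not_writes hr s
    have hinv : AInv x s2 := by
      have e6 : ∀ v, s2.arrs aMate v = 0 := by rw [ga rfl]; exact h6
      have e7 : ∀ v, s2.arrs aUsed v = 0 := by rw [ga rfl]; exact h7
      have e8 : ∀ v, s2.arrs aLab v = 0 := by rw [ga rfl]; exact h8
      constructor <;> simp [e6, e7, e8]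
    obtain ⟨hinv3, hquiet⟩ := sem_auctionProg c2 hinv
    rw [← hs3] at hinv3 hquiet
    have em : s3.arrs aMark = s2.arrs aMark := Prog.sem_arrs_of_not_writes rfl s2
    rw [← em] at hg hmax
    obtain ⟨hk4, hu4⟩ := sem_countProg c3
    rw [← hs4] at hk4 hu4
    rw [← card_filter_fin] at hu4
    have eM : s4.regs rM = s2.regs rM :=
      Prog.sem_regs_of_not_writes (p := .seq auctionProg countProg) rfl s2
    have hfail : ∀ T : Finset (Fin (nOf x)), (graphOf x).IsVertexCover (T : Set (Fin (nOf x))) →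
        s4.regs rM ≤ T.card ∧ s4.regs rU ≤ T.card := fun T hT =>
      ⟨eM ▸ (hg.cover T hT).trans (Finset.card_filter_le _ _),
        hu4 ▸ AuctionInv.card_used_le hinv3 hmax hT⟩
    rw [e]
    refine ⟨c4.setReg _, ?_⟩
    by_cases hx : (s4.regs rM - kOf x) + (s4.regs rU - kOf x) = 0
    · refine .inr ⟨by simpa using hx, .inr ⟨by omega, ?_⟩⟩
      obtain ⟨C, H, B, m, hc, hd⟩ := AuctionInv.exists_crown (k := kOf x) hinv3
        (fun i hi hm => hg.supp i hi hm) hmax (fun c hc => hquiet c hc)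
        (by rw [hg.card]; omega) (by omega)
      refine ⟨C, H, B, m, hc, hd.trans ?_⟩
      ext i
      simp only [Set.mem_ofPred_eq, State.arrs_setReg, hk4 i i.2]
      omega
    · refine .inl ⟨by simpa using hx, by omega, fun T hT => ?_⟩
      obtain ⟨h1, h2⟩ := hfail T hT
      omega

/-! ### The output of the compression algorithm -/

/-- Output the reduced instance. -/
def printProg : Prog :=
  .ite (.reg rX)
    (.seq (.put (.lit 0)) (.seq (.put (.lit 1)) (.seq (.put (.lit 1)) (.seq (.put (.lit 0))
      (.seq (.put (.lit 0)) (.put (.lit 1)))))))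
    (.seq (.count rI rK (.put (.lit 1))) (.seq (.put (.lit 0))
      (.seq (.count rI rN (.ite (.cell aKeep (.reg rI)) (.put (.lit 1)) .skip))
        (.seq (.put (.lit 0))
          (.count rI rN (.ite (.cell aKeep (.reg rI))
            (.count rJ rN (.ite (.cell aKeep (.reg rJ))
              (.put (.cell aIn (.add (.cell aRow (.reg rI)) (.reg rJ)))) .skip)) .skip))))))

/-- The word that represents `k` and the graph with vertices `l` and adjacency matrix `b`. -/
def encode (k : ℕ) (l : List ℕ) (b : ℕ → ℕ → Bool) : Word :=
  List.replicate k true ++ false ::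
    (List.replicate l.length true ++ false :: l.flatMap fun i => l.map (b i))

/-! ### Decoding an encoded instance -/

theorem ones_replicate_append (k : ℕ) (w : Word) :
    ones (List.replicate k true ++ false :: w) = k := by
  unfold ones
  rw [List.idxOf_append_of_notMem (by simp)]
  simp

theorem drop_replicate_append (k : ℕ) (w : Word) :
    (List.replicate k true ++ false :: w).drop (k + 1) = w := by
  rw [← List.drop_drop]
  simp

theorem kOf_encode (k : ℕ) (l : List ℕ) (b : ℕ → ℕ → Bool) : kOf (encode k l b) = k :=
  ones_replicate_append _ _

theorem nOf_encode (k : ℕ) (l : List ℕ) (b : ℕ → ℕ → Bool) : nOf (encode k l b) = l.length := by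
  unfold nOf
  rw [kOf_encode, encode, drop_replicate_append, ones_replicate_append]

theorem getD_flatMap_map (l l' : List ℕ) (b : ℕ → ℕ → Bool) {i j : ℕ} (hi : i < l.length)
    (hj : j < l'.length) :
    (l.flatMap fun i => l'.map (b i)).getD (i * l'.length + j) false = b l[i] l'[j] := by
  induction l generalizing i with
  | nil => simp at hi
  | cons a l ih =>
    rw [List.flatMap_cons]
    cases i with
    | zero =>
      rw [Nat.zero_mul, Nat.zero_add, List.getD_append _ _ _ _ (by simpa using hj)]
      simp [List.getD, hj]
    | succ i =>
      rw [List.getD_append_right _ _ _ _ (by simp [Nat.succ_mul]; omega), List.length_map,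
        show (i + 1) * l'.length + j - l'.length = i * l'.length + j by rw [Nat.succ_mul]; omega]
      simpa using ih (by simpa using hi)

theorem bitOf_encode (k : ℕ) (l : List ℕ) (b : ℕ → ℕ → Bool) {i j : ℕ} (hi : i < l.length)
    (hj : j < l.length) : bitOf (encode k l b) i j = b l[i] l[j] := by
  have key : ∀ (w : Word) (m q : ℕ), w.getD (m + q) false = (w.drop m).getD q false := by
    intro w m q
    simp [List.getD]
  unfold bitOf
  rw [kOf_encode, nOf_encode, Nat.add_assoc, key, encode, drop_replicate_append, key,
    drop_replicate_append, getD_flatMap_map l l b hi hj]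

theorem length_encode (k : ℕ) (l : List ℕ) (b : ℕ → ℕ → Bool) :
    (encode k l b).length = k + l.length + 2 + l.length * l.length := by
  simp [encode, List.length_flatMap]
  omega

/-- The kept vertices, in increasing order. -/
def kept (x : Word) (s : State) : List ℕ :=
  (List.range (nOf x)).filter fun i => s.arrs aKeep i ≠ 0

theorem buf_printProg {x : Word} {s : State} (h : Ctx x s) (hb : s.buf = []) :
    (printProg.sem s).buf = if s.regs rX ≠ 0 then [false, true, true, false, false, true] else
      encode (kOf x) (kept x s) (bitOf x) := by
  by_cases hX : s.regs rX = 0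
  · rw [if_neg (by simpa using hX)]
    have e1 : ∀ u : State, Ctx x u → ((Prog.count rI rK (.put (.lit 1))).sem u).buf =
        u.buf ++ List.replicate (kOf x) true := by
      intro u hu
      have := Prog.sem_count_induct (i := rI) (l := rK) (p := .put (.lit 1))
        (Inv := fun i v => v.buf = u.buf ++ List.replicate i true) (s := u) rfl (by simp)
        fun i v _ _ hv => by simp [Prog.sem, Exp.eval, hv, List.replicate_succ']
      rwa [hu.k] at this
    have e2 : ∀ u : State, Ctx x u →
        ((Prog.count rI rN (.ite (.cell aKeep (.reg rI)) (.put (.lit 1)) .skip)).sem u).buf =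
        u.buf ++ List.replicate (kept x u).length true := by
      intro u hu
      have := Prog.sem_count_induct (i := rI) (l := rN)
        (p := .ite (.cell aKeep (.reg rI)) (.put (.lit 1)) .skip)
        (Inv := fun i v => v.arrs = u.arrs ∧ v.buf = u.buf ++ List.replicate
          ((List.range i).filter fun i => u.arrs aKeep i ≠ 0).length true) (s := u) rfl (by simp) ?_
      · rw [hu.n] at this
        exact this.2
      · rintro i v _ hi ⟨h1, h2⟩
        rw [List.range_succ, List.filter_append, List.length_append]
        by_cases h0 : u.arrs aKeep i = 0 <;>
          simp [Prog.sem, Exp.eval, hi, h1, h0, h2, List.replicate_succ']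
    have e3 : ∀ u : State, Ctx x u → u.regs rI < nOf x →
        ((Prog.count rJ rN (.ite (.cell aKeep (.reg rJ))
          (.put (.cell aIn (.add (.cell aRow (.reg rI)) (.reg rJ)))) .skip)).sem u).buf =
        u.buf ++ (kept x u).map (bitOf x (u.regs rI)) := by
      intro u hu hI
      have := Prog.sem_count_induct (i := rJ) (l := rN)
        (p := .ite (.cell aKeep (.reg rJ))
          (.put (.cell aIn (.add (.cell aRow (.reg rI)) (.reg rJ)))) .skip)
        (Inv := fun j v => v.regs rI = u.regs rI ∧ v.arrs = u.arrs ∧ v.buf = u.buf ++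
          ((List.range j).filter fun i => u.arrs aKeep i ≠ 0).map (bitOf x (u.regs rI)))
        (s := u) rfl (by simp) ?_
      · rw [hu.n] at this
        exact this.2.2
      · rintro j v _ hj ⟨h1, h2, h3⟩
        rw [List.range_succ, List.filter_append, List.map_append]
        by_cases h0 : u.arrs aKeep j = 0
        · simp [Prog.sem, Exp.eval, hj, h1, h2, h0, h3]
        · have := hu.bit (j := j) hI
          simp [Prog.sem, Exp.eval, hj, h1, h2, h0, h3, this]
    have e4 : ∀ u : State, Ctx x u →
        ((Prog.count rI rN (.ite (.cell aKeep (.reg rI))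
            (.count rJ rN (.ite (.cell aKeep (.reg rJ))
              (.put (.cell aIn (.add (.cell aRow (.reg rI)) (.reg rJ)))) .skip)) .skip)).sem u).buf =
        u.buf ++ (kept x u).flatMap fun i => (kept x u).map (bitOf x i) := by
      intro u hu
      have := Prog.sem_count_induct (i := rI) (l := rN)
        (p := .ite (.cell aKeep (.reg rI))
            (.count rJ rN (.ite (.cell aKeep (.reg rJ))
              (.put (.cell aIn (.add (.cell aRow (.reg rI)) (.reg rJ)))) .skip)) .skip)
        (Inv := fun i v => Ctx x v ∧ v.arrs = u.arrs ∧ v.buf = u.buf ++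
          ((List.range i).filter fun i => u.arrs aKeep i ≠ 0).flatMap
            fun i => (kept x u).map (bitOf x i))
        (s := u) rfl ⟨hu.setReg 0, by simp⟩ ?_
      · rw [hu.n] at this
        exact this.2.2
      · rintro i v hi hi' ⟨h1, h2, h3⟩
        rw [hu.n] at hi
        refine ⟨(h1.sem rfl).setReg _, ?_, ?_⟩
        · funext a
          rw [State.arrs_setReg, Prog.sem_arrs_of_not_writes rfl, h2]
        rw [List.range_succ, List.filter_append, List.flatMap_append, State.buf_setReg,
          Prog.sem]
        by_cases h0 : u.arrs aKeep i = 0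
        · simp [Prog.sem, Exp.eval, h2, hi', h0, h3]
        · have h4 : kept x v = kept x u := by unfold kept; rw [h2]
          rw [if_pos (by simpa [Exp.eval, h2, hi'] using h0), e3 v h1 (by omega), h3, hi', h4]
          simp [h0]
    set p1 : Prog := .count rI rK (.put (.lit 1)) with hp1
    set p2 : Prog := .count rI rN (.ite (.cell aKeep (.reg rI)) (.put (.lit 1)) .skip) with hp2
    have c1 : Ctx x ((p1.sem s).push false) := (h.sem (p := .seq p1 (.put (.lit 0))) rfl)
    have c2 : Ctx x ((p2.sem ((p1.sem s).push false)).push false) :=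
      (c1.sem (p := .seq p2 (.put (.lit 0))) rfl)
    have k1 : kept x ((p1.sem s).push false) = kept x s := by
      unfold kept
      rw [State.arrs_push, Prog.sem_arrs_of_not_writes rfl]
    have k2 : kept x ((p2.sem ((p1.sem s).push false)).push false) = kept x s := by
      rw [← k1]
      unfold kept
      rw [State.arrs_push, Prog.sem_arrs_of_not_writes (p := p2) rfl]
    simp only [printProg, ← hp1, ← hp2]
    rw [Prog.sem, if_neg (by simpa [Exp.eval] using hX)]
    change ((Prog.count rI rN (.ite (.cell aKeep (.reg rI))
            (.count rJ rN (.ite (.cell aKeep (.reg rJ))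
              (.put (.cell aIn (.add (.cell aRow (.reg rI)) (.reg rJ)))) .skip)) .skip)).sem
            ((p2.sem ((p1.sem s).push false)).push false)).buf = _
    rw [e4 _ c2, k2, State.buf_push, e2 _ c1, k1, State.buf_push, e1 _ h, hb, encode]
    simp
  · simp [printProg, Prog.sem, Exp.eval, hX, hb]

end EnumVC

namespace EnumVC

/-! ### The compression algorithm -/

theorem kOf_le_length (x : Word) : kOf x ≤ x.length := List.idxOf_le_length

theorem nOf_le_length (x : Word) : nOf x ≤ x.length :=
  List.idxOf_le_length.trans (by simp)

/-- The state after the reduction has been computed for `x`. -/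
def redState (x : Word) : State := reduceProg.sem (setupProg.sem (State.init [x] []))

/-- The registers that hold the same values in both algorithms. -/
def commonReg (r : ℕ) : Bool := r == 0 || Nat.ble 5 r

/-- The arrays that hold the same values in both algorithms. -/
def commonArr (a : ℕ) : Bool := a == 0 || Nat.ble 3 a

/-- Inputs occupy at most the registers 0 to 4 and the arrays 0 to 2, and the input word comes first
in both algorithms. The work space beyond is zero, so the additional inputs are invisible to the
reduction. -/
theorem init_agree (x : Word) (ws : List Word) (ns : List ℕ) (h1 : ws.length ≤ 2)
    (h2 : ws.length + ns.length ≤ 4) :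
    (State.init (x :: ws) ns).Agree commonReg commonArr (State.init [x] []) where
  regs r hr := by
    simp only [commonReg, Bool.or_eq_true, beq_iff_eq, Nat.ble_eq] at hr
    rcases hr with rfl | hr
    · simp [State.init]
    · simp only [State.init]
      rw [List.getD_eq_default _ _ (by simp; omega), List.getD_eq_default _ _ (by simp; omega)]
  arrs a ha := by
    simp only [commonArr, Bool.or_eq_true, beq_iff_eq, Nat.ble_eq] at ha
    funext i
    rcases ha with rfl | ha
    · simp [State.init]
    · simp only [State.init]
      rw [List.getD_eq_default (x :: ws) _ (by simp; omega),
        List.getD_eq_default [x] _ (by simp; omega)]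

theorem ctx_of_agree {x : Word} {s : State}
    (h : s.Agree commonReg commonArr (State.init [x] [])) :
    Ctx0 x (setupProg.sem s) ∧ Ctx x (reduceProg.sem (setupProg.sem s)) ∧
      Reduced x (reduceProg.sem (setupProg.sem s)) := by
  have hr : ∀ r, 5 ≤ r → s.regs r = 0 := fun r hr => by
    rw [h.regs r (by simp [commonReg, hr])]
    exact List.getD_eq_default _ _ (by simp; omega)
  have ha : ∀ a, 3 ≤ a → ∀ v, s.arrs a v = 0 := fun a ha v => by
    rw [h.arrs a (by simp [commonArr, ha])]
    simp only [State.init]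
    rw [List.getD_eq_default [x] _ (by simp; omega)]
    simp
  have hc : Ctx0 x (setupProg.sem s) := by
    refine sem_setupProg (hr _ (by simp)) (hr _ (by simp)) (hr _ (by simp)) ?_ fun i => ?_
    · rw [h.regs 0 (by simp [commonReg])]
      simp [State.init]
    · rw [h.arrs 0 (by simp [commonArr])]
      simp [State.init]
  have ha' : ∀ a, 3 ≤ a → setupProg.writesArr a = false → ∀ v, (setupProg.sem s).arrs a v = 0 :=
    fun a h3 hw v => by rw [Prog.sem_arrs_of_not_writes hw]; exact ha a h3 v
  refine ⟨hc, sem_reduceProg hc ?_ (ha' _ (by simp) rfl) (ha' _ (by simp) rfl)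
    (ha' _ (by simp) rfl) (ha' _ (by simp) rfl)⟩
  rw [Prog.sem_regs_of_not_writes rfl]
  exact hr _ (by simp)

theorem init_agree_self (x : Word) :
    (State.init [x] []).Agree commonReg commonArr (State.init [x] []) := ⟨fun _ _ => rfl, fun _ _ => rfl⟩

theorem reduced_redState (x : Word) : Reduced x (redState x) :=
  (ctx_of_agree (init_agree_self x)).2.2

/-- The lifting algorithm is not told which vertices were kept. It runs the same reduction from an
indistinguishable state and thus recovers them in the same order. -/
theorem agree_redState {x : Word} {s : State}
    (h : s.Agree commonReg commonArr (State.init [x] [])) :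
    (reduceProg.sem (setupProg.sem s)).Agree commonReg commonArr (redState x) :=
  Prog.agree_sem (p := .seq setupProg reduceProg) (by decide) h

attribute [irreducible] redState

/-- The word for `(K₂, 0)`. -/
def failWord : Word := [false, true, true, false, false, true]

/-- The kept vertices of the instance `x`, in increasing order. -/
def keptList (x : Word) : List ℕ := kept x (redState x)

/-- The compressed instance. -/
def compress (x : Word) : Word :=
  if (redState x).regs rX ≠ 0 then failWord else encode (kOf x) (keptList x) (bitOf x)

/-- The compression algorithm. -/
def compressCmd : Cmd :=
  .seq setupProg.compile (.seq (Prog.seq reduceProg printProg).compile .emit)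

/-- The running time of the compression algorithm. -/
noncomputable def compressTime : Polynomial ℕ :=
  setupProg.bound + ((Prog.seq reduceProg printProg).bound.comp (Polynomial.X + 1) + 1)

theorem outputs_append (t t' : Trace) : Trace.outputs (t ++ t') = t.outputs ++ t'.outputs :=
  List.reduceOption_append t t'

theorem outputs_replicate (m : ℕ) : Trace.outputs (List.replicate m none) = [] := by
  simp [Trace.outputs]

theorem time_append (t t' : Trace) : Trace.time (t ++ t') = t.time + t'.time :=
  List.count_append

theorem time_replicate (m : ℕ) : Trace.time (List.replicate m none) = m := by
  simp [Trace.time]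

theorem compressCmd_run (x : Word) (k : ℕ) :
    ∃ t s, Exec compressCmd (State.init [x] [k]) t s ∧ Trace.outputs t = [compress x] ∧
      Trace.time t ≤ compressTime.eval (x.length + k) := by
  have hag := init_agree x [] [k] (by simp) (by simp)
  obtain ⟨c0, c1, -⟩ := ctx_of_agree hag
  -- Parsing is limited by the word length alone. Its results `k`, `n`, `n + 1` can be loop limits
  -- only afterwards, since limits must not be written; they are at most `|x| + 1`, which explains
  -- the composition with `X + 1`.
  obtain ⟨m, hm, e⟩ := Prog.exec_compile (L := [0]) (p := setupProg) (by decide)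
    (N := x.length + k) (s := State.init [x] [k]) (by simp [State.init])
  obtain ⟨m', hm', e'⟩ := Prog.exec_compile (L := [rK, rN, rN1])
    (p := .seq reduceProg printProg) (by decide)
    (N := x.length + k + 1) (s := setupProg.sem (State.init [x] [k])) (by
      have := kOf_le_length x
      have := nOf_le_length x
      simp only [List.mem_cons, List.not_mem_nil, or_false, forall_eq_or_imp, forall_eq]
      rw [c0.k, c0.n, c0.n1]
      omega)
  refine ⟨_, _, .seq e (.seq e' (.emit _)), ?_, ?_⟩
  · have hbuf : (reduceProg.sem (setupProg.sem (State.init [x] [k]))).buf = [] :=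
      Prog.sem_buf_of_not_writes (p := .seq setupProg reduceProg) rfl _
    have hr := agree_redState hag
    have hk : kept x (reduceProg.sem (setupProg.sem (State.init [x] [k]))) = keptList x := by
      unfold keptList kept
      rw [hr.arrs aKeep rfl]
    rw [outputs_append, outputs_append, outputs_replicate, outputs_replicate, Prog.sem,
      buf_printProg c1 hbuf, hr.regs rX rfl, hk]
    simp [Trace.outputs, List.reduceOption, compress, failWord]
  · rw [time_append, time_append, time_replicate, time_replicate]
    have : Trace.time [none, some ((Prog.seq reduceProg printProg).sem
      (setupProg.sem (State.init [x] [k]))).buf] = 1 := by simp [Trace.time]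
    rw [this]
    simp only [compressTime, Polynomial.eval_add, Polynomial.eval_comp, Polynomial.eval_X,
      Polynomial.eval_one]
    omega

/-! ### The compressed instance -/

theorem decode_k (w : Word) : (decode w).k = kOf w := rfl

theorem decode_n (w : Word) : (decode w).n = nOf w := rfl

theorem charVec_injective {n : ℕ} : Function.Injective (charVec (n := n)) := by
  intro S T h
  ext i
  have h1 := charVec_getD S i
  rw [h, charVec_getD] at h1
  simpa using h1.symm

theorem charVec_mem_sol {w : Word} {S : Finset (Fin (nOf w))} :
    charVec S ∈ sol w ↔ (graphOf w).IsVertexCover (S : Set (Fin (nOf w))) ∧ S.card ≤ kOf w := by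
  classical
  unfold sol
  rw [Finset.mem_image]
  constructor
  · rintro ⟨T, hT, e⟩
    obtain rfl := charVec_injective e
    exact (Finset.mem_filter.1 hT).2
  · exact fun h => ⟨S, Finset.mem_filter.2 ⟨Finset.mem_univ _, h⟩, rfl⟩

theorem exists_of_mem_sol {w v : Word} (h : v ∈ sol w) :
    ∃ S : Finset (Fin (nOf w)), charVec S = v :=
  exists_charVec v ((mem_sol w v).1 h).1

theorem sol_failWord : sol failWord = ∅ := by
  refine Finset.eq_empty_of_forall_notMem fun v hv => ?_
  obtain ⟨-, h1, h2⟩ := (mem_sol _ _).1 hv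
  have h3 : v.count true = 0 := Nat.le_zero.1 h1
  have h4 : ∀ i, v.getD i false ≠ true := fun i hi => by
    rw [List.count_eq_zero] at h3
    by_cases hlt : i < v.length
    · rw [List.getD_eq_getElem _ _ hlt] at hi
      exact h3 (hi ▸ List.getElem_mem hlt)
    · rw [List.getD_eq_default _ _ (by omega)] at hi
      simp at hi
  have := h2 0 (by decide) 1 (by decide)
  simp only [h4] at this
  revert this
  decide

theorem failWord_graph : (decode failWord).graph = ⊤ := by
  ext i j
  rw [SimpleGraph.top_adj]
  refine ⟨fun h => h.1, fun h => ⟨h, ?_⟩⟩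
  have key : ∀ a < 2, ∀ b < 2, a ≠ b →
      bitOf failWord a b = true ∨ bitOf failWord b a = true := by decide
  exact key i i.2 j j.2 fun e => h (Fin.ext e)

theorem exists_embedding {x y : Word} {l : List ℕ} (hlen : nOf y = l.length)
    (hl : ∀ i ∈ l, i < nOf x) (hnd : l.Nodup)
    (hb : ∀ i j, (hi : i < l.length) → (hj : j < l.length) → bitOf y i j = bitOf x l[i] l[j]) :
    ∃ φ : graphOf y ↪g graphOf x, ∀ i, ((φ i : Fin (nOf x)) : ℕ) = l.getD i 0 := by
  have hlt : ∀ i : Fin (nOf y), (i : ℕ) < l.length := fun i => hlen ▸ i.2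
  have hinj : ∀ i j : Fin (nOf y), l[i]'(hlt i) = l[j]'(hlt j) → i = j := fun i j e =>
    Fin.ext ((hnd.getElem_inj_iff).1 e)
  refine ⟨⟨⟨fun i => ⟨l[i]'(hlt i), hl _ (List.getElem_mem _)⟩, fun i j e => hinj i j ?_⟩, ?_⟩, ?_⟩
  · simpa using e
  · intro i j
    rw [graphOf_adj, graphOf_adj]
    simp only [AdjN]
    have h1 := hb i j (hlt i) (hlt j)
    have h2 := hb j i (hlt j) (hlt i)
    have h3 : (l[i]'(hlt i) ≠ l[j]'(hlt j)) ↔ (i : ℕ) ≠ j :=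
      not_congr ⟨fun e => congrArg _ (hinj i j e), fun e => by
        have : i = j := Fin.ext e
        rw [this]⟩
    rw [h1, h2]
    exact and_congr h3 Iff.rfl
  · intro i
    rw [List.getD_eq_getElem _ _ (hlt i)]
    rfl

theorem mem_kept {x : Word} {s : State} {i : ℕ} :
    i ∈ kept x s ↔ i < nOf x ∧ s.arrs aKeep i ≠ 0 := by
  simp [kept]

theorem nodup_kept (x : Word) (s : State) : (kept x s).Nodup := List.nodup_range.filter _

/-- All later statements about the compressed instance rest on this dichotomy. Recording `φ` as the
indexing of `keptList` links the abstract embedding to the order in which the lifting program meets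
the kept vertices. -/
theorem compress_cases (x : Word) :
    (3 * kOf x < (graphOf x).support.ncard ∧ sol x = ∅ ∧ compress x = failWord) ∨
    (nOf (compress x) = (keptList x).length ∧
      ∃ φ : (decode (compress x)).graph ↪g (decode x).graph,
      IsCrownReduction (decode x) (decode (compress x)) φ ∧
      ∀ i, ((φ i : Fin (nOf x)) : ℕ) = (keptList x).getD i 0) := by
  rcases reduced_redState x with ⟨hX, h1, h2⟩ | ⟨hX, h⟩
  · left
    refine ⟨h1, Finset.eq_empty_of_forall_notMem fun v hv => ?_, by rw [compress, if_pos hX]⟩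
    obtain ⟨S, rfl⟩ := exists_of_mem_sol hv
    obtain ⟨h3, h4⟩ := charVec_mem_sol.1 hv
    exact absurd h4 (by simpa using h2 S h3)
  · right
    have hc : compress x = encode (kOf x) (keptList x) (bitOf x) := by
      rw [compress, if_neg (by simpa using hX)]
    have hn : nOf (compress x) = (keptList x).length := by rw [hc, nOf_encode]
    obtain ⟨φ, hφ⟩ := exists_embedding (x := x) (y := compress x) (l := keptList x) hn
      (fun i hi => (mem_kept.1 hi).1) (nodup_kept _ _)
      (fun i j hi hj => by rw [hc, bitOf_encode _ _ _ hi hj])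
    have hrange : Set.range φ = {i : Fin (nOf x) | (redState x).arrs aKeep i ≠ 0} := by
      ext i
      rw [Set.mem_ofPred_eq]
      constructor
      · rintro ⟨j, rfl⟩
        rw [hφ, List.getD_eq_getElem _ _ (hn ▸ j.2)]
        exact (mem_kept.1 (List.getElem_mem _)).2
      · intro hi
        obtain ⟨j, hj, e⟩ := List.getElem_of_mem (show (i : ℕ) ∈ keptList x from mem_kept.2 ⟨i.2, hi⟩)
        refine ⟨⟨j, hn ▸ hj⟩, Fin.ext ?_⟩
        rw [hφ, List.getD_eq_getElem _ _ hj]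
        exact e
    refine ⟨hn, φ, ⟨?_, ?_⟩, hφ⟩
    · rw [decode_k, decode_k, hc, kOf_encode]
    · rcases h with ⟨h1, h2⟩ | ⟨h1, C, H, B, m, h2, h3⟩
      · exact .inl ⟨h1, hrange.trans h2.symm⟩
      · exact .inr ⟨h1, C, H, B, m, h2, hrange.trans h3.symm⟩

/-! ### Size and solvability of the compressed instance -/

/-- The size of the kernel. -/
def kernelSize (k : ℕ) : ℕ := k + (3 * k + 2) + 2 + (3 * k + 2) * (3 * k + 2)

theorem computable_kernelSize : Computable kernelSize := by
  have h : Primrec fun k : ℕ => 3 * k + 2 :=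
    Primrec.nat_add.comp (Primrec.nat_mul.comp (.const 3) .id) (.const 2)
  exact (Primrec.nat_add.comp (Primrec.nat_add.comp (Primrec.nat_add.comp .id h) (.const 2))
    (Primrec.nat_mul.comp h h)).to_comp

theorem kOf_compress_le (x : Word) : kOf (compress x) ≤ kOf x := by
  rcases compress_cases x with ⟨-, -, h⟩ | ⟨-, φ, h, -⟩
  · rw [h]
    exact Nat.zero_le _
  · exact (h.k_eq : kOf (compress x) = kOf x).le

theorem length_compress_le (x : Word) : (compress x).length ≤ kernelSize (kOf x) := by
  rcases compress_cases x with ⟨-, -, h⟩ | ⟨hn, φ, h, -⟩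
  · rw [h]
    -- The two additional vertices in `kernelSize` make room for `failWord` even when `k = 0`.
    simp only [failWord, kernelSize, List.length_cons, List.length_nil]
    nlinarith [Nat.zero_le (kOf x)]
  · have h1 : (keptList x).length ≤ 3 * kOf x := hn ▸ h.card_le
    unfold compress
    split_ifs
    · simp only [failWord, kernelSize, List.length_cons, List.length_nil]
      nlinarith [Nat.zero_le (kOf x)]
    · rw [length_encode, kernelSize]
      have := Nat.mul_le_mul (h1.trans (Nat.le_add_right _ 2)) (h1.trans (Nat.le_add_right _ 2))
      omega

/-- Restriction gives one direction. The other needs the crown exchange, because the lift of an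
individual `Y` may be empty. -/
theorem sol_compress_nonempty_iff (x : Word) :
    (sol (compress x)).Nonempty ↔ (sol x).Nonempty := by
  rcases compress_cases x with ⟨-, h1, h2⟩ | ⟨-, φ, h, -⟩
  · simp [h1, h2, sol_failWord]
  · constructor
    · rintro ⟨v, hv⟩
      obtain ⟨Y, rfl⟩ := exists_of_mem_sol hv
      obtain ⟨h3, h4⟩ := charVec_mem_sol.1 hv
      obtain ⟨S, hS⟩ := h.exists_cover h3 h4
      exact ⟨charVec S, charVec_mem_sol.2 hS⟩
    · rintro ⟨v, hv⟩
      obtain ⟨S, rfl⟩ := exists_of_mem_sol hv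
      obtain ⟨h3, h4⟩ := charVec_mem_sol.1 hv
      have h5 : kOf (compress x) = kOf x := h.k_eq
      refine ⟨_, charVec_mem_sol.2
        ⟨isVertexCover_preimage (I := decode x) (J := decode (compress x)) (φ := φ) (S := S) h3, ?_⟩⟩
      rw [h5]
      exact (card_preimage_le (I := decode x) (J := decode (compress x)) (φ := φ) S).trans h4

end EnumVC

namespace EnumVC

/-! ### Enumeration of small sets in colexicographic order -/

section Colex

open Finset.Colex

/-- The subset of `T` that is left when the free elements below `p` have been removed. -/
def keepFrom (Fr T : Finset ℕ) (p : ℕ) : Finset ℕ := T.filter fun l => l ∉ Fr ∨ p ≤ l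

theorem mem_keepFrom {Fr T : Finset ℕ} {p l : ℕ} :
    l ∈ keepFrom Fr T p ↔ l ∈ T ∧ (l ∉ Fr ∨ p ≤ l) := Finset.mem_filter

/-- The sets below `n` of size at most `k` that agree with `S` outside the free elements `Fr`. -/
structure Valid (n k : ℕ) (Fr S U : Finset ℕ) : Prop where
  subset : U ⊆ Finset.range n
  card_le : U.card ≤ k
  agree : ∀ i < n, i ∉ Fr → (i ∈ U ↔ i ∈ S)

variable {n k : ℕ} {Fr S T U : Finset ℕ} {p : ℕ}

/-- Here `q` is the largest element in which `T` and `U` differ. It is free, and `U` contains `q`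
and all of `keepFrom Fr T q`; so the latter has fewer than `k` elements, and `q` is not one of the
skipped positions. -/
theorem Valid.le_of_skip (hT : Valid n k Fr S T) (hU : Valid n k Fr S U)
    (hskip : ∀ j < p, j ∈ Fr → j ∉ T → k ≤ (keepFrom Fr T j).card) {q : ℕ} (hqU : q ∈ U)
    (hqT : q ∉ T) (hq : ∀ b ∈ T, b ∉ U → b < q) : p ≤ q := by
  by_contra! hlt
  have hn : ∀ i ∈ U, i < n := fun i hi => by simpa using hU.subset hi
  have hn' : ∀ i ∈ T, i < n := fun i hi => by simpa using hT.subset hi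
  have hF : q ∈ Fr := by
    by_contra h
    exact hqT ((hT.agree q (hn q hqU) h).2 ((hU.agree q (hn q hqU) h).1 hqU))
  have hsub : insert q (keepFrom Fr T q) ⊆ U := by
    intro l hl
    rcases Finset.mem_insert.1 hl with rfl | hl
    · exact hqU
    obtain ⟨h1, h2⟩ := mem_keepFrom.1 hl
    by_contra h3
    have h4 := hq l h1 h3
    have h5 := h2.resolve_right (by omega)
    exact h3 ((hU.agree l (hn' l h1) h5).2 ((hT.agree l (hn' l h1) h5).1 h1))
  have h1 := Finset.card_le_card hsub
  rw [Finset.card_insert_of_notMem fun h => hqT (mem_keepFrom.1 h).1] at h1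
  have h2 := hskip q hlt hF hqT
  have h3 := hU.card_le
  omega

theorem Valid.not_lt_of_skip (hT : Valid n k Fr S T) (hU : Valid n k Fr S U)
    (hskip : ∀ j < n, j ∈ Fr → j ∉ T → k ≤ (keepFrom Fr T j).card) :
    ¬ toColex T < toColex U := by
  intro hlt
  obtain ⟨q, hqU, hqT, hq⟩ := toColex_lt_toColex_iff_exists_forall_lt.1 hlt
  have h1 := hT.le_of_skip hU hskip hqU hqT hq
  have h2 : q < n := by simpa using hU.subset hqU
  omega

theorem Valid.succ (hT : Valid n k Fr S T) (hp : p < n) (hpF : p ∈ Fr)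
    (hlt : (keepFrom Fr T p).card < k) : Valid n k Fr S (insert p (keepFrom Fr T p)) where
  subset := by
    intro l hl
    rcases Finset.mem_insert.1 hl with rfl | hl
    · simpa using hp
    · exact hT.subset (mem_keepFrom.1 hl).1
  card_le := (Finset.card_insert_le _ _).trans hlt
  agree i hi hiF := by
    rw [← hT.agree i hi hiF, Finset.mem_insert, mem_keepFrom]
    constructor
    · rintro (rfl | h)
      · exact absurd hpF hiF
      · exact h.1
    · exact fun h => .inr ⟨h, .inl hiF⟩

theorem lt_succ (hpT : p ∉ T) : toColex T < toColex (insert p (keepFrom Fr T p)) := by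
  refine toColex_lt_toColex_iff_exists_forall_lt.2 ⟨p, Finset.mem_insert_self _ _, hpT, ?_⟩
  intro b hb hb'
  by_contra! h
  exact hb' (Finset.mem_insert_of_mem (mem_keepFrom.2 ⟨hb, .inr h⟩))

/-- Let `q` be the largest difference of `T` and `U`. If `q > p`, it also decides in favor of `U`
against the successor. If `q = p`, then `U` contains the whole successor: above `p` it misses
nothing of `T`, and below `p` only non-free elements remain. -/
theorem Valid.succ_le (hT : Valid n k Fr S T) (hU : Valid n k Fr S U) (hpT : p ∉ T)
    (hskip : ∀ j < p, j ∈ Fr → j ∉ T → k ≤ (keepFrom Fr T j).card)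
    (hlt : toColex T < toColex U) : toColex (insert p (keepFrom Fr T p)) ≤ toColex U := by
  obtain ⟨q, hqU, hqT, hq⟩ := toColex_lt_toColex_iff_exists_forall_lt.1 hlt
  have hpq := hT.le_of_skip hU hskip hqU hqT hq
  refine toColex_le_toColex.2 fun a ha haU => ?_
  rcases Nat.lt_or_eq_of_le hpq with h | rfl
  · refine ⟨q, hqU, ?_, ?_⟩
    · rw [Finset.mem_insert, mem_keepFrom]
      rintro (rfl | h')
      · omega
      · exact hqT h'.1
    · rcases Finset.mem_insert.1 ha with rfl | h'
      · exact hpq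
      · exact (hq a (mem_keepFrom.1 h').1 haU).le
  · rcases Finset.mem_insert.1 ha with rfl | h'
    · exact absurd hqU haU
    · obtain ⟨h1, h2⟩ := mem_keepFrom.1 h'
      have h3 := hq a h1 haU
      have h4 := h2.resolve_right (by omega)
      have h5 : a < n := by simpa using hT.subset h1
      exact absurd ((hU.agree a h5 h4).2 ((hT.agree a h5 h4).1 h1)) haU

end Colex

/-! ### The successor and output programs -/

/-- Replace the set in array `aSet`, of size `rW`, by its successor; `rG` tells whether there is
one. -/
def nextProg : Prog :=
  .seq (.assign rG (.lit 0)) (.count rI rN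
    (.ite (.reg rG) .skip (.ite (.cell aFree (.reg rI))
      (.ite (.cell aSet (.reg rI))
        (.seq (.store aSet (.reg rI) (.lit 0)) (.assign rW (.sub (.reg rW) (.lit 1))))
        (.ite (.sub (.reg rK) (.reg rW))
          (.seq (.store aSet (.reg rI) (.lit 1))
            (.seq (.assign rW (.add (.reg rW) (.lit 1))) (.assign rG (.lit 1))))
          .skip)) .skip)))

/-- The array `aSet` represents the set `T`. -/
structure Represents (x : Word) (Fr T : Finset ℕ) (s : State) : Prop where
  ctx : Ctx x s
  free : ∀ i < nOf x, s.arrs aFree i ≠ 0 ↔ i ∈ Fr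
  set : ∀ i < nOf x, s.arrs aSet i ≠ 0 ↔ i ∈ T
  card : s.regs rW = T.card

theorem Represents.setReg {x : Word} {Fr T : Finset ℕ} {s : State} (h : Represents x Fr T s)
    {r : ℕ} (v : ℕ) (hr : r ≠ rK ∧ r ≠ rN ∧ r ≠ rN1 ∧ r ≠ rW := by decide) :
    Represents x Fr T (s.setReg r v) :=
  ⟨h.ctx.setReg v ⟨hr.1, hr.2.1, hr.2.2.1⟩, h.free, h.set, by
    rw [State.regs_setReg, if_neg hr.2.2.2.symm, h.card]⟩

theorem Represents.setArr {x : Word} {Fr T T' : Finset ℕ} {s : State} (h : Represents x Fr T s)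
    {i v : ℕ} (hi : ∀ j, j ∈ T' ↔ if j = i then v ≠ 0 else j ∈ T) :
    Represents x Fr T' ((s.setArr aSet i v).setReg rW T'.card) where
  ctx := h.ctx.congr (by simp) (by simp) (by simp) (by funext; simp) (by funext; simp)
  free j hj := by simpa using h.free j hj
  set j hj := by
    rw [hi]
    by_cases e : j = i <;> simp [e]
    have := h.set j hj
    simpa using this
  card := by simp

theorem keepFrom_succ_of_mem {Fr T : Finset ℕ} {i : ℕ} (hi : i ∈ Fr) :
    keepFrom Fr T (i + 1) = (keepFrom Fr T i).erase i := by
  ext l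
  rw [Finset.mem_erase, mem_keepFrom, mem_keepFrom]
  constructor
  · rintro ⟨h1, h2⟩
    refine ⟨?_, h1, h2.imp_right fun h => by omega⟩
    rintro rfl
    rcases h2 with h2 | h2
    · exact h2 hi
    · omega
  · rintro ⟨h0, h1, h2⟩
    exact ⟨h1, h2.imp_right fun h => by omega⟩

theorem keepFrom_succ_of_notMem {Fr T : Finset ℕ} {i : ℕ} (hi : i ∉ Fr ∨ i ∉ T) :
    keepFrom Fr T (i + 1) = keepFrom Fr T i := by
  ext l
  rw [mem_keepFrom, mem_keepFrom]
  refine and_congr_right fun hl => ⟨Or.imp_right fun h => by omega, ?_⟩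
  rintro (h | h)
  · exact .inl h
  · rcases Nat.lt_or_eq_of_le h with h | rfl
    · exact .inr h
    · exact .inl (hi.resolve_right fun h' => h' hl)

/-- During the upward scan the array holds `keepFrom Fr T i` and `rW` its size, so a single
comparison with `k` decides whether position `i` can be filled. If no position can, the set has been
destroyed, which is harmless at the end of the enumeration. -/
theorem sem_nextProg {x : Word} {Fr T : Finset ℕ} {s : State} (h : Represents x Fr T s) :
    ((nextProg.sem s).regs rG = 0 ∧
      ∀ j < nOf x, j ∈ Fr → j ∉ T → kOf x ≤ (keepFrom Fr T j).card) ∨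
    ((nextProg.sem s).regs rG = 1 ∧ ∃ p < nOf x, p ∈ Fr ∧ p ∉ T ∧
      (keepFrom Fr T p).card < kOf x ∧
      (∀ j < p, j ∈ Fr → j ∉ T → kOf x ≤ (keepFrom Fr T j).card) ∧
      Represents x Fr (insert p (keepFrom Fr T p)) (nextProg.sem s)) := by
  have key := Prog.sem_count_induct (i := rI) (l := rN)
    (p := .ite (.reg rG) .skip (.ite (.cell aFree (.reg rI))
      (.ite (.cell aSet (.reg rI))
        (.seq (.store aSet (.reg rI) (.lit 0)) (.assign rW (.sub (.reg rW) (.lit 1))))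
        (.ite (.sub (.reg rK) (.reg rW))
          (.seq (.store aSet (.reg rI) (.lit 1))
            (.seq (.assign rW (.add (.reg rW) (.lit 1))) (.assign rG (.lit 1))))
          .skip)) .skip))
    (Inv := fun i u => (u.regs rG = 0 ∧ Represents x Fr (keepFrom Fr T i) u ∧
        ∀ j < i, j ∈ Fr → j ∉ T → kOf x ≤ (keepFrom Fr T j).card) ∨
      (u.regs rG = 1 ∧ ∃ p < i, p ∈ Fr ∧ p ∉ T ∧
      (keepFrom Fr T p).card < kOf x ∧
      (∀ j < p, j ∈ Fr → j ∉ T → kOf x ≤ (keepFrom Fr T j).card) ∧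
      Represents x Fr (insert p (keepFrom Fr T p)) u))
    (s := s.setReg rG 0) rfl ?_ ?_
  · rw [(h.setReg (r := rG) 0).ctx.n] at key
    rcases key with ⟨h1, h2, h3⟩ | key
    · exact .inl ⟨h1, h3⟩
    · exact .inr key
  · left
    have : keepFrom Fr T 0 = T := by ext l; simp [mem_keepFrom]
    rw [this]
    exact ⟨by simp, (h.setReg 0).setReg 0, by simp⟩
  · rintro i u hi hi' (⟨h1, h2, h3⟩ | ⟨h1, p, hp, h2⟩)
    · rw [(h.setReg (r := rG) 0).ctx.n] at hi
      have hnew : (∀ j < i, j ∈ Fr → j ∉ T → kOf x ≤ (keepFrom Fr T j).card) →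
          (i ∈ Fr → i ∉ T → kOf x ≤ (keepFrom Fr T i).card) →
          ∀ j < i + 1, j ∈ Fr → j ∉ T → kOf x ≤ (keepFrom Fr T j).card := by
        intro a1 a2 j hj
        rcases Nat.lt_succ_iff_lt_or_eq.1 hj with h | rfl
        · exact a1 j h
        · exact a2
      have hmem : i ∈ keepFrom Fr T i ↔ i ∈ T := by simp [mem_keepFrom]
      by_cases hf : i ∈ Fr
      · have ef : u.arrs aFree i ≠ 0 := (h2.free i hi).2 hf
        by_cases ht : i ∈ T
        · have et : u.arrs aSet i ≠ 0 := (h2.set i hi).2 (hmem.2 ht)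
          left
          simp only [Prog.sem, Exp.eval, h1, hi', ef, et, ne_eq, not_true_eq_false,
            not_false_eq_true, if_true, if_false, State.regs_setArr]
          refine ⟨by simp [h1], ?_, hnew h3 fun _ h => absurd ht h⟩
          have hc : u.regs rW - 1 = (keepFrom Fr T (i + 1)).card := by
            rw [keepFrom_succ_of_mem hf, Finset.card_erase_of_mem (hmem.2 ht), h2.card]
          rw [hc]
          refine (h2.setArr fun j => ?_).setReg _
          rw [keepFrom_succ_of_mem hf, Finset.mem_erase]
          by_cases e : j = i <;> simp [e]
        · have et : u.arrs aSet i = 0 := by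
            by_contra h
            exact ht (hmem.1 ((h2.set i hi).1 h))
          by_cases hk : kOf x ≤ (keepFrom Fr T i).card
          · have ek : u.regs rK - u.regs rW = 0 := by rw [h2.ctx.k, h2.card]; omega
            left
            simp only [Prog.sem, Exp.eval, h1, hi', ef, et, ek, ne_eq, not_true_eq_false,
              not_false_eq_true, if_true, if_false]
            refine ⟨by simp [h1], ?_, hnew h3 fun _ _ => hk⟩
            rw [keepFrom_succ_of_notMem (.inr ht)]
            exact h2.setReg _
          · have ek : u.regs rK - u.regs rW ≠ 0 := by rw [h2.ctx.k, h2.card]; omega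
            right
            simp only [Prog.sem, Exp.eval, h1, hi', ef, et, ek, ne_eq, not_true_eq_false,
              not_false_eq_true, if_true, if_false, State.regs_setArr]
            refine ⟨by simp, i, by omega, hf, ht, by omega, h3, ?_⟩
            have hc : u.regs rW + 1 = (insert i (keepFrom Fr T i)).card := by
              rw [Finset.card_insert_of_notMem fun h => ht (hmem.1 h), h2.card]
            rw [hc]
            refine ((h2.setArr fun j => ?_).setReg _).setReg _
            rw [Finset.mem_insert]
            by_cases e : j = i <;> simp [e]
      · have ef : u.arrs aFree i = 0 := by
          by_contra h
          exact hf ((h2.free i hi).1 h)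
        left
        simp only [Prog.sem, Exp.eval, h1, hi', ef, ne_eq, not_true_eq_false, if_false]
        refine ⟨by simp [h1], ?_, hnew h3 fun h => absurd h hf⟩
        rw [keepFrom_succ_of_notMem (.inl hf)]
        exact h2.setReg _
    · right
      simp only [Prog.sem, Exp.eval, h1, ne_eq, one_ne_zero, not_false_eq_true, if_true]
      obtain ⟨a1, a2, a3, a4, a5⟩ := h2
      exact ⟨by simp [h1], p, by omega, a1, a2, a3, a4, a5.setReg _⟩

/-- Output the set in array `aSet`. -/
def outProg : Prog := .count rI rN (.put (.cell aSet (.reg rI)))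

/-- The characteristic vector of a set of numbers below `n`. -/
def wordOf (n : ℕ) (U : Finset ℕ) : Word := (List.range n).map fun i => decide (i ∈ U)

theorem sem_outProg {x : Word} {Fr T : Finset ℕ} {s : State} (h : Represents x Fr T s) :
    (outProg.sem s).buf = s.buf ++ wordOf (nOf x) T := by
  have := Prog.sem_count_induct (i := rI) (l := rN) (p := .put (.cell aSet (.reg rI)))
    (Inv := fun i u => u.arrs = s.arrs ∧
      u.buf = s.buf ++ (List.range i).map fun i => decide (i ∈ T)) (s := s) rfl (by simp) ?_
  · rw [h.ctx.n] at this
    exact this.2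
  · rintro i u hi hi' ⟨h1, h2⟩
    rw [h.ctx.n] at hi
    have := h.set i hi
    rw [List.range_succ, List.map_append]
    simp only [Prog.sem, Exp.eval, h1, hi', State.buf_setReg, State.buf_push, h2, this,
      State.arrs_setReg, State.arrs_push, true_and, List.map_cons, List.map_nil, List.append_assoc]

theorem wordOf_injOn {n : ℕ} {U V : Finset ℕ} (hU : U ⊆ Finset.range n) (hV : V ⊆ Finset.range n)
    (h : wordOf n U = wordOf n V) : U = V := by
  have key : ∀ i < n, i ∈ U ↔ i ∈ V := fun i hi => by
    have := (List.map_inj_left.1 h) i (List.mem_range.2 hi)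
    simpa using this
  ext i
  constructor
  · intro hi
    exact (key i (by simpa using hU hi)).1 hi
  · intro hi
    exact (key i (by simpa using hV hi)).2 hi

theorem Represents.outProg {x : Word} {Fr T : Finset ℕ} {s : State} (h : Represents x Fr T s) :
    Represents x Fr T { outProg.sem s with buf := [] } := by
  have ea : (EnumVC.outProg.sem s).arrs = s.arrs := by
    funext a
    exact Prog.sem_arrs_of_not_writes rfl s
  have er : ∀ {r}, EnumVC.outProg.writesReg r = false →
      (EnumVC.outProg.sem s).regs r = s.regs r := fun hr => Prog.sem_regs_of_not_writes hr s
  refine ⟨h.ctx.congr (er rfl) (er rfl) (er rfl) ?_ ?_, ?_, ?_, (er rfl).trans h.card⟩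
  · exact congrFun ea _
  · exact congrFun ea _
  · simpa [ea] using h.free
  · simpa [ea] using h.set

/-! ### Delays and the enumeration loop -/

theorem infix_none_append {A B : Trace} {w : Word} {m : ℕ}
    (h : List.replicate m none <:+: A ++ some w :: B) :
    List.replicate m none <:+: A ∨ List.replicate m none <:+: B := by
  induction A with
  | nil =>
    rcases List.infix_cons_iff.1 h with h | h
    · cases m with
      | zero => exact .inl (by simp)
      | succ m => simp [List.replicate_succ] at h
    · exact .inr h
  | cons a A ih =>
    rw [List.cons_append] at h
    rcases List.infix_cons_iff.1 h with h | h
    · left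
      rw [← List.cons_append] at h
      by_cases hm : m ≤ (a :: A).length
      · exact (List.prefix_of_prefix_length_le h (List.prefix_append _ _) (by simpa using hm)).isInfix
      · have h1 := h.getElem (i := (a :: A).length) (by simpa using hm)
        simp at h1
    · exact (ih h).imp_left fun h => List.infix_cons_iff.2 (.inr h)

theorem delayLE_append {A B : Trace} {w : Word} {d : ℕ} (hA : A.length ≤ d)
    (hB : Trace.DelayLE B d) : Trace.DelayLE (A ++ some w :: B) d := by
  intro m hm
  rcases infix_none_append hm with h | h
  · have := h.length_le
    simp only [List.length_replicate] at this
    omega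
  · exact hB m h

theorem delayLE_of_length_le {A : Trace} {d : ℕ} (hA : A.length ≤ d) : Trace.DelayLE A d := by
  intro m hm
  have := hm.length_le
  simp only [List.length_replicate] at this
  omega

/-- Output all the sets from the one in array `aSet` on. -/
def enumCmd : Cmd :=
  .loop (.reg rG) (.seq outProg.compile (.seq .emit nextProg.compile))

open Finset.Colex in
theorem enumCmd_run {x : Word} {Fr S T : Finset ℕ} {s : State} (h : Represents x Fr T s)
    (hT : Valid (nOf x) (kOf x) Fr S T) (hG : s.regs rG ≠ 0) (hb : s.buf = []) {d : ℕ}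
    (hd : nextProg.bound.eval (x.length + 1) ≤ d) :
    ∃ t s', Exec enumCmd s t s' ∧ (Trace.outputs t).Nodup ∧
      (∀ w, w ∈ Trace.outputs t ↔ ∃ U, Valid (nOf x) (kOf x) Fr S U ∧ toColex T ≤ toColex U ∧
        wordOf (nOf x) U = w) ∧
      ∀ a ≤ d, Trace.DelayLE (List.replicate a none ++ t)
        (d + (outProg.bound.eval (x.length + 1) + 2)) := by
  classical
  induction hc : ((Finset.range (nOf x)).powerset.filter fun U =>
      Valid (nOf x) (kOf x) Fr S U ∧ toColex T < toColex U).card using Nat.strong_induction_on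
      generalizing T s with
  | _ c ih =>
  have hlim : ∀ u : State, Ctx x u → ∀ l ∈ [rK, rN, rN1], u.regs l ≤ x.length + 1 := by
    intro u hu
    have := kOf_le_length x
    have := nOf_le_length x
    simp only [List.mem_cons, List.not_mem_nil, or_false, forall_eq_or_imp, forall_eq]
    rw [hu.k, hu.n, hu.n1]
    omega
  obtain ⟨m1, hm1, e1⟩ := Prog.exec_compile (L := [rK, rN, rN1]) (p := outProg) (by decide)
    (hlim s h.ctx)
  have hbuf : (outProg.sem s).buf = wordOf (nOf x) T := by rw [sem_outProg h, hb, List.nil_append]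
  set u : State := { outProg.sem s with buf := [] } with hu
  have hru : Represents x Fr T u := h.outProg
  obtain ⟨m2, hm2, e2⟩ := Prog.exec_compile (L := [rK, rN, rN1]) (p := nextProg) (by decide)
    (hlim u hru.ctx)
  have hbu : (nextProg.sem u).buf = [] := Prog.sem_buf_of_not_writes rfl u
  have hbody := Exec.seq e1 (Exec.seq (Exec.emit _) e2)
  rw [hbuf] at hbody
  -- One pass through the loop body outputs `T`; the rest of the run must list the valid sets
  -- strictly beyond `T`.
  suffices hrest : ∃ t s', Exec enumCmd (nextProg.sem u) t s' ∧ (Trace.outputs t).Nodup ∧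
      (∀ w, w ∈ Trace.outputs t ↔ ∃ U, Valid (nOf x) (kOf x) Fr S U ∧ toColex T < toColex U ∧
        wordOf (nOf x) U = w) ∧
      ∀ a ≤ d, Trace.DelayLE (List.replicate a none ++ t)
        (d + (outProg.bound.eval (x.length + 1) + 2)) by
    obtain ⟨t, s', h1, h2, h3, h4⟩ := hrest
    refine ⟨_, _, .loop_true hG hbody h1, ?_, ?_, ?_⟩
    all_goals
      have hout : Trace.outputs (none :: (List.replicate m1 none ++
          ([none, some (wordOf (nOf x) T)] ++ List.replicate m2 none) ++ t)) =
          wordOf (nOf x) T :: Trace.outputs t := by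
        simp only [Trace.outputs, List.reduceOption_cons_of_none, List.reduceOption_append,
          List.reduceOption_cons_of_some, List.cons_append, List.nil_append]
        have := outputs_replicate m1
        have := outputs_replicate m2
        simp_all [Trace.outputs]
    · rw [hout, List.nodup_cons]
      refine ⟨fun hmem => ?_, h2⟩
      obtain ⟨U, hU, hlt, e⟩ := (h3 _).1 hmem
      rw [wordOf_injOn hU.subset hT.subset e] at hlt
      exact lt_irrefl _ hlt
    · intro w
      rw [hout, List.mem_cons, h3]
      constructor
      · rintro (rfl | ⟨U, hU, hlt, e⟩)
        · exact ⟨T, hT, le_rfl, rfl⟩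
        · exact ⟨U, hU, hlt.le, e⟩
      · rintro ⟨U, hU, hle, e⟩
        rcases hle.eq_or_lt with h5 | h5
        · left
          rw [← e, toColex_inj.1 h5]
        · exact .inr ⟨U, hU, h5, e⟩
    · intro a ha
      have e : List.replicate a none ++ (none :: (List.replicate m1 none ++
          ([none, some (wordOf (nOf x) T)] ++ List.replicate m2 none) ++ t)) =
          (List.replicate a none ++ none :: (List.replicate m1 none ++ [none])) ++
            some (wordOf (nOf x) T) :: (List.replicate m2 none ++ t) := by simp
      rw [e]
      refine delayLE_append ?_ (h4 m2 (hm2.trans hd))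
      simp
      omega
  rcases sem_nextProg hru with ⟨h1, h2⟩ | ⟨h1, p, hp, hpF, hpT, hlt, hskip, hrep⟩
  · refine ⟨_, _, .loop_false h1, by simp [Trace.outputs, List.reduceOption], ?_, ?_⟩
    · intro w
      constructor
      · intro hw
        simp [Trace.outputs, List.reduceOption] at hw
      · rintro ⟨U, hU, hlt, -⟩
        exact absurd hlt (hT.not_lt_of_skip hU h2)
    · intro a ha
      refine delayLE_of_length_le ?_
      simp
      omega
  · have hT' := hT.succ hp hpF hlt
    have hTT' := lt_succ (Fr := Fr) hpT
    have hcard : ((Finset.range (nOf x)).powerset.filter fun U => Valid (nOf x) (kOf x) Fr S U ∧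
        toColex (insert p (keepFrom Fr T p)) < toColex U).card < c := by
      rw [← hc]
      refine Finset.card_lt_card ?_
      rw [Finset.ssubset_iff_of_subset]
      · refine ⟨insert p (keepFrom Fr T p), ?_, ?_⟩
        · exact Finset.mem_filter.2 ⟨Finset.mem_powerset.2 hT'.subset, hT', hTT'⟩
        · intro hmem
          exact lt_irrefl _ (Finset.mem_filter.1 hmem).2.2
      · intro U hU
        obtain ⟨a1, a2, a3⟩ := Finset.mem_filter.1 hU
        exact Finset.mem_filter.2 ⟨a1, a2, hTT'.trans a3⟩
    obtain ⟨t, s', h3, h4, h5, h6⟩ := ih _ hcard hrep hT' (by rw [h1]; simp) hbu rfl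
    refine ⟨t, s', h3, h4, fun w => (h5 w).trans ?_, h6⟩
    constructor
    · rintro ⟨U, hU, hle, e⟩
      exact ⟨U, hU, hTT'.trans_le hle, e⟩
    · rintro ⟨U, hU, hlt', e⟩
      exact ⟨U, hU, hT.succ_le hU hpT hskip hlt', e⟩

end EnumVC

namespace EnumVC

/-! ### The lifting algorithm -/

/-- Copy the solution of the compressed instance to the kept vertices. -/
def placeProg : Prog :=
  .seq (.assign rP (.lit 0)) (.count rI rN (.ite (.cell aKeep (.reg rI))
    (.seq (.store aSet (.reg rI) (.cell aSol (.reg rP))) (.assign rP (.add (.reg rP) (.lit 1))))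
    .skip))

/-- Decide whether the vertex in register `rI` is forced. -/
def forcedProg : Prog :=
  .count rJ rN (ifAdj rI rJ
    (.ite (.cell aKeep (.reg rJ)) (.ite (.cell aSet (.reg rJ)) .skip (.assign rT (.lit 1))) .skip))

/-- Add the forced vertices, and determine the free vertices. -/
def forceProg : Prog :=
  .count rI rN (.ite (.cell aKeep (.reg rI)) (.store aFree (.reg rI) (.lit 0))
    (.seq (.assign rT (.lit 0)) (.seq forcedProg (.seq (.store aSet (.reg rI) (.reg rT))
      (.store aFree (.reg rI) (.sub (.lit 1) (.reg rT)))))))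

/-- Compute the size of the set in array `aSet`. -/
def weighProg : Prog :=
  .seq (.assign rW (.lit 0)) (.count rI rN
    (.ite (.cell aSet (.reg rI)) (.assign rW (.add (.reg rW) (.lit 1))) .skip))

/-- Prepare the enumeration: compute its first set and the free vertices, and let `rG` tell whether
the first set is small enough. -/
def baseProg : Prog :=
  .seq placeProg (.seq forceProg (.seq weighProg
    (.assign rG (.sub (.lit 1) (.sub (.reg rW) (.reg rK))))))

/-- `rP` counts the kept vertices met so far, so the bits of `Y` are distributed in the numbering of
the compressed graph. -/
theorem sem_placeProg {x : Word} {s : State} (h : Ctx x s) :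
    ∀ p v, (kept x s)[p]? = some v → (placeProg.sem s).arrs aSet v = s.arrs aSol p := by
  have := Prog.sem_count_induct (i := rI) (l := rN) (p := .ite (.cell aKeep (.reg rI))
    (.seq (.store aSet (.reg rI) (.cell aSol (.reg rP))) (.assign rP (.add (.reg rP) (.lit 1))))
    .skip)
    (Inv := fun i u => u.arrs aKeep = s.arrs aKeep ∧ u.arrs aSol = s.arrs aSol ∧
      u.regs rP = ((List.range i).filter fun i => s.arrs aKeep i ≠ 0).length ∧
      ∀ p v, ((List.range i).filter fun i => s.arrs aKeep i ≠ 0)[p]? = some v →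
        u.arrs aSet v = s.arrs aSol p) (s := s.setReg rP 0) rfl ?_ ?_
  · rw [(h.setReg (r := rP) 0).n] at this
    exact this.2.2.2
  · simp
  · rintro i u hi hi' ⟨h1, h2, h3, h4⟩
    simp only [State.arrs_setReg]
    refine ⟨(Prog.sem_arrs_of_not_writes rfl u).trans h1,
      (Prog.sem_arrs_of_not_writes rfl u).trans h2, ?_⟩
    rw [List.range_succ, List.filter_append]
    by_cases h0 : s.arrs aKeep i = 0
    · have e : (Prog.ite (.cell aKeep (.reg rI))
          (.seq (.store aSet (.reg rI) (.cell aSol (.reg rP)))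
            (.assign rP (.add (.reg rP) (.lit 1)))) .skip).sem u = u := by
        simp [Prog.sem, Exp.eval, hi', h1, h0]
      rw [e, List.filter_cons_of_neg (by simpa using h0), List.filter_nil, List.append_nil]
      exact ⟨h3, h4⟩
    · have e : (Prog.ite (.cell aKeep (.reg rI))
          (.seq (.store aSet (.reg rI) (.cell aSol (.reg rP)))
            (.assign rP (.add (.reg rP) (.lit 1)))) .skip).sem u =
          (u.setArr aSet i (s.arrs aSol (u.regs rP))).setReg rP (u.regs rP + 1) := by
        simp [Prog.sem, Exp.eval, hi', h1, h0, h2]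
      rw [e]
      refine ⟨by simp [h0, h3], fun p v hp => ?_⟩
      simp only [State.arrs_setReg, State.arrs_setArr, true_and]
      rw [List.filter_cons_of_pos (by simpa using h0), List.filter_nil] at hp
      rcases Nat.lt_or_ge p (((List.range i).filter fun i => s.arrs aKeep i ≠ 0)).length with hlt | hge
      · rw [List.getElem?_append_left hlt] at hp
        have hv : v < i := by
          have := List.mem_of_getElem? hp
          simp only [List.mem_filter, List.mem_range] at this
          exact this.1
        rw [if_neg hv.ne]
        exact h4 p v hp
      · rw [List.getElem?_append_right hge] at hp
        have h5 : p - ((List.range i).filter fun i => s.arrs aKeep i ≠ 0).length = 0 := by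
          by_contra h6
          rw [List.getElem?_eq_none (by simp only [List.length_singleton]; omega)] at hp
          simp at hp
        rw [h5] at hp
        simp only [List.getElem?_cons_zero, Option.some.injEq] at hp
        rw [if_pos hp.symm, h3]
        congr 1
        omega

/-- The vertex `i` has a kept neighbor outside the set. -/
def Forced (x : Word) (keep set : ℕ → ℕ) (i : ℕ) : Prop :=
  ∃ j < nOf x, AdjN x i j ∧ keep j ≠ 0 ∧ set j = 0

theorem sem_forcedProg {x : Word} {s : State} (h : Ctx x s) (hi : s.regs rI < nOf x)
    (hT : s.regs rT = 0) :
    (forcedProg.sem s).regs rT ≠ 0 ↔ Forced x (s.arrs aKeep) (s.arrs aSet) (s.regs rI) := by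
  have := Prog.sem_count_induct (i := rJ) (l := rN) (p := ifAdj rI rJ
      (.ite (.cell aKeep (.reg rJ)) (.ite (.cell aSet (.reg rJ)) .skip (.assign rT (.lit 1))) .skip))
    (Inv := fun j u => Ctx x u ∧ u.arrs = s.arrs ∧ u.regs rI = s.regs rI ∧
      (u.regs rT ≠ 0 ↔ ∃ j' < j, AdjN x (s.regs rI) j' ∧ s.arrs aKeep j' ≠ 0 ∧ s.arrs aSet j' = 0))
    (s := s) rfl ?_ ?_
  · rw [h.n] at this
    exact this.2.2.2
  · exact ⟨h.setReg 0, rfl, by simp, by simp [hT]⟩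
  · rintro j u hj hj' ⟨h1, h2, h3, h4⟩
    rw [h.n] at hj
    refine ⟨(h1.sem rfl).setReg _, ?_, ?_, ?_⟩
    · funext a
      rw [State.arrs_setReg, Prog.sem_arrs_of_not_writes rfl, h2]
    · rw [State.regs_setReg, if_neg (by simp), Prog.sem_regs_of_not_writes rfl, h3]
    have hsplit : (∃ j' < j + 1, AdjN x (s.regs rI) j' ∧ s.arrs aKeep j' ≠ 0 ∧ s.arrs aSet j' = 0) ↔
        (u.regs rT ≠ 0 ∨ (AdjN x (s.regs rI) j ∧ s.arrs aKeep j ≠ 0 ∧ s.arrs aSet j = 0)) := by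
      rw [h4]
      constructor
      · rintro ⟨j', h5, h6⟩
        rcases Nat.lt_succ_iff_lt_or_eq.1 h5 with h7 | rfl
        · exact .inl ⟨j', h7, h6⟩
        · exact .inr h6
      · rintro (⟨j', h5, h6⟩ | h6)
        · exact ⟨j', by omega, h6⟩
        · exact ⟨j, by omega, h6⟩
    rw [hsplit, h1.sem_ifAdj _ (by omega) (by omega), h3, hj']
    by_cases ha : AdjN x (s.regs rI) j
    · by_cases hk : s.arrs aKeep j = 0
      · simp [ha, Prog.sem, Exp.eval, hj', h2, hk]
      · by_cases hs : s.arrs aSet j = 0 <;> simp [ha, Prog.sem, Exp.eval, hj', h2, hk, hs]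
    · simp [ha]

/-- Whether a vertex is forced depends on the set only at kept vertices, which this loop leaves
alone. Hence overwriting the set at deleted vertices does not affect later tests. -/
theorem sem_forceProg {x : Word} {s : State} (h : Ctx x s) :
    ∀ i < nOf x,
      (s.arrs aKeep i ≠ 0 → (forceProg.sem s).arrs aSet i = s.arrs aSet i ∧
        (forceProg.sem s).arrs aFree i = 0) ∧
      (s.arrs aKeep i = 0 →
        ((forceProg.sem s).arrs aSet i ≠ 0 ↔ Forced x (s.arrs aKeep) (s.arrs aSet) i) ∧
        ((forceProg.sem s).arrs aFree i ≠ 0 ↔ ¬ Forced x (s.arrs aKeep) (s.arrs aSet) i)) := by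
  have := Prog.sem_count_induct (i := rI) (l := rN)
    (p := .ite (.cell aKeep (.reg rI)) (.store aFree (.reg rI) (.lit 0))
    (.seq (.assign rT (.lit 0)) (.seq forcedProg (.seq (.store aSet (.reg rI) (.reg rT))
      (.store aFree (.reg rI) (.sub (.lit 1) (.reg rT)))))))
    (Inv := fun i u => Ctx x u ∧ u.arrs aKeep = s.arrs aKeep ∧
      (∀ j, s.arrs aKeep j ≠ 0 → u.arrs aSet j = s.arrs aSet j) ∧
      ∀ j < i, (s.arrs aKeep j ≠ 0 → u.arrs aFree j = 0) ∧
      (s.arrs aKeep j = 0 →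
        (u.arrs aSet j ≠ 0 ↔ Forced x (s.arrs aKeep) (s.arrs aSet) j) ∧
        (u.arrs aFree j ≠ 0 ↔ ¬ Forced x (s.arrs aKeep) (s.arrs aSet) j))) (s := s) rfl ?_ ?_
  · rw [h.n] at this
    obtain ⟨-, -, h2, h3⟩ := this
    exact fun i hi => ⟨fun hk => ⟨h2 i hk, (h3 i hi).1 hk⟩, (h3 i hi).2⟩
  · exact ⟨h.setReg 0, rfl, by simp, by simp⟩
  · rintro i u hi hi' ⟨h1, h2, h3, h4⟩
    rw [h.n] at hi
    refine ⟨(h1.sem rfl).setReg _, (Prog.sem_arrs_of_not_writes rfl u).trans h2, ?_⟩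
    simp only [State.arrs_setReg]
    by_cases hk : s.arrs aKeep i = 0
    · set v := forcedProg.sem (u.setReg rT 0) with hv
      have e : (Prog.ite (.cell aKeep (.reg rI)) (.store aFree (.reg rI) (.lit 0))
          (.seq (.assign rT (.lit 0)) (.seq forcedProg (.seq (.store aSet (.reg rI) (.reg rT))
          (.store aFree (.reg rI) (.sub (.lit 1) (.reg rT))))))).sem u =
          (v.setArr aSet i (v.regs rT)).setArr aFree i (1 - v.regs rT) := by
        have hvI : v.regs rI = i := by
          rw [hv, Prog.sem_regs_of_not_writes rfl]
          simpa using hi'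
        simp [Prog.sem, Exp.eval, hi', h2, hk, ← hv, hvI]
      have hva : v.arrs = u.arrs := by
        funext a
        exact Prog.sem_arrs_of_not_writes rfl _
      have hvT := sem_forcedProg (h1.setReg (r := rT) 0) (by simp [hi', hi]) (by simp)
      rw [← hv] at hvT
      have hF : Forced x ((u.setReg rT 0).arrs aKeep) ((u.setReg rT 0).arrs aSet)
          ((u.setReg rT 0).regs rI) ↔ Forced x (s.arrs aKeep) (s.arrs aSet) i := by
        simp only [State.arrs_setReg, State.regs_setReg, Nat.reduceEqDiff, reduceIte, hi', h2, Forced]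
        refine exists_congr fun j => and_congr_right fun hj => and_congr_right fun _ =>
          and_congr_right fun hkj => ?_
        rw [h3 j hkj]
      rw [hF] at hvT
      rw [e]
      constructor
      · intro j hj
        have hji : j ≠ i := fun e => hj (e ▸ hk)
        simpa [hva, hji] using h3 j hj
      · intro j hj
        rcases Nat.lt_succ_iff_lt_or_eq.1 hj with hj | rfl
        · simpa [hva, hj.ne] using h4 j hj
        · simp [hk, ← hvT]
          omega
    · have e : (Prog.ite (.cell aKeep (.reg rI)) (.store aFree (.reg rI) (.lit 0))
          (.seq (.assign rT (.lit 0)) (.seq forcedProg (.seq (.store aSet (.reg rI) (.reg rT))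
          (.store aFree (.reg rI) (.sub (.lit 1) (.reg rT))))))).sem u = u.setArr aFree i 0 := by
        simp [Prog.sem, Exp.eval, hi', h2, hk]
      rw [e]
      constructor
      · intro j hj
        simpa using h3 j hj
      · intro j hj
        rcases Nat.lt_succ_iff_lt_or_eq.1 hj with hj | rfl
        · simpa [hj.ne] using h4 j hj
        · simp [hk]

theorem sem_weighProg {x : Word} {s : State} (h : Ctx x s) :
    (weighProg.sem s).regs rW = ((Finset.range (nOf x)).filter fun i => s.arrs aSet i ≠ 0).card := by
  have := Prog.sem_count_induct (i := rI) (l := rN)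
    (p := .ite (.cell aSet (.reg rI)) (.assign rW (.add (.reg rW) (.lit 1))) .skip)
    (Inv := fun i u => u.arrs = s.arrs ∧
      u.regs rW = ((Finset.range i).filter fun i => s.arrs aSet i ≠ 0).card)
    (s := s.setReg rW 0) rfl ?_ ?_
  · rw [(h.setReg (r := rW) 0).n] at this
    exact this.2
  · exact ⟨rfl, by simp⟩
  · rintro i u hi hi' ⟨h1, h2⟩
    rw [Finset.range_add_one, Finset.filter_insert]
    by_cases h0 : s.arrs aSet i = 0 <;> simp [Prog.sem, Exp.eval, hi', h1, h0, h2]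

/-- The first set of the enumeration and the free vertices. -/
structure IsBase (x : Word) (l : List ℕ) (sol : ℕ → ℕ) (S Fr : Finset ℕ) : Prop where
  subset : S ⊆ Finset.range (nOf x)
  place : ∀ p v, l[p]? = some v → (v ∈ S ↔ sol p ≠ 0)
  forced : ∀ i < nOf x, i ∉ l → (i ∈ S ↔ ∃ j ∈ l, AdjN x i j ∧ j ∉ S)
  free : ∀ i < nOf x, i ∈ Fr ↔ i ∉ l ∧ i ∉ S

theorem sem_baseProg {x : Word} {s : State} (h : Ctx x s) :
    ∃ S Fr : Finset ℕ, IsBase x (kept x s) (s.arrs aSol) S Fr ∧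
      Represents x Fr S (baseProg.sem s) ∧
      ((baseProg.sem s).regs rG ≠ 0 ↔ S.card ≤ kOf x) := by
  set s1 := placeProg.sem s with hs1
  set s2 := forceProg.sem s1 with hs2
  have c1 : Ctx x s1 := h.sem rfl
  have c2 : Ctx x s2 := c1.sem rfl
  have c3 : Ctx x (weighProg.sem s2) := c2.sem rfl
  have hplace := sem_placeProg h
  have hforce := sem_forceProg c1
  have hweigh := sem_weighProg c2
  have hk1 : s1.arrs aKeep = s.arrs aKeep := Prog.sem_arrs_of_not_writes rfl s
  rw [← hs1] at hplace
  rw [← hs2, hk1] at hforce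
  have ebase : baseProg.sem s = (weighProg.sem s2).setReg rG
      (1 - ((weighProg.sem s2).regs rW - kOf x)) := by
    simp only [baseProg, Prog.sem, Exp.eval, ← hs1, ← hs2, c3.k]
  have earr : ∀ a, (weighProg.sem s2).arrs a = s2.arrs a := fun a =>
    Prog.sem_arrs_of_not_writes rfl s2
  set S := (Finset.range (nOf x)).filter fun i => s2.arrs aSet i ≠ 0 with hS
  set Fr := (Finset.range (nOf x)).filter fun i => s2.arrs aFree i ≠ 0 with hFr
  have memS : ∀ i < nOf x, i ∈ S ↔ s2.arrs aSet i ≠ 0 := fun i hi => by simp [hS, hi]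
  have memFr : ∀ i < nOf x, i ∈ Fr ↔ s2.arrs aFree i ≠ 0 := fun i hi => by simp [hFr, hi]
  refine ⟨S, Fr, ⟨Finset.filter_subset _ _, ?_, ?_, ?_⟩, ?_, ?_⟩
  · intro p v hp
    obtain ⟨hv, hk⟩ := mem_kept.1 (List.mem_of_getElem? hp)
    rw [memS v hv, ((hforce v hv).1 hk).1, hplace p v hp]
  · intro i hi hil
    have hk : s.arrs aKeep i = 0 := by
      by_contra hk
      exact hil (mem_kept.2 ⟨hi, hk⟩)
    rw [memS i hi, ((hforce i hi).2 hk).1, Forced]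
    constructor
    · rintro ⟨j, hj, hadj, hkj, h0⟩
      refine ⟨j, mem_kept.2 ⟨hj, hkj⟩, hadj, ?_⟩
      rw [memS j hj, ((hforce j hj).1 hkj).1, h0]
      simp
    · rintro ⟨j, hj, hadj, h0⟩
      obtain ⟨hj, hkj⟩ := mem_kept.1 hj
      refine ⟨j, hj, hadj, hkj, ?_⟩
      rw [memS j hj, ((hforce j hj).1 hkj).1] at h0
      simpa using h0
  · intro i hi
    rw [memFr i hi, memS i hi, mem_kept]
    by_cases hk : s.arrs aKeep i = 0
    · have := (hforce i hi).2 hk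
      rw [this.1, this.2]
      simp [hk]
    · have := (hforce i hi).1 hk
      simp [this.2, hk, hi]
  · rw [ebase]
    refine (Represents.mk c3 ?_ ?_ hweigh).setReg _
    · intro i hi
      rw [memFr i hi, earr]
    · intro i hi
      rw [memS i hi, earr]
  · rw [ebase, State.regs_setReg, if_pos rfl, hweigh]
    omega

/-- The lifting algorithm. -/
def liftCmd : Cmd :=
  .seq setupProg.compile (.seq (Prog.seq reduceProg baseProg).compile enumCmd)

/-- The delay of the lifting algorithm. -/
noncomputable def liftDelay : Polynomial ℕ :=
  setupProg.bound + ((Prog.seq reduceProg baseProg).bound + nextProg.bound + outProg.bound + 3).comp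
    (Polynomial.X + 1)

open Finset.Colex in
theorem liftCmd_run (x y Y : Word) (k k' : ℕ) :
    ∃ S Fr : Finset ℕ, IsBase x (keptList x) (fun p => (Y.getD p false).toNat) S Fr ∧
      ∃ t s, Exec liftCmd (State.init [x, y, Y] [k, k']) t s ∧ (Trace.outputs t).Nodup ∧
        (∀ w, w ∈ Trace.outputs t ↔ ∃ U, Valid (nOf x) (kOf x) Fr S U ∧ wordOf (nOf x) U = w) ∧
        Trace.DelayLE t (liftDelay.eval (x.length + y.length + Y.length + k + k')) := by
  set N := x.length + y.length + Y.length + k + k' with hN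
  have hag := init_agree x [y, Y] [k, k'] (by simp) (by simp)
  obtain ⟨c0, c1, -⟩ := ctx_of_agree hag
  have hr := agree_redState hag
  set s0 := State.init [x, y, Y] [k, k'] with hs0
  set s1 := reduceProg.sem (setupProg.sem s0) with hs1
  have hkept : kept x s1 = keptList x := by
    unfold keptList kept
    rw [hr.arrs aKeep rfl]
  have hsol : s1.arrs aSol = fun p => (Y.getD p false).toNat := by
    rw [hs1]
    refine (Prog.sem_arrs_of_not_writes (p := .seq setupProg reduceProg) rfl s0).trans ?_
    funext p
    simp [hs0, State.init]
  obtain ⟨S, Fr, hbase, hrep, hG⟩ := sem_baseProg c1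
  rw [hkept, hsol] at hbase
  have hbuf : (baseProg.sem s1).buf = [] :=
    Prog.sem_buf_of_not_writes (p := .seq (.seq setupProg reduceProg) baseProg) rfl s0
  obtain ⟨m, hm, e⟩ := Prog.exec_compile (L := [0]) (p := setupProg) (by decide)
    (N := N) (s := s0) (by simp [hs0, State.init, hN]; omega)
  obtain ⟨m', hm', e'⟩ := Prog.exec_compile (L := [rK, rN, rN1])
    (p := .seq reduceProg baseProg) (by decide)
    (N := N + 1) (s := setupProg.sem s0) (by
      have := kOf_le_length x
      have := nOf_le_length x
      simp only [List.mem_cons, List.not_mem_nil, or_false, forall_eq_or_imp, forall_eq]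
      rw [c0.k, c0.n, c0.n1]
      omega)
  have hD : liftDelay.eval N = setupProg.bound.eval N +
      ((Prog.seq reduceProg baseProg).bound.eval (N + 1) + nextProg.bound.eval (N + 1) +
        outProg.bound.eval (N + 1) + 3) := by
    simp [liftDelay]
  have hnext := Prog.eval_mono nextProg.bound (show x.length + 1 ≤ N + 1 by omega)
  have hout := Prog.eval_mono outProg.bound (show x.length + 1 ≤ N + 1 by omega)
  -- The base set has no free elements, so every valid set contains it. It is therefore the
  -- colexicographically least candidate, and if it is too large there is nothing to output.
  have hSU : ∀ U, Valid (nOf x) (kOf x) Fr S U → S ⊆ U := by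
    intro U hU i hi
    have hin : i < nOf x := by simpa using hbase.subset hi
    exact (hU.agree i hin fun hF => ((hbase.free i hin).1 hF).2 hi).2 hi
  refine ⟨S, Fr, hbase, ?_⟩
  by_cases hle : S.card ≤ kOf x
  · have hS : Valid (nOf x) (kOf x) Fr S S := ⟨hbase.subset, hle, fun _ _ _ => Iff.rfl⟩
    obtain ⟨t, s', h1, h2, h3, h4⟩ := enumCmd_run
      (d := setupProg.bound.eval N + (Prog.seq reduceProg baseProg).bound.eval (N + 1) +
        nextProg.bound.eval (N + 1)) hrep hS (hG.2 hle) hbuf (by omega)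
    have eo : Trace.outputs (List.replicate m none ++ (List.replicate m' none ++ t)) =
        Trace.outputs t := by
      rw [outputs_append, outputs_append, outputs_replicate, outputs_replicate]
      rfl
    refine ⟨_, _, .seq e (.seq e' h1), ?_, ?_, ?_⟩
    · rwa [eo]
    · intro w
      rw [eo, h3]
      constructor
      · rintro ⟨U, hU, -, e⟩
        exact ⟨U, hU, e⟩
      · rintro ⟨U, hU, e⟩
        exact ⟨U, hU, toColex_le_toColex_of_subset (hSU U hU), e⟩
    -- Parsing, reduction and preparation form the silent prefix before the first output.
    · have := h4 (m + m') (by omega)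
      rw [List.replicate_add, List.append_assoc] at this
      intro a ha
      have := this a ha
      omega
  · have h0 : (Exp.reg rG).eval (baseProg.sem s1) = 0 := by
      by_contra h
      exact hle (hG.1 h)
    have eo : Trace.outputs (List.replicate m none ++ (List.replicate m' none ++ [none])) = [] := by
      rw [outputs_append, outputs_append, outputs_replicate, outputs_replicate]
      rfl
    refine ⟨_, _, .seq e (.seq e' (.loop_false h0)), ?_, ?_, ?_⟩
    · simp [eo]
    · intro w
      rw [eo]
      constructor
      · intro h
        simp at h
      · rintro ⟨U, hU, -⟩
        exact absurd ((Finset.card_le_card (hSU U hU)).trans hU.card_le) hle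
    · refine delayLE_of_length_le ?_
      simp
      omega

/-! ### The lifted solutions -/

/-- The sets `F` and `Z` are determined by `T` and `Y`, so they can be eliminated. The resulting
conditions on `T` alone are what the enumeration is compared with. -/
theorem mem_lifted_iff {I J : Instance} {φ : J.graph ↪g I.graph} {Y : Finset (Fin J.n)}
    {T : Finset (Fin I.n)} :
    T ∈ lifted I J φ Y ↔ T.card ≤ I.k ∧ (∀ u, φ u ∈ T ↔ u ∈ Y) ∧
      ∀ v ∉ Set.range φ, (∃ u, u ∉ Y ∧ I.graph.Adj v (φ u)) → v ∈ T := by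
  classical
  constructor
  · intro hT
    have hY := eq_preimage_of_mem_lifted hT
    obtain ⟨hk, F, Z, hF, hZ, rfl⟩ := hT
    refine ⟨hk, fun u => ?_, fun v hv hu => ?_⟩
    · conv_rhs => rw [hY]
      simp
    · have := (hF v).2 ⟨hv, hu⟩
      simp [this]
  · rintro ⟨hk, hY, hF⟩
    refine ⟨hk, Finset.univ.filter fun v => v ∉ Set.range φ ∧ ∃ u, u ∉ Y ∧ I.graph.Adj v (φ u),
      T.filter fun v => v ∉ Set.range φ ∧ ¬ ∃ u, u ∉ Y ∧ I.graph.Adj v (φ u), ?_, ?_, ?_⟩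
    · intro v
      simp
    · intro v hv
      obtain ⟨-, h1, h2⟩ := Finset.mem_filter.1 hv
      exact ⟨h1, fun h => h2 (Finset.mem_filter.1 h).2.2⟩
    · ext v
      simp only [Finset.mem_union, Finset.mem_image, Finset.mem_filter, Finset.mem_univ, true_and]
      constructor
      · intro hv
        by_cases hr : v ∈ Set.range φ
        · obtain ⟨u, rfl⟩ := hr
          exact .inl (.inl ⟨u, (hY u).1 hv, rfl⟩)
        · by_cases hf : ∃ u, u ∉ Y ∧ I.graph.Adj v (φ u)
          · exact .inl (.inr ⟨hr, hf⟩)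
          · exact .inr ⟨hv, hr, hf⟩
      · rintro ((⟨u, hu, rfl⟩ | ⟨h1, h2⟩) | h)
        · exact (hY u).2 hu
        · exact hF v h1 h2
        · exact h.1

theorem wordOf_map {n : ℕ} (T : Finset (Fin n)) :
    wordOf n (T.map Fin.valEmbedding) = charVec T := by
  unfold wordOf charVec
  rw [← List.map_coe_finRange_eq_range, List.map_map, List.ofFn_eq_map]
  exact List.map_congr_left fun i _ => decide_eq_decide.2 (Finset.mem_map' Fin.valEmbedding)

/-- The non-free vertices are the kept ones, where the base set is the image of `Y`, and the forced
ones, which it contains. Agreement with the base set there says exactly that `T` restricts to `Y`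
and contains every forced vertex. -/
theorem valid_iff_extends {x : Word} {y : Word} {φ : graphOf y ↪g graphOf x}
    {l : List ℕ} (hn : nOf y = l.length) (hl : ∀ i ∈ l, i < nOf x)
    (hφ : ∀ i, ((φ i : Fin (nOf x)) : ℕ) = l.getD i 0)
    {Y : Finset (Fin (nOf y))} {S Fr : Finset ℕ}
    (hb : IsBase x l (fun p => ((charVec Y).getD p false).toNat) S Fr) (T : Finset (Fin (nOf x))) :
    Valid (nOf x) (kOf x) Fr S (T.map Fin.valEmbedding) ↔
      T.card ≤ kOf x ∧ (∀ u, φ u ∈ T ↔ u ∈ Y) ∧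
        ∀ v ∉ Set.range φ, (∃ u, u ∉ Y ∧ (graphOf x).Adj v (φ u)) → v ∈ T := by
  have memT : ∀ i : Fin (nOf x), (i : ℕ) ∈ T.map Fin.valEmbedding ↔ i ∈ T := fun i =>
    Finset.mem_map' Fin.valEmbedding
  have hget : ∀ u : Fin (nOf y), l[(u : ℕ)]? = some ((φ u : Fin (nOf x)) : ℕ) := fun u => by
    rw [hφ, List.getD_eq_getElem _ _ (hn ▸ u.2), List.getElem?_eq_getElem]
  have hφl : ∀ u : Fin (nOf y), ((φ u : Fin (nOf x)) : ℕ) ∈ l := fun u =>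
    List.mem_of_getElem? (hget u)
  have hrange : ∀ i : Fin (nOf x), i ∈ Set.range φ ↔ (i : ℕ) ∈ l := fun i => by
    constructor
    · rintro ⟨u, rfl⟩
      exact hφl u
    · intro hi
      obtain ⟨j, hj, e⟩ := List.getElem_of_mem hi
      refine ⟨⟨j, hn ▸ hj⟩, Fin.ext ?_⟩
      rw [hφ, List.getD_eq_getElem _ _ hj]
      exact e
  have hφS : ∀ u : Fin (nOf y), ((φ u : Fin (nOf x)) : ℕ) ∈ S ↔ u ∈ Y := fun u => by
    rw [hb.place _ _ (hget u), charVec_getD]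
    simp
  have hforced : ∀ i : Fin (nOf x), i ∉ Set.range φ →
      ((i : ℕ) ∈ S ↔ ∃ u, u ∉ Y ∧ (graphOf x).Adj i (φ u)) := fun i hi => by
    rw [hb.forced i i.2 fun h => hi ((hrange i).2 h)]
    constructor
    · rintro ⟨j, hj, hadj, hjS⟩
      obtain ⟨u, hu⟩ := (hrange ⟨j, hl j hj⟩).2 hj
      have hu' : ((φ u : Fin (nOf x)) : ℕ) = j := congrArg Fin.val hu
      refine ⟨u, fun h => hjS (hu' ▸ (hφS u).2 h), graphOf_adj.2 ?_⟩
      rwa [hu']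
    · rintro ⟨u, hu, hadj⟩
      exact ⟨_, hφl u, graphOf_adj.1 hadj, fun h => hu ((hφS u).1 h)⟩
  have hfree : ∀ i : Fin (nOf x), (i : ℕ) ∈ Fr ↔ i ∉ Set.range φ ∧ (i : ℕ) ∉ S := fun i => by
    rw [hb.free i i.2, hrange]
  constructor
  · intro h
    refine ⟨by simpa using h.card_le, fun u => ?_, fun v hv hu => ?_⟩
    · rw [← hφS u, ← h.agree _ (Fin.isLt _) fun hF => ((hfree _).1 hF).1 ⟨u, rfl⟩, memT]
    · have hvS := (hforced v hv).2 hu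
      rw [← memT v, h.agree _ (Fin.isLt _) fun hF => ((hfree v).1 hF).2 hvS]
      exact hvS
  · rintro ⟨h1, h2, h3⟩
    refine ⟨?_, by simpa using h1, ?_⟩
    · intro i hi
      obtain ⟨j, -, rfl⟩ := Finset.mem_map.1 hi
      simp
    · intro i hi hiF
      rw [memT ⟨i, hi⟩]
      by_cases hr : (⟨i, hi⟩ : Fin (nOf x)) ∈ Set.range φ
      · obtain ⟨u, hu⟩ := hr
        have e : ((φ u : Fin (nOf x)) : ℕ) = i := congrArg Fin.val hu
        rw [← hu, ← e, hφS]
        exact h2 u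
      · have hiS : i ∈ S := by
          by_contra hiS
          exact hiF ((hfree ⟨i, hi⟩).2 ⟨hr, hiS⟩)
        refine ⟨fun _ => hiS, fun _ => ?_⟩
        exact h3 _ hr ((hforced ⟨i, hi⟩ hr).1 hiS)

/-- The run exists for every word `Y`, solution or not, so its list of outputs can be chosen as a
total function without any appeal to determinism of the machine. -/
theorem exists_lift (x Y : Word) :
    ∃ o : List Word, (∃ t s, Exec liftCmd
        (State.init [x, compress x, Y] [kOf x, kOf (compress x)]) t s ∧ Trace.outputs t = o ∧
        Trace.DelayLE t (liftDelay.eval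
          (x.length + (compress x).length + Y.length + kOf x + kOf (compress x)))) ∧
      o.Nodup ∧ ∃ S Fr : Finset ℕ,
        IsBase x (keptList x) (fun p => (Y.getD p false).toNat) S Fr ∧
        ∀ w, w ∈ o ↔ ∃ U, Valid (nOf x) (kOf x) Fr S U ∧ wordOf (nOf x) U = w := by
  obtain ⟨S, Fr, hb, t, s, h1, h2, h3, h4⟩ := liftCmd_run x (compress x) Y (kOf x) (kOf (compress x))
  exact ⟨_, ⟨t, s, h1, rfl, h4⟩, h2, S, Fr, hb, h3⟩

/-- The solutions listed by the lifting algorithm. -/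
noncomputable def lift (x Y : Word) : List Word := (exists_lift x Y).choose

theorem mem_lift {x : Word} {φ : (decode (compress x)).graph ↪g (decode x).graph}
    (hn : nOf (compress x) = (keptList x).length)
    (hφ : ∀ i, ((φ i : Fin (nOf x)) : ℕ) = (keptList x).getD i 0)
    (Y : Finset (Fin (nOf (compress x)))) (w : Word) :
    w ∈ lift x (charVec Y) ↔
      ∃ T ∈ lifted (decode x) (decode (compress x)) φ Y, charVec T = w := by
  obtain ⟨-, -, S, Fr, hb, h⟩ := (exists_lift x (charVec Y)).choose_spec
  have key : ∀ T : Finset (Fin (nOf x)), Valid (nOf x) (kOf x) Fr S (T.map Fin.valEmbedding) ↔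
      T ∈ lifted (decode x) (decode (compress x)) φ Y := fun T =>
    (valid_iff_extends hn (fun i hi => (mem_kept.1 hi).1) hφ hb T).trans
      (mem_lifted_iff (I := decode x) (J := decode (compress x))).symm
  rw [lift, h]
  constructor
  · rintro ⟨U, hU, rfl⟩
    have e : (Finset.univ.filter fun i : Fin (nOf x) => (i : ℕ) ∈ U).map Fin.valEmbedding = U := by
      ext i
      simp only [Finset.mem_map, Finset.mem_filter, Finset.mem_univ, true_and,
        Fin.valEmbedding_apply]
      constructor
      · rintro ⟨j, hj, rfl⟩
        exact hj
      · intro hi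
        exact ⟨⟨i, by simpa using hU.subset hi⟩, hi, rfl⟩
    rw [← e] at hU ⊢
    exact ⟨_, (key _).1 hU, (wordOf_map _).symm⟩
  · rintro ⟨T, hT, rfl⟩
    exact ⟨_, (key T).2 hT, wordOf_map T⟩

theorem lift_disjoint {x Y Y' : Word} (hY : Y ∈ sol (compress x)) (hY' : Y' ∈ sol (compress x))
    (hne : Y ≠ Y') : (lift x Y).Disjoint (lift x Y') := by
  rcases compress_cases x with ⟨-, -, h⟩ | ⟨hn, φ, -, hφ⟩
  · rw [h, sol_failWord] at hY
    simp at hY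
  · obtain ⟨Y, rfl⟩ := exists_of_mem_sol hY
    obtain ⟨Y', rfl⟩ := exists_of_mem_sol hY'
    intro w h1 h2
    obtain ⟨T, hT, e⟩ := (mem_lift hn hφ Y w).1 h1
    obtain ⟨T', hT', e'⟩ := (mem_lift hn hφ Y' w).1 h2
    obtain rfl : T = T' := charVec_injective (e.trans e'.symm)
    exact hne (congrArg charVec
      ((eq_preimage_of_mem_lifted hT).trans (eq_preimage_of_mem_lifted hT').symm))

theorem mem_sol_iff_exists_lift (x w : Word) :
    w ∈ sol x ↔ ∃ Y ∈ sol (compress x), w ∈ lift x Y := by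
  rcases compress_cases x with ⟨-, h1, h2⟩ | ⟨hn, φ, h, hφ⟩
  · simp [h1, h2, sol_failWord]
  · have hk : kOf (compress x) = kOf x := h.k_eq
    constructor
    · intro hw
      obtain ⟨S, rfl⟩ := exists_of_mem_sol hw
      obtain ⟨h3, h4⟩ := charVec_mem_sol.1 hw
      refine ⟨_, charVec_mem_sol.2
        ⟨isVertexCover_preimage (I := decode x) (J := decode (compress x)) (φ := φ) (S := S) h3, ?_⟩,
        (mem_lift hn hφ _ _).2 ⟨S, mem_lifted_preimage (I := decode x) h3 h4, rfl⟩⟩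
      rw [hk]
      exact (card_preimage_le (I := decode x) (J := decode (compress x)) (φ := φ) S).trans h4
    · rintro ⟨Y, hY, hw⟩
      obtain ⟨Y, rfl⟩ := exists_of_mem_sol hY
      obtain ⟨T, hT, rfl⟩ := (mem_lift hn hφ Y w).1 hw
      exact charVec_mem_sol.2
        ⟨h.lifted_isVertexCover (charVec_mem_sol.1 hY).1 hT, (mem_lifted_iff.1 hT).1⟩

/-! ### The kernel and its properties -/

/-- The polynomial-delay kernel for Enum Vertex Cover. -/
noncomputable def kernel : PDKernel enumVertexCover where
  compress := compress
  lift := lift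
  compressProg := compressCmd
  liftProg := liftCmd
  time := compressTime
  delay := liftDelay
  size := kernelSize
  size_computable := computable_kernelSize
  compress_run x := compressCmd_run x (kOf x)
  κ_compress_le x := (kOf_compress_le x).trans (by
    change kOf x ≤ kernelSize (kOf x)
    unfold kernelSize
    omega)
  length_compress_le := length_compress_le
  sol_compress_nonempty_iff := sol_compress_nonempty_iff
  lift_run x Y _ := (exists_lift x Y).choose_spec.1
  lift_nodup x Y _ := (exists_lift x Y).choose_spec.2.1
  lift_disjoint _ _ hY _ hY' hne := lift_disjoint hY hY' hne
  lift_cover := mem_sol_iff_exists_lift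

theorem nOf_failWord : nOf failWord = 2 := by decide

end EnumVC

theorem mainTheorem4 :
    ∃ K : PDKernel enumVertexCover, ∀ x : Word,
      ((EnumVC.decode (K.compress x)).n ≤ 3 * (EnumVC.decode x).k ∨
        ((EnumVC.decode x).k = 0 ∧ EnumVC.sol x = ∅ ∧ (EnumVC.decode (K.compress x)).n = 2)) ∧
      ((3 * (EnumVC.decode x).k < (EnumVC.decode x).graph.support.ncard ∧ EnumVC.sol x = ∅ ∧
          (EnumVC.decode (K.compress x)).n = 2 ∧ (EnumVC.decode (K.compress x)).graph = ⊤ ∧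
          (EnumVC.decode (K.compress x)).k = 0) ∨
        ∃ φ : (EnumVC.decode (K.compress x)).graph ↪g (EnumVC.decode x).graph,
          EnumVC.IsCrownReduction (EnumVC.decode x) (EnumVC.decode (K.compress x)) φ ∧
          ∀ Y : Finset (Fin (EnumVC.decode (K.compress x)).n),
            EnumVC.charVec Y ∈ EnumVC.sol (K.compress x) →
            ∀ S : Word, S ∈ K.lift x (EnumVC.charVec Y) ↔
              ∃ T ∈ EnumVC.lifted (EnumVC.decode x) (EnumVC.decode (K.compress x)) φ Y,
                EnumVC.charVec T = S) := by
  refine ⟨EnumVC.kernel, fun x => ?_⟩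
  change ((EnumVC.decode (EnumVC.compress x)).n ≤ 3 * EnumVC.kOf x ∨ (EnumVC.kOf x = 0 ∧
    EnumVC.sol x = ∅ ∧ (EnumVC.decode (EnumVC.compress x)).n = 2)) ∧ _
  rcases EnumVC.compress_cases x with ⟨h1, h2, h3⟩ | ⟨hn, φ, h, hφ⟩
  · refine ⟨?_, .inl ⟨h1, h2, ?_⟩⟩
    · rw [h3, EnumVC.decode_n, EnumVC.nOf_failWord]
      -- The two vertices of `K₂` respect the bound `3k` unless `k = 0`.
      rcases Nat.eq_zero_or_pos (EnumVC.kOf x) with h0 | h0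
      · exact .inr ⟨h0, h2, rfl⟩
      · left; omega
    · change (EnumVC.decode (EnumVC.compress x)).n = 2 ∧
        (EnumVC.decode (EnumVC.compress x)).graph = ⊤ ∧ (EnumVC.decode (EnumVC.compress x)).k = 0
      rw [h3]
      exact ⟨EnumVC.nOf_failWord, EnumVC.failWord_graph, rfl⟩
  · exact ⟨.inl h.card_le, .inr ⟨φ, h, fun Y _ S => EnumVC.mem_lift hn hφ Y S⟩⟩
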